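/- **Positive hypergraphs and opetopes.** A *positive hypergraph* $S$ consists of finite sets $S_k$ of faces ($k\ge 0$, only finitely many of them non-empty), functions $\gamma:S_{k+1}\to S_k$ and total relations $\delta:S_{k+1}\to S_k$ (so $\delta(a)\subseteq S_k$ is a non-empty set for $a\in S_{k+1}$), where $\delta:S_1\to S_0$ is a function. Write $\gamma\delta(a)=\{\gamma(b): b\in\delta(a)\}$, $\delta\delta(a)=\bigcup_{b\in\delta(a)}\delta(b)$, $\partial(a)=\{\gamma(a)\}\cup\delta(a)$, and for $p\in S_l$ let $\gamma^{(k)}(p)\in S_k$ be the iterated codomain if $l\geq k$ (and $p$ itself if $l\le k$). On $S_k$, $k>0$, let $<^-$ be the transitive closure of the relation "$\gamma(a)\in\delta(b)$"; on $S_k$, $k\ge0$, let $<^+$ be the transitive closure of the relation "there is $\alpha\in S_{k+1}$ with $a\in\delta(\alpha)$ and $\gamma(\alpha)=b$". Let $a\le^+b$ mean $a=b$ or $a<^+b$; for a set $A$ of faces, $a\le^+ A$ means $a\le^+t$ for some $t\in A$. $S$ is a *positive opetope* if $S_0\ne\emptyset$ and 1. (globularity) $\{\gamma\gamma(a)\}=\gamma\delta(a)\setminus\delta\delta(a)$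 and $\delta\gamma(a)=\delta\delta(a)\setminus\gamma\delta(a)$ for all faces $a$ of dimension $\ge2$; 2. (strictness) every $<^+$ is a strict order, and $<^+$ is linear on $S_0$; 3. (disjointness) for $k>0$, no two faces of $S_k$ are comparable both for $<^-$ and for $<^+$; 4. (pencil linearity) for $k>0$ and $x\in S_{k-1}$, the sets $\{a\in S_k: x=\gamma(a)\}$ and $\{a\in S_k: x\in\delta(a)\}$ are linearly ordered by $<^+$; 5. $|S_l\setminus\delta(S_{l+1})|\le1$ for all $l$. **Flags.** Let $P$ be a positive opetope of dimension $n$. A *flag* $\vec x=[x_k,\dots,x_0]$ under $x_k$ is a sequence with $x_i\in P_i$ and $x_i\in\partial(x_{i+1})$ for $i<k$; it is *maximal* if $k=n$. Let $\mathrm{sgn}[x_0]=1$, and $\mathrm{sgn}[x_k,\dots,x_0]=\pm\mathrm{sgn}[x_{k-1},\dots,x_0]$ with sign $+$ if $x_{k-1}=\gamma(x_k)$ and $-$ if $x_{k-1}\in\delta(x_k)$. For faces $a,b$ with $x\in\partial(a)\cap\partial(b)$, let $a\prec_x b$ if $\gamma(b)=x\in\delta(a)$, or $x\in\delta(a)\cap\delta(b)$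 and $a<^+b$, or $\gamma(a)=x=\gamma(b)$ and $b<^+a$. Flags under $x_k$ are ordered as follows: if $j$ is the least index with $x_j\ne y_j$, then $\vec x\lhd\vec y$ iff $j=0$ and $y_0<^+x_0$, or $j>0$, $\mathrm{sgn}[x_{j-1},\dots,x_0]=1$ and $x_j\prec_{x_{j-1}}y_j$, or $j>0$, $\mathrm{sgn}[x_{j-1},\dots,x_0]=-1$ and $y_j\prec_{x_{j-1}}x_j$. *First* and *last* flags under $x_k$ refer to $\lhd$. Write $\vec x_{(i)}$ for $\vec x$ with the entry $x_i$ replaced by a dummy $0$ (for $i=k$ the top entry, together with a possible $0$ just below it, is dropped), and $\vec x_{\lceil m}$ for $\vec x$ with the entries in dimensions above $m$ dropped. For a flag $\vec x=[x_k,\dots,x_0]$, $k>1$, that is neither first nor last, let $\ell(\vec x)=\max\{i<k-1: x_{i+1}\in\delta(x_{i+2})\}$. A *p-flag* is $\vec x_{(k-1)}$ (high; $k\ge1$) or $\vec x_{(\ell(\vec x))}$ (low; $k>1$ and $\vec x$ neither first nor last) for some flag $\vec x=[x_k,\dots,x_0]$. **The cylinder.** The faces of $\mathrm{Cyl}_h(P)$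 are $-p$ and $+p$ ($p\in P$, of dimension $\dim p$), all flags and all p-flags of faces of $P$ (of dimension the number of their non-zero entries). For a p-flag $\vec x$ with $0$ at level $l$ and a face $p\in P_k$ occurring in its top face, $p\star\vec x$ is given by the first applicable case. Here $D_j(p)=\delta\gamma^{(j+1)}(p)$ if $k>j$, $D_j(p)=\{p\}$ if $k=j$, and $$L_j(p,t)=[p,\gamma(p),\dots,\gamma^{(j+2)}(p),t,0,x_{j-1},\dots,x_0]\quad\text{for } t\in D_{j+1}(p),$$ which means $[p,0,x_{j-1},\dots,x_0]$ if $k=j+1$. * $\vec x_{\lceil k}$ if $k\ne l$ and $p=x_k$; * $L_l(p,t)$ if $k>l$ and $x_{l+1}\le^+t\in D_{l+1}(p)$; * $L_{l-1}(p,t)$ if $k\ge l>0$ and $\gamma(x_{l+1})\le^+t\in D_l(p)$; * $L_{j}(p,t)$ if $j$ is the largest number $\leq l-2$ with $j<k$ and $x_{j+1}\le^+D_{j+1}(p)$, and $x_{j+1}\le^+t\in D_{j+1}(p)$; * $-p$ if $l>0$ and $\gamma^{(0)}(p)\le^+x_0$, or $l=0$ and $\gamma^{(0)}(p)<^+\gamma(x_1)$;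 * $+p$ otherwise. The operations of $\mathrm{Cyl}_h(P)$ are: * $\gamma(\pm p)=\pm\gamma(p)$ and $\delta(\pm p)=\{\pm q:q\in\delta(p)\}$ for $p\in P_{\ge1}$; * $\gamma([x_0])=+x_0$ and $\delta([x_0])=\{-x_0\}$; * for a flag $\vec x=[x_k,\dots,x_0]$ with $k\ge1$: $\gamma(\vec x)=\vec x_{(k-1)}$ and $\delta(\vec x)=\{\vec x_{(k)},\vec x_{low}\}$, where $\vec x_{low}$ is $-x_k$ if $\vec x$ is the first flag under $x_k$, $+x_k$ if it is the last one, and $\vec x_{(\ell(\vec x))}$ otherwise; * for a p-flag $\vec x$ with top face $x_k$: $\gamma(\vec x)=\gamma(x_k)\star\vec x$, and $\delta(\vec x)=\{p\star\vec x:p\in\delta(x_k)\}$, to which the flag $\vec x_{(k)}$ is added if $\vec x$ is high and $k\ge2$. **Proposition.** Let $P$ be a positive opetope and $\vec x$ a maximal flag in $P$. Let $P^{\vec x}$ be the least set containing $\vec x$ and closed under $\gamma$ (on elements of positive dimension) and $\delta$, with $\gamma$ and $\delta$ restricted to it. Then all elements of $P^{\vec x}$ are faces of $\mathrm{Cyl}_h(P)$,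 and $P^{\vec x}$ is a positive opetope. That is, it is a positive hypergraph with $P^{\vec x}_0\neq\emptyset$ satisfying globularity, strictness, disjointness and pencil linearity, and $|P^{\vec x}_l\setminus\delta(P^{\vec x}_{l+1})|\le1$ for all $l$. -/

import Mathlib

open Set

universe u

noncomputable section

/-- The data of a hypergraph: graded faces with a codomain operation `γ` and a domain relation `δ`.
The set `S_k` is `{a | dim a = k}`. The value of `γ` on faces of dimension `0` is irrelevant
(every definition below only uses `γ` on faces of positive dimension). -/
structure HypergraphData where
  Face : Type u
  dim : Face → ℕ
  γ : Face → Face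
  δ : Face → Set Face

namespace HypergraphData

variable (S : HypergraphData.{u})

/-- A positive hypergraph: finitely many faces, `γ : S_{k+1} → S_k` is a function,
`δ : S_{k+1} → S_k` is a total relation, and `δ : S_1 → S_0` is a function. -/
structure IsPositiveHypergraph : Prop where
  finite : Finite S.Face
  dim_γ : ∀ a : S.Face, 0 < S.dim a → S.dim (S.γ a) + 1 = S.dim a
  dim_δ : ∀ a b : S.Face, b ∈ S.δ a → S.dim b + 1 = S.dim a
  δ_total : ∀ a : S.Face, 0 < S.dim a → (S.δ a).Nonempty
  δ_one : ∀ a : S.Face, S.dim a = 1 → ∃ b : S.Face, S.δ a = {b}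

/-- `a ◁⁻ b`: the faces have the same positive dimension and `γ(a) ∈ δ(b)`. -/
def LowerStep (a b : S.Face) : Prop :=
  0 < S.dim a ∧ S.dim a = S.dim b ∧ S.γ a ∈ S.δ b

/-- The lower order `a <⁻ b`. -/
def LowerLT : S.Face → S.Face → Prop := Relation.TransGen S.LowerStep

/-- `a ◁⁺ b`: there is `α` with `a ∈ δ(α)` and `γ(α) = b`. -/
def UpperStep (a b : S.Face) : Prop :=
  ∃ α : S.Face, 0 < S.dim α ∧ a ∈ S.δ α ∧ S.γ α = b

/-- The upper order `a <⁺ b`. -/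
def UpperLT : S.Face → S.Face → Prop := Relation.TransGen S.UpperStep

/-- `a ≤⁺ b`. -/
def UpperLE (a b : S.Face) : Prop := a = b ∨ S.UpperLT a b

/-- `γγ(a) = γδ(a) - δδ(a)` and `δγ(a) = δδ(a) - γδ(a)` for all faces of dimension at least 2. -/
def Globularity : Prop :=
  ∀ a : S.Face, 2 ≤ S.dim a →
    ({S.γ (S.γ a)} : Set S.Face) = (S.γ '' S.δ a) \ (⋃ b ∈ S.δ a, S.δ b) ∧
    S.δ (S.γ a) = (⋃ b ∈ S.δ a, S.δ b) \ (S.γ '' S.δ a)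

/-- The upper order (transitive by construction) is irreflexive, and it is linear on `S_0`. -/
def Strictness : Prop :=
  (∀ a : S.Face, ¬ S.UpperLT a a) ∧
  ∀ a b : S.Face, S.dim a = 0 → S.dim b = 0 → S.UpperLT a b ∨ a = b ∨ S.UpperLT b a

/-- No two faces of the same positive dimension are comparable both in the lower and in the
upper order. -/
def Disjointness : Prop :=
  ∀ a b : S.Face, 0 < S.dim a → S.dim a = S.dim b →
    ¬ ((S.LowerLT a b ∨ S.LowerLT b a) ∧ (S.UpperLT a b ∨ S.UpperLT b a))

/-- For each face `x`, the sets `{a | x = γ(a)}` and `{a | x ∈ δ(a)}` (with `a` one dimension above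
`x`) are linearly ordered by `<⁺`. -/
def PencilLinearity : Prop :=
  ∀ x a b : S.Face, S.dim a = S.dim x + 1 → S.dim b = S.dim x + 1 →
    ((x = S.γ a ∧ x = S.γ b) ∨ (x ∈ S.δ a ∧ x ∈ S.δ b)) →
    S.UpperLT a b ∨ a = b ∨ S.UpperLT b a

structure IsPositiveOpetopicCardinal : Prop extends IsPositiveHypergraph S where
  nonempty : ∃ a : S.Face, S.dim a = 0
  globularity : S.Globularity
  strictness : S.Strictness
  disjointness : S.Disjointness
  pencilLinearity : S.PencilLinearity

/-- `size(S)_l = |S_l - δ(S_{l+1})|`. -/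
def size (l : ℕ) : ℕ :=
  Set.ncard {a : S.Face | S.dim a = l ∧ ∀ b : S.Face, S.dim b = l + 1 → a ∉ S.δ b}

structure IsPositiveOpetope : Prop extends IsPositiveOpetopicCardinal S where
  size_le_one : ∀ l : ℕ, S.size l ≤ 1

/-- The faces of `S[x]`: the least set of faces that contains `x` and is closed under `γ`
(on faces of positive dimension) and `δ`. -/
inductive Generated (x : S.Face) : S.Face → Prop
  | base : Generated x x
  | γ_mem {a : S.Face} : Generated x a → 0 < S.dim a → Generated x (S.γ a)
  | δ_mem {a b : S.Face} : Generated x a → b ∈ S.δ a → Generated x b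

open Classical in
/-- The least sub-hypergraph `S[x]` of `S` containing the face `x`, with the operations `γ`, `δ`
restricted to it. -/
def generatedBy (x : S.Face) : HypergraphData.{u} where
  Face := {a : S.Face // S.Generated x a}
  dim a := S.dim a.1
  γ a := if h : 0 < S.dim a.1 then ⟨S.γ a.1, a.2.γ_mem h⟩ else a
  δ a := {b | b.1 ∈ S.δ a.1}

/-- `γ^{(k)}(p)`: the iterated codomain of `p` in dimension `k`, and `p` itself if `dim p ≤ k`. -/
def codTo (k : ℕ) (p : S.Face) : S.Face := S.γ^[S.dim p - k] p

/-- `∂(p) = γ(p) ∪ δ(p)`. -/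
def boundary (p : S.Face) : Set S.Face := {S.γ p} ∪ S.δ p

/-- Sequences of faces indexed by dimension: `x i = some a` means that the entry in dimension `i`
is the face `a`, and `x i = none` that there is no face (in particular, the dummy entry `0`). -/
abbrev Vec := ℕ → Option S.Face

/-- `x = [x_k, x_{k-1}, …, x_0]` is a flag: `x_i ∈ S_i` and `x_i ∈ ∂(x_{i+1})`. -/
structure IsFlag (k : ℕ) (x : S.Vec) : Prop where
  face : ∀ i, i ≤ k → ∃ a ∈ x i, S.dim a = i
  above : ∀ i, k < i → x i = none
  mem_boundary : ∀ i, i < k → ∀ a ∈ x i, ∀ b ∈ x (i + 1), a ∈ S.boundary b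

/-- A maximal flag: its top face has dimension `dim(S)`. -/
def IsMaximalFlag (x : S.Vec) : Prop :=
  ∃ n : ℕ, IsGreatest (Set.range S.dim) n ∧ S.IsFlag n x

open Classical in
/-- The sign of `[x_k, …, x_0]`. -/
def sgn (x : S.Vec) : ℕ → ℤ
  | 0 => 1
  | k + 1 => if x k = (x (k + 1)).map S.γ then sgn x k else - sgn x k

/-- The pencil order `a ≺_x b` for faces `a`, `b` with `x ∈ ∂(a)` and `x ∈ ∂(b)`. -/
def PencilLT (x a b : S.Face) : Prop :=
  (S.γ b = x ∧ x ∈ S.δ a) ∨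
  (x ∈ S.δ a ∧ x ∈ S.δ b ∧ S.UpperLT a b) ∨
  (S.γ a = x ∧ S.γ b = x ∧ S.UpperLT b a)

/-- The flag order `x ◁ y`; here `j` is the least dimension in which `x` and `y` differ. -/
def FlagLT (x y : S.Vec) : Prop :=
  ∃ j : ℕ, (∀ i, i < j → x i = y i) ∧ ∃ a ∈ x j, ∃ b ∈ y j, a ≠ b ∧
    ((j = 0 ∧ S.UpperLT b a) ∨
      (0 < j ∧ ∃ c ∈ x (j - 1),
        (S.sgn x (j - 1) = 1 ∧ S.PencilLT c a b) ∨ (S.sgn x (j - 1) = -1 ∧ S.PencilLT c b a)))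

/-- `x` is the first of the flags under its top face `x_k`. -/
def IsFirstFlag (k : ℕ) (x : S.Vec) : Prop :=
  S.IsFlag k x ∧ ∀ y : S.Vec, S.IsFlag k y → y k = x k → y ≠ x → S.FlagLT x y

/-- `x` is the last of the flags under its top face `x_k`. -/
def IsLastFlag (k : ℕ) (x : S.Vec) : Prop :=
  S.IsFlag k x ∧ ∀ y : S.Vec, S.IsFlag k y → y k = x k → y ≠ x → S.FlagLT y x

/-- The low level `max {i < k - 1 | x_{i+1} ∈ δ(x_{i+2})}` of a flag `[x_k, …, x_0]`. -/
def lowLevel (k : ℕ) (x : S.Vec) : ℕ :=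
  sSup {i | i + 1 < k ∧ ∃ a ∈ x (i + 1), ∃ b ∈ x (i + 2), a ∈ S.δ b}

variable {S} in
/-- `x_{(i)}`: the entry in dimension `i` is removed. -/
def puncture (x : S.Vec) (i : ℕ) : S.Vec := Function.update x i none

variable {S} in
/-- `[x_k, …, x_0]`: the entries in dimensions above `k` are removed. -/
def truncate (x : S.Vec) (k : ℕ) : S.Vec := fun i => if i ≤ k then x i else none

/-- `z` is a p-flag with top face in dimension `k`: either a high p-flag `x_{(k-1)}` of a flag `x`
or the low p-flag of a flag that is neither the first nor the last one. -/
def IsPFlag (k : ℕ) (z : S.Vec) : Prop :=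
  ∃ x : S.Vec, S.IsFlag k x ∧
    ((1 ≤ k ∧ z = puncture x (k - 1)) ∨
      (1 < k ∧ ¬ S.IsFirstFlag k x ∧ ¬ S.IsLastFlag k x ∧ z = puncture x (S.lowLevel k x)))

/-- Candidates for the faces of the cylinder: bottom flat faces `-p`, top flat faces `+p`, and
sequences of faces; the genuine faces are singled out by `IsCylFace`. -/
inductive CylFace : Type u
  | bot (p : S.Face) : CylFace
  | top (p : S.Face) : CylFace
  | vec (x : S.Vec) : CylFace

/-- The faces of the cylinder set `Cyl(S)`: flat faces, flags and p-flags. -/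
def IsCylFace : S.CylFace → Prop
  | .bot _ => True
  | .top _ => True
  | .vec x => ∃ k : ℕ, S.IsFlag k x ∨ S.IsPFlag k x

/-- The dimension: `dim(-p) = dim(+p) = dim(p)`, and the number of nonzero entries of a sequence. -/
def cylDim : S.CylFace → ℕ
  | .bot p => S.dim p
  | .top p => S.dim p
  | .vec x => Set.ncard {i : ℕ | x i ≠ none}

variable {S} in
/-- The dimension of the top entry of a sequence. -/
def topLevel (x : S.Vec) : ℕ := sSup {i : ℕ | x i ≠ none}

variable {S} in
/-- The level of the puncture of a p-flag. -/
def gap (x : S.Vec) : ℕ := sInf {i : ℕ | x i = none}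

/-- The set `δγ^{(j+1)}(p)` of faces of dimension `j`, read as `{p}` if `dim p = j`. -/
def domAt (j : ℕ) (p : S.Face) : Set S.Face :=
  {t | (S.dim p = j ∧ t = p) ∨ (j < S.dim p ∧ t ∈ S.δ (S.codTo (j + 1) p))}

/-- `[p, γ(p), …, γ^{(l+2)}(p), t, 0, x_{l-1}, …, x_0]`
(which is `[p, 0, x_{l-1}, …, x_0]` if `dim p = l + 1` and `t = p`). -/
def lift (p : S.Face) (l : ℕ) (t : S.Face) (x : S.Vec) : S.Vec := fun i =>
  if i < l then x i
  else if i = l then none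
  else if i = l + 1 then some t
  else if i ≤ S.dim p then some (S.codTo i p)
  else none

/-- `x_{q+1} ≤⁺ t ∈ δγ^{(q+2)}(p)`. -/
def Hits (p : S.Face) (x : S.Vec) (q : ℕ) (t : S.Face) : Prop :=
  t ∈ S.domAt (q + 1) p ∧ ∃ a ∈ x (q + 1), S.UpperLE a t

open Classical in
/-- The star operation `p ⋆ x` for a p-flag `x` with puncture at level `l`, where `k = dim p`. -/
def star (p : S.Face) (x : S.Vec) : S.CylFace :=
  if S.dim p ≠ gap x ∧ x (S.dim p) = some p then
    .vec (truncate x (S.dim p))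
  else if h : gap x < S.dim p ∧ ∃ t, S.Hits p x (gap x) t then
    .vec (S.lift p (gap x) h.2.choose x)
  else if h : 0 < gap x ∧ gap x ≤ S.dim p ∧
      ∃ t ∈ S.domAt (gap x) p, ∃ a ∈ x (gap x + 1), S.UpperLE (S.γ a) t then
    .vec (S.lift p (gap x - 1) h.2.2.choose x)
  else if h : ∃ q t, IsGreatest {q' | q' + 2 ≤ gap x ∧ q' < S.dim p ∧ ∃ t', S.Hits p x q' t'} q ∧
      S.Hits p x q t then
    .vec (S.lift p h.choose h.choose_spec.choose x)
  else if (0 < gap x ∧ ∃ a ∈ x 0, S.UpperLE (S.codTo 0 p) a) ∨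
      (gap x = 0 ∧ ∃ a ∈ x 1, S.UpperLT (S.codTo 0 p) (S.γ a)) then
    .bot p
  else .top p

open Classical in
/-- `x_low` for a flag `x = [x_k, …, x_0]` with `k > 0` and `x_k = a`. -/
def low (k : ℕ) (x : S.Vec) (a : S.Face) : S.CylFace :=
  if S.IsFirstFlag k x then .bot a
  else if S.IsLastFlag k x then .top a
  else .vec (puncture x (S.lowLevel k x))

open Classical in
/-- The operation `γ` of the cylinder. For a flag `[x_0]` it is `+x_0`, for a flag of larger
dimension it is the high p-flag, and for a p-flag `x` with top face `a` it is `γ(a) ⋆ x`. -/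
def cylγ : S.CylFace → S.CylFace
  | .bot p => .bot (S.γ p)
  | .top p => .top (S.γ p)
  | .vec x =>
    match x (topLevel x) with
    | none => .vec x
    | some a =>
      if S.IsFlag (topLevel x) x then
        if topLevel x = 0 then .top a else .vec (puncture x (topLevel x - 1))
      else S.star (S.γ a) x

open Classical in
/-- The operation `δ` of the cylinder. For a flag `[x_0]` it is `-x_0`, for a flag `x` with top
entry in dimension `k > 0` it is `{x_{(k)}, x_low}`, and for a p-flag with top face `a` it consists
of the faces `p ⋆ x` with `p ∈ δ(a)` and, if the p-flag is high and `k > 1`, of the flag `x_{(k)}`. -/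
def cylδ : S.CylFace → Set S.CylFace
  | .bot p => CylFace.bot '' S.δ p
  | .top p => CylFace.top '' S.δ p
  | .vec x =>
    match x (topLevel x) with
    | none => ∅
    | some a =>
      if S.IsFlag (topLevel x) x then
        if topLevel x = 0 then {.bot a}
        else {.vec (puncture x (topLevel x)), S.low (topLevel x) x a}
      else
        ((fun p => S.star p x) '' S.δ a) ∪
          {φ | 1 < topLevel x ∧ x (topLevel x - 1) = none ∧ φ = .vec (puncture x (topLevel x))}

/-- The cylinder over `S` with its operations `γ` and `δ`. -/
def cylinder : HypergraphData.{u} where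
  Face := S.CylFace
  dim := S.cylDim
  γ := S.cylγ
  δ := S.cylδ

/-- The sub-hypergraph `S^x` of the cylinder generated by the flag `x`. -/
def flagHypergraph (x : S.Vec) : HypergraphData.{u} :=
  S.cylinder.generatedBy (CylFace.vec x)

end HypergraphData

end

namespace HypergraphData

variable {S : HypergraphData.{u}}

/-! The part of the cylinder generated by a maximal flag `f` has a description that avoids the star
operation. Cut the opetope open along the flag and glue in a prism: a face outside the flag has one
lift, a flag face `f j` has a lower and an upper lift, and a new face `fl f j` of dimension `j + 1`
leads from the lower to the upper one. A lift is up if it is an upper copy of a flag face or lies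
strictly above the flag face of its dimension. The codomain inherits this label, the domain gets the
opposite one, and an up face of dimension `j + 2` has `fl f j` as an extra input. This hypergraph is
`prism`.

The axioms for `prism` reduce to those of the opetope. The upper order projects to the old one,
except for the crossing from a lower to an upper lift (`exists_pt_of_lt`), and prisms can be cut out
of lower chains (`lowerLT_of_pt`). Globularity is the old one away from the flag; at a flag face it
is a case analysis on how the flag meets a face (`up_γ_cases`, `globularity_aux`). The facts about
opetopes behind this are that the faces above a given face form a chain (`linear_above`), that
inputs of one face are incomparable (`not_lt_of_mem_δ`), and that a boundary face of `x` strictly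
below `γ q` lies below an input of `q` unless `x ≤⁺ q` (`le_δ_or_le`).

The map `toCyl` embeds the prism into the cylinder. It sends `fl f j` to the flag `[f j, …, f 0]`
and an up lift of `p` to a high p-flag, or to `+p` for a vertex. Any other lift goes to the low
p-flag whose gap is the greatest level at which the flag passes below a domain of `p`, and to `-p`
or `+p` if there is no such level. Compatibility with `γ` and `δ` amounts to matching the clauses of
the star operation with this recipe (`star_low_δ`, `star_low_γ`, `star_up_δ`, `star_up_γ`) and to
describing the first and the last flag explicitly (`low_eq_place`). A positive opetope is generated
by a face of top dimension, so the generated part is isomorphic to the prism. -/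

theorem upperLE_iff {a b : S.Face} :
    S.UpperLE a b ↔ Relation.ReflTransGen S.UpperStep a b := by
  rw [Relation.reflTransGen_iff_eq_or_transGen]
  exact or_congr_left eq_comm

theorem UpperLE.refl (a : S.Face) : S.UpperLE a a := Or.inl rfl

theorem UpperLT.le {a b : S.Face} (h : S.UpperLT a b) : S.UpperLE a b := Or.inr h

theorem UpperLT.trans {a b c : S.Face} (h : S.UpperLT a b) (h' : S.UpperLT b c) :
    S.UpperLT a c :=
  Relation.TransGen.trans h h'

theorem UpperLE.trans_lt {a b c : S.Face} (h : S.UpperLE a b) (h' : S.UpperLT b c) :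
    S.UpperLT a c := by
  rcases h with rfl | h
  · exact h'
  · exact h.trans h'

theorem UpperLT.trans_le {a b c : S.Face} (h : S.UpperLT a b) (h' : S.UpperLE b c) :
    S.UpperLT a c := by
  rcases h' with rfl | h'
  · exact h
  · exact h.trans h'

theorem UpperLE.trans {a b c : S.Face} (h : S.UpperLE a b) (h' : S.UpperLE b c) :
    S.UpperLE a c := by
  rcases h with rfl | h
  · exact h'
  · exact (h.trans_le h').le

theorem UpperLE.lt_of_ne {a b : S.Face} (h : S.UpperLE a b) (hne : a ≠ b) : S.UpperLT a b :=
  h.resolve_left hne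

theorem UpperStep.lt {a b : S.Face} (h : S.UpperStep a b) : S.UpperLT a b :=
  Relation.TransGen.single h

theorem mem_boundary_iff {y x : S.Face} : y ∈ S.boundary x ↔ y = S.γ x ∨ y ∈ S.δ x := by
  simp [boundary]

theorem γ_mem_boundary (x : S.Face) : S.γ x ∈ S.boundary x := mem_boundary_iff.2 (Or.inl rfl)

theorem δ_subset_boundary (x : S.Face) : S.δ x ⊆ S.boundary x :=
  fun _ h => mem_boundary_iff.2 (Or.inr h)

/-! ### Dimensions and orders in a positive hypergraph -/

namespace IsPositiveHypergraph

theorem pos_of_mem (hS : S.IsPositiveHypergraph) {a b : S.Face} (h : b ∈ S.δ a) :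
    0 < S.dim a := by
  have := hS.dim_δ a b h; omega

theorem upperStep (hS : S.IsPositiveHypergraph) {a b : S.Face} (h : b ∈ S.δ a) :
    S.UpperStep b (S.γ a) :=
  ⟨a, hS.pos_of_mem h, h, rfl⟩

theorem lt_γ (hS : S.IsPositiveHypergraph) {a b : S.Face} (h : b ∈ S.δ a) :
    S.UpperLT b (S.γ a) :=
  (hS.upperStep h).lt

theorem le_γ (hS : S.IsPositiveHypergraph) {x y : S.Face} (h : y ∈ S.boundary x) :
    S.UpperLE y (S.γ x) := by
  rcases mem_boundary_iff.1 h with rfl | h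
  · exact .refl _
  · exact (hS.lt_γ h).le

theorem dim_boundary (hS : S.IsPositiveHypergraph) {x y : S.Face} (hx : 0 < S.dim x)
    (h : y ∈ S.boundary x) : S.dim y + 1 = S.dim x := by
  rcases mem_boundary_iff.1 h with rfl | h
  · exact hS.dim_γ x hx
  · exact hS.dim_δ x y h

theorem dim_step (hS : S.IsPositiveHypergraph) {a b : S.Face} (h : S.UpperStep a b) :
    S.dim a = S.dim b := by
  obtain ⟨α, hα, ha, rfl⟩ := h
  have := hS.dim_δ α a ha
  have := hS.dim_γ α hα
  omega

theorem dim_lt (hS : S.IsPositiveHypergraph) {a b : S.Face} (h : S.UpperLT a b) :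
    S.dim a = S.dim b := by
  induction h with
  | single h => exact hS.dim_step h
  | tail _ h ih => exact ih.trans (hS.dim_step h)

theorem dim_le (hS : S.IsPositiveHypergraph) {a b : S.Face} (h : S.UpperLE a b) :
    S.dim a = S.dim b := by
  rcases h with rfl | h
  · rfl
  · exact hS.dim_lt h

theorem lowerLT_γ (hS : S.IsPositiveHypergraph) {a b : S.Face} (h : S.LowerLT a b) :
    S.UpperLT (S.γ a) (S.γ b) := by
  induction h with
  | single h => exact hS.lt_γ h.2.2
  | tail _ h ih => exact ih.trans (hS.lt_γ h.2.2)

end IsPositiveHypergraph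

theorem LowerStep.lt {a b : S.Face} (h : S.LowerStep a b) : S.LowerLT a b :=
  Relation.TransGen.single h

theorem LowerLT.trans {a b c : S.Face} (h : S.LowerLT a b) (h' : S.LowerLT b c) :
    S.LowerLT a c :=
  Relation.TransGen.trans h h'

theorem LowerLT.dim_eq {a b : S.Face} (h : S.LowerLT a b) : 0 < S.dim a ∧ S.dim a = S.dim b := by
  induction h with
  | single h => exact ⟨h.1, h.2.1⟩
  | tail _ h ih => exact ⟨ih.1, ih.2.trans h.2.1⟩

/-! ### Order structure of positive opetopic cardinals -/

namespace IsPositiveOpetopicCardinal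

theorem irrefl (hS : S.IsPositiveOpetopicCardinal) (a : S.Face) : ¬ S.UpperLT a a :=
  hS.strictness.1 a

theorem not_le_of_lt (hS : S.IsPositiveOpetopicCardinal) {a b : S.Face} (h : S.UpperLT a b) :
    ¬ S.UpperLE b a :=
  fun h' => hS.irrefl a (h.trans_le h')

theorem antisymm (hS : S.IsPositiveOpetopicCardinal) {a b : S.Face} (h : S.UpperLE a b)
    (h' : S.UpperLE b a) : a = b := by
  by_contra hne
  exact hS.not_le_of_lt (h.lt_of_ne hne) h'

/-- Finiteness makes `<⁺` well-founded in both directions; many arguments below walk up or down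
along it. -/
theorem wf (hS : S.IsPositiveOpetopicCardinal) : WellFounded S.UpperLT :=
  haveI := hS.finite
  haveI : IsTrans S.Face S.UpperLT := ⟨fun _ _ _ => UpperLT.trans⟩
  haveI : Std.Irrefl S.UpperLT := ⟨hS.irrefl⟩
  Finite.wellFounded_of_trans_of_irrefl _

theorem wf_swap (hS : S.IsPositiveOpetopicCardinal) :
    WellFounded (fun a b => S.UpperLT b a) :=
  haveI := hS.finite
  haveI : IsTrans S.Face (fun a b => S.UpperLT b a) := ⟨fun _ _ _ h h' => UpperLT.trans h' h⟩
  haveI : Std.Irrefl (fun a b => S.UpperLT b a) := ⟨hS.irrefl⟩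
  Finite.wellFounded_of_trans_of_irrefl _

/-- `γ` carries `<⁻` to `<⁺`, so a lower loop would give an upper loop. -/
theorem lower_irrefl (hS : S.IsPositiveOpetopicCardinal) (a : S.Face) : ¬ S.LowerLT a a :=
  fun h => hS.irrefl _ (hS.lowerLT_γ h)

theorem disjoint_le (hS : S.IsPositiveOpetopicCardinal) {a b : S.Face} (h : S.LowerLT a b) :
    ¬ S.UpperLE a b := by
  rintro (rfl | h')
  · exact hS.lower_irrefl _ h
  · exact hS.disjointness a b h.dim_eq.1 h.dim_eq.2 ⟨.inl h, .inl h'⟩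

theorem disjoint_ge (hS : S.IsPositiveOpetopicCardinal) {a b : S.Face} (h : S.LowerLT a b) :
    ¬ S.UpperLE b a := by
  rintro (rfl | h')
  · exact hS.lower_irrefl _ h
  · exact hS.disjointness a b h.dim_eq.1 h.dim_eq.2 ⟨.inl h, .inr h'⟩

theorem pencil_γ (hS : S.IsPositiveOpetopicCardinal) {a b : S.Face} (ha : 0 < S.dim a)
    (hb : 0 < S.dim b) (h : S.γ a = S.γ b) : S.UpperLE a b ∨ S.UpperLT b a := by
  have h1 := hS.dim_γ a ha
  have h2 := hS.dim_γ b hb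
  rcases hS.pencilLinearity (S.γ a) a b (by omega) (by rw [h]; omega) (.inl ⟨rfl, h⟩) with
    h | h | h
  exacts [.inl h.le, .inl (.inl h), .inr h]

theorem pencil_δ (hS : S.IsPositiveOpetopicCardinal) {a b y : S.Face} (ha : y ∈ S.δ a)
    (hb : y ∈ S.δ b) : S.UpperLE a b ∨ S.UpperLT b a := by
  have h1 := hS.dim_δ a y ha
  have h2 := hS.dim_δ b y hb
  rcases hS.pencilLinearity y a b (by omega) (by omega) (.inr ⟨ha, hb⟩) with h | h | h
  exacts [.inl h.le, .inl (.inl h), .inr h]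

theorem γγ_mem (hS : S.IsPositiveOpetopicCardinal) {A : S.Face} (hA : 2 ≤ S.dim A) :
    ∃ c ∈ S.δ A, S.γ c = S.γ (S.γ A) := by
  have h : S.γ (S.γ A) ∈ (S.γ '' S.δ A) \ (⋃ b ∈ S.δ A, S.δ b) := by
    rw [← (hS.globularity A hA).1]; rfl
  exact h.1

theorem γγ_notMem (hS : S.IsPositiveOpetopicCardinal) {A c : S.Face} (hA : 2 ≤ S.dim A)
    (hc : c ∈ S.δ A) : S.γ (S.γ A) ∉ S.δ c := by
  have h : S.γ (S.γ A) ∈ (S.γ '' S.δ A) \ (⋃ b ∈ S.δ A, S.δ b) := by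
    rw [← (hS.globularity A hA).1]; rfl
  intro h'
  exact h.2 (mem_biUnion hc h')

theorem γ_eq_or_mem (hS : S.IsPositiveOpetopicCardinal) {A c : S.Face} (hA : 2 ≤ S.dim A)
    (hc : c ∈ S.δ A) : S.γ c = S.γ (S.γ A) ∨ ∃ d ∈ S.δ A, S.γ c ∈ S.δ d := by
  by_cases h : ∃ d ∈ S.δ A, S.γ c ∈ S.δ d
  · exact .inr h
  · left
    have : S.γ c ∈ (S.γ '' S.δ A) \ (⋃ b ∈ S.δ A, S.δ b) :=
      ⟨⟨c, hc, rfl⟩, by simpa using h⟩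
    rw [← (hS.globularity A hA).1] at this
    exact this

theorem mem_δγ_iff (hS : S.IsPositiveOpetopicCardinal) {A s : S.Face} (hA : 2 ≤ S.dim A) :
    s ∈ S.δ (S.γ A) ↔ (∃ c ∈ S.δ A, s ∈ S.δ c) ∧ ∀ c ∈ S.δ A, S.γ c ≠ s := by
  rw [(hS.globularity A hA).2]
  simp

/-- As long as `γ c` is not the final codomain, globularity makes it an input of another face of `δ
A`, whose codomain is strictly higher; finiteness ends the climb. -/
theorem γ_le_γγ (hS : S.IsPositiveOpetopicCardinal) {A : S.Face} (hA : 2 ≤ S.dim A) :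
    ∀ c ∈ S.δ A, S.UpperLE (S.γ c) (S.γ (S.γ A)) := by
  intro c
  induction h : S.γ c using hS.wf_swap.induction generalizing c with
  | _ s ih =>
    subst h
    intro hc
    rcases hS.γ_eq_or_mem hA hc with h | ⟨d, hd, h⟩
    · exact .inl h
    · exact (hS.lt_γ h).le.trans (ih _ (hS.lt_γ h) d rfl hd)

theorem γ_mono (hS : S.IsPositiveOpetopicCardinal) {a b : S.Face} (ha : 0 < S.dim a)
    (h : S.UpperLE a b) : S.UpperLE (S.γ a) (S.γ b) := by
  rw [upperLE_iff] at h
  induction h with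
  | refl => exact .refl _
  | @tail b c hab hbc ih =>
    refine ih.trans ?_
    have hd := hS.dim_le (upperLE_iff.2 hab)
    obtain ⟨A, hA, hb, rfl⟩ := hbc
    have := hS.dim_δ A _ hb
    exact hS.γ_le_γγ (by omega) _ hb

/-- Faces above a given face are linearly ordered. -/
theorem linear_above (hS : S.IsPositiveOpetopicCardinal) {x a b : S.Face} (ha : S.UpperLE x a)
    (hb : S.UpperLE x b) : S.UpperLE a b ∨ S.UpperLT b a := by
  induction x using hS.wf_swap.induction generalizing a b with
  | _ x ih =>
    rcases ha with rfl | ha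
    · exact .inl hb
    rcases hb with rfl | hb
    · exact .inr ha
    obtain ⟨a1, ⟨α, hα, hxα, rfl⟩, ha1⟩ := Relation.TransGen.head'_iff.1 ha
    obtain ⟨b1, ⟨β, hβ, hxβ, rfl⟩, hb1⟩ := Relation.TransGen.head'_iff.1 hb
    rw [← upperLE_iff] at ha1 hb1
    -- The two first steps leave `x` through faces of one pencil, so their targets are comparable
    -- and the induction continues from the lower one.
    rcases hS.pencil_δ hxα hxβ with h | h
    · exact ih _ (hS.lt_γ hxα) ha1 ((hS.γ_mono hα h).trans hb1)
    · exact ih _ (hS.lt_γ hxβ) ((hS.γ_mono hβ h.le).trans ha1) hb1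

/-- A chain of upper steps that ends in `δ q` starts in the domain of a face that is lower
than `q`. -/
theorem exists_lowerLT (hS : S.IsPositiveOpetopicCardinal) {y p q : S.Face} (h : S.UpperLT y p)
    (hp : p ∈ S.δ q) : ∃ β, y ∈ S.δ β ∧ S.LowerLT β q := by
  induction h using Relation.TransGen.head_induction_on with
  | @single y h =>
    obtain ⟨α, hα, hy, rfl⟩ := h
    refine ⟨α, hy, LowerStep.lt ⟨hα, ?_, hp⟩⟩
    have := hS.dim_δ q _ hp
    have := hS.dim_γ α hα
    omega
  | @head y z h _ ih =>
    obtain ⟨β, hz, hβ⟩ := ih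
    obtain ⟨α, hα, hy, rfl⟩ := h
    refine ⟨α, hy, (LowerStep.lt ⟨hα, ?_, hz⟩).trans hβ⟩
    have := hS.dim_δ β _ hz
    have := hS.dim_γ α hα
    omega

theorem lowerLT_of_le (hS : S.IsPositiveOpetopicCardinal) {x p q : S.Face} (hx : 0 < S.dim x)
    (h : S.UpperLE (S.γ x) p) (hp : p ∈ S.δ q) : S.LowerLT x q := by
  have step : ∀ β, S.γ x ∈ S.δ β → S.LowerLT x β := fun β hβ =>
    LowerStep.lt ⟨hx, by have := hS.dim_δ β _ hβ; have := hS.dim_γ x hx; omega, hβ⟩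
  rcases h with rfl | h
  · exact step _ hp
  · obtain ⟨β, hβ, hl⟩ := hS.exists_lowerLT h hp
    exact (step _ hβ).trans hl

/-- A chain from `a` to `b` starts in the domain of some `β <⁻ A`. Since `β` and `A` share the input
`a`, pencil linearity makes them comparable for `<⁺` as well, against disjointness. -/
theorem not_lt_of_mem_δ (hS : S.IsPositiveOpetopicCardinal) {a b A : S.Face} (ha : a ∈ S.δ A)
    (hb : b ∈ S.δ A) : ¬ S.UpperLT a b := by
  intro h
  obtain ⟨β, hβ, hl⟩ := hS.exists_lowerLT h hb
  rcases hS.pencil_δ hβ ha with h | h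
  · exact hS.disjoint_le hl h
  · exact hS.disjoint_ge hl h.le

theorem eq_of_le_of_mem_δ (hS : S.IsPositiveOpetopicCardinal) {a b A : S.Face} (ha : a ∈ S.δ A)
    (hb : b ∈ S.δ A) (h : S.UpperLE a b) : a = b :=
  h.resolve_right (hS.not_lt_of_mem_δ ha hb)

theorem eq_of_comparable (hS : S.IsPositiveOpetopicCardinal) {a b A : S.Face} (ha : a ∈ S.δ A)
    (hb : b ∈ S.δ A) (h : S.UpperLE a b ∨ S.UpperLT b a) : a = b := by
  rcases h with h | h
  · exact hS.eq_of_le_of_mem_δ ha hb h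
  · exact (hS.not_lt_of_mem_δ hb ha h).elim

theorem eq_of_le_le (hS : S.IsPositiveOpetopicCardinal) {a b A x : S.Face} (ha : a ∈ S.δ A)
    (hb : b ∈ S.δ A) (hxa : S.UpperLE x a) (hxb : S.UpperLE x b) : a = b :=
  hS.eq_of_comparable ha hb (hS.linear_above hxa hxb)

theorem γ_notMem_δ (hS : S.IsPositiveOpetopicCardinal) (a : S.Face) : S.γ a ∉ S.δ a :=
  fun h => hS.irrefl _ (hS.lt_γ h)

/-- Such an inequality would put `x`, or some face sharing the input `y` with `x`, below `q` for
`<⁻`, while `x ≤⁺ q` keeps that face comparable to `q` for `<⁺`. -/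
theorem not_lt_of_boundary (hS : S.IsPositiveOpetopicCardinal) {x q y p : S.Face}
    (hx : 0 < S.dim x) (hxq : S.UpperLE x q) (hy : y ∈ S.boundary x) (hp : p ∈ S.δ q) :
    ¬ S.UpperLT y p := by
  intro h
  rcases mem_boundary_iff.1 hy with rfl | hy
  · exact hS.disjoint_le (hS.lowerLT_of_le hx h.le hp) hxq
  · obtain ⟨β, hβ, hl⟩ := hS.exists_lowerLT h hp
    rcases hS.pencil_δ hβ hy with h | h
    · exact hS.disjoint_le hl (h.trans hxq)
    · rcases hS.linear_above h.le hxq with h | h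
      · exact hS.disjoint_le hl h
      · exact hS.disjoint_ge hl h.le

theorem exists_le_of_γ_eq (hS : S.IsPositiveOpetopicCardinal) {q β : S.Face} (hq : 0 < S.dim q)
    (h : S.UpperLE q β) (hγ : S.γ q = S.γ β) :
    ∀ t' ∈ S.δ β, ∃ t ∈ S.δ q, S.UpperLE t' t := by
  rw [upperLE_iff] at h
  induction h with
  | refl => exact fun t ht => ⟨t, ht, .refl _⟩
  | @tail b c hqb hbc ih =>
    rw [← upperLE_iff] at hqb
    have hd := hS.dim_le hqb
    obtain ⟨A, hA, hb, rfl⟩ := hbc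
    have hA2 : 2 ≤ S.dim A := by have := hS.dim_δ A _ hb; omega
    -- The codomains along the chain are squeezed between equal ends, so `b` is the face of `δ A`
    -- that carries the final codomain.
    have hbγ : S.γ b = S.γ (S.γ A) :=
      hS.antisymm (hS.γ_le_γγ hA2 _ hb) (hγ ▸ hS.γ_mono hq hqb)
    -- Everything in `δ A` flows into `b`: either `c` is `b` itself, or its codomain is an input of
    -- a further face of `δ A`.
    have key : ∀ s, ∀ c ∈ S.δ A, s ∈ S.δ c → ∃ t ∈ S.δ b, S.UpperLE s t := by
      intro s
      induction s using hS.wf_swap.induction with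
      | _ s ihs =>
        intro c hc hs
        rcases hS.γ_eq_or_mem hA2 hc with h | ⟨d, hd, h⟩
        · have : c = b := by
            have h1 := hS.pos_of_mem hs
            exact hS.eq_of_comparable hc hb
              (hS.pencil_γ h1 (by omega) (h.trans hbγ.symm))
          subst this
          exact ⟨s, hs, .refl _⟩
        · obtain ⟨t, ht, hst⟩ := ihs _ (hS.lt_γ hs) d hd h
          exact ⟨t, ht, ((hS.lt_γ hs).trans_le hst).le⟩
    intro t' ht'
    obtain ⟨⟨c, hc, htc⟩, -⟩ := (hS.mem_δγ_iff hA2).1 ht'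
    obtain ⟨t, ht, htt⟩ := key t' c hc htc
    obtain ⟨r, hr, htr⟩ := ih (hγ.trans hbγ.symm) t ht
    exact ⟨r, hr, htt.trans htr⟩

/-- In each composition step an input survives unless it is glued to the codomain of another face.
-/
theorem mem_δ_or_exists_γ (hS : S.IsPositiveOpetopicCardinal) {β q y : S.Face}
    (h : S.UpperLE β q) (hy : y ∈ S.δ β) : y ∈ S.δ q ∨ ∃ β', S.UpperLT β' q ∧ S.γ β' = y := by
  rw [upperLE_iff] at h
  induction h with
  | refl => exact .inl hy
  | @tail b c hqb hbc ih =>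
    rw [← upperLE_iff] at hqb
    have hd := hS.dim_le hqb
    have hβ := hS.pos_of_mem hy
    rcases ih with h | ⟨β', h, h'⟩
    · obtain ⟨A, hA, hb, rfl⟩ := hbc
      have hA2 : 2 ≤ S.dim A := by have := hS.dim_δ A _ hb; omega
      by_cases hex : ∃ d ∈ S.δ A, S.γ d = y
      · obtain ⟨d, hd, h'⟩ := hex
        exact .inr ⟨d, hS.lt_γ hd, h'⟩
      · push Not at hex
        exact .inl ((hS.mem_δγ_iff hA2).2 ⟨⟨b, hb, h⟩, hex⟩)
    · exact .inr ⟨β', h.trans hbc.lt, h'⟩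

/-- A face `y` in the boundary of `x` that lies strictly below `γ q` either lies below a face of
`δ q` or is an inner face of `q`, and in that case `x` lies below `q`. -/
theorem le_δ_or_le (hS : S.IsPositiveOpetopicCardinal) {x q y : S.Face} (hx : 0 < S.dim x)
    (hy : y ∈ S.boundary x) (hq : 0 < S.dim q) (h : S.UpperLT y (S.γ q)) :
    (∃ t ∈ S.δ q, S.UpperLE y t) ∨ S.UpperLE x q := by
  by_contra hcon
  push Not at hcon
  obtain ⟨hcon, hxq⟩ := hcon
  have dimq : ∀ β, S.UpperLE β q → 0 < S.dim β := fun β hβ => by rw [hS.dim_le hβ]; exact hq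
  -- a face that is both a codomain and in a domain of faces inside `q` cannot be `y`
  have inner : ∀ β β', S.UpperLT β' q → S.γ β' = y → S.UpperLE β q → y ∈ S.δ β → False := by
    intro β β' hβ' hγ hβ hyβ
    rcases mem_boundary_iff.1 hy with hyx | hyx
    · rcases hS.pencil_γ hx (dimq _ hβ'.le) (hyx.symm.trans hγ.symm) with h1 | h1
      · exact hxq (h1.trans hβ'.le)
      · rcases hS.linear_above h1.le hβ'.le with h2 | h2
        · exact hxq h2
        · exact hS.not_le_of_lt h (hyx ▸ hS.γ_mono hq h2.le)
    · rcases hS.pencil_δ hyx hyβ with h1 | h1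
      · exact hxq (h1.trans hβ)
      · rcases hS.linear_above h1.le hβ with h2 | h2
        · exact hxq h2
        · refine hS.disjoint_le (LowerStep.lt ⟨dimq _ hβ'.le, ?_, hγ ▸ hyx⟩) (hβ'.trans h2).le
          rw [hS.dim_le hβ'.le, hS.dim_lt h2]
  -- Descent on `w`: the last step of a chain from `y` to `w` goes through some `α` with `γ α = w`.
  -- If `α ≤⁺ q`, the chain can be shortened inside `q`; otherwise `q <⁺ α` with equal codomains,
  -- and `exists_le_of_γ_eq` applies.
  have key : ∀ w, S.UpperLT y w → ∀ β, S.UpperLE β q → S.γ β = w → False := by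
    intro w
    induction w using hS.wf.induction with
    | _ w ih =>
      intro hyw β hβ hβw
      obtain ⟨v, hyv, α, hα, hvα, hαw⟩ := Relation.TransGen.tail'_iff.1 hyw
      rw [← upperLE_iff] at hyv
      have down : S.UpperLE α q → False := by
        intro hαq
        rcases hS.mem_δ_or_exists_γ hαq hvα with h1 | ⟨β', h1, h2⟩
        · exact hcon v h1 hyv
        · rcases hyv with rfl | hyv
          · exact inner α β' h1 h2 hαq hvα
          · exact ih v (hαw ▸ hS.lt_γ hvα) hyv β' h1.le h2
      rcases hS.pencil_γ hα (dimq _ hβ) (hαw.trans hβw.symm) with h1 | h1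
      · exact down (h1.trans hβ)
      · rcases hS.linear_above h1.le hβ with h2 | h2
        · exact down h2
        · have : S.γ q = S.γ α := hS.antisymm (hS.γ_mono hq h2.le)
            (hαw.trans hβw.symm ▸ hS.γ_mono (dimq _ hβ) hβ)
          obtain ⟨t, ht, hvt⟩ := hS.exists_le_of_γ_eq hq h2.le this v hvα
          exact hcon t ht (hyv.trans hvt)
  exact key _ h q (.refl _) rfl

theorem exists_boundary_boundary_γ (hS : S.IsPositiveOpetopicCardinal) {A c y v : S.Face}
    (hc : c ∈ S.δ A) (hc2 : 2 ≤ S.dim c) (hy : y ∈ S.boundary c) (hv : v ∈ S.boundary y) :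
    ∃ z ∈ S.boundary (S.γ A), v ∈ S.boundary z := by
  have hdc : ∀ d ∈ S.δ A, S.dim d = S.dim c := fun d hd => by
    have := hS.dim_δ A _ hd; have := hS.dim_δ A _ hc; omega
  have hA2 : 2 ≤ S.dim A := by have := hS.dim_δ A _ hc; omega
  -- pass to inputs as long as possible
  have up : ∀ y, ∀ c ∈ S.δ A, y ∈ S.boundary c → v ∈ S.δ y →
      ∃ z ∈ S.δ (S.γ A), v ∈ S.δ z := by
    intro y
    induction y using hS.wf.induction with
    | _ y ih =>
      intro c hc hy hv
      by_cases hex : ∃ d ∈ S.δ A, S.γ d = y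
      · obtain ⟨d, hd, rfl⟩ := hex
        obtain ⟨⟨z, hz, hvz⟩, -⟩ := (hS.mem_δγ_iff (by rw [hdc d hd]; exact hc2)).1 hv
        exact ih z (hS.lt_γ hz) d hd (δ_subset_boundary _ hz) hvz
      · push Not at hex
        rcases mem_boundary_iff.1 hy with rfl | hy
        · exact (hex c hc rfl).elim
        · exact ⟨y, (hS.mem_δγ_iff hA2).2 ⟨⟨c, hc, hy⟩, hex⟩, hv⟩
  -- Dually, `y` is replaced by higher faces with codomain `v` until it is no input of a face of `δ
  -- A`; if `v` turns into an input on the way, `up` takes over.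
  have down : ∀ y, ∀ c ∈ S.δ A, y ∈ S.boundary c → v = S.γ y →
      ∃ z ∈ S.boundary (S.γ A), v ∈ S.boundary z := by
    intro y
    induction y using hS.wf_swap.induction with
    | _ y ih =>
      rintro c hc hy rfl
      by_cases hex : ∃ d ∈ S.δ A, y ∈ S.δ d
      · obtain ⟨d, hd, hyd⟩ := hex
        rcases hS.γ_eq_or_mem (by rw [hdc d hd]; exact hc2) hyd with h | ⟨z, hz, h⟩
        · exact ih _ (hS.lt_γ hyd) d hd (γ_mem_boundary d) h
        · obtain ⟨z, hz, hvz⟩ := up z d hd (δ_subset_boundary _ hz) h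
          exact ⟨z, δ_subset_boundary _ hz, δ_subset_boundary _ hvz⟩
      · rcases mem_boundary_iff.1 hy with rfl | hy
        · rcases hS.γ_eq_or_mem hA2 hc with h | h
          · exact ⟨_, γ_mem_boundary _, h ▸ γ_mem_boundary _⟩
          · exact (hex h).elim
        · exact (hex ⟨c, hc, hy⟩).elim
  rcases mem_boundary_iff.1 hv with h | h
  · exact down y c hc hy h
  · obtain ⟨z, hz, hvz⟩ := up y c hc hy h
    exact ⟨z, δ_subset_boundary _ hz, δ_subset_boundary _ hvz⟩

/-- Passing up along `<⁺` may lose `y`, but not the face `v` of codimension two. This lets the lower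
part of a flag be completed to a flag under a larger face. -/
theorem exists_boundary_boundary (hS : S.IsPositiveOpetopicCardinal) {x q y v : S.Face}
    (hx : 2 ≤ S.dim x) (h : S.UpperLE x q) (hy : y ∈ S.boundary x) (hv : v ∈ S.boundary y) :
    ∃ z ∈ S.boundary q, v ∈ S.boundary z := by
  rw [upperLE_iff] at h
  induction h with
  | refl => exact ⟨y, hy, hv⟩
  | tail hqb hbc ih =>
    obtain ⟨z, hz, hvz⟩ := ih
    have hd := hS.dim_le (upperLE_iff.2 hqb)
    obtain ⟨A, hA, hb, rfl⟩ := hbc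
    exact hS.exists_boundary_boundary_γ hb (by omega) hz hvz

end IsPositiveOpetopicCardinal

/-! ### The prism over a maximal flag -/

/-- A maximal flag, given by its sequence of faces `f 0, …, f n`. -/
structure IsFullFlag (S : HypergraphData.{u}) (n : ℕ) (f : ℕ → S.Face) : Prop where
  dim_eq : ∀ i ≤ n, S.dim (f i) = i
  mem_boundary : ∀ i < n, f i ∈ S.boundary (f (i + 1))
  dim_le : ∀ p : S.Face, S.dim p ≤ n

/-- Whether the lift of the face `p` lies above the prism over the flag `f`; the proposition `a`
decides in case `p` is a face of the flag. -/
def Up (f : ℕ → S.Face) (p : S.Face) (a : Prop) : Prop :=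
  (p = f (S.dim p) ∧ a) ∨ S.UpperLT (f (S.dim p)) p

/-- The lifts of faces: a face of the flag has two of them, any other face has one. -/
def Lifted (f : ℕ → S.Face) : Type u := {p : S.Face × Prop // Up f p.1 p.2 ↔ p.2}

/-- Idempotence makes `Up f p a` an admissible label in `Lifted`, so any proposition `a` can be
normalised to one. -/
theorem up_up (f : ℕ → S.Face) (p : S.Face) (a : Prop) : Up f p (Up f p a) ↔ Up f p a := by
  unfold Up; tauto

section

variable {f : ℕ → S.Face}

theorem up_iff_of_ne {p : S.Face} (h : p ≠ f (S.dim p)) (a b : Prop) : Up f p a ↔ Up f p b := by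
  unfold Up; tauto

theorem Up.le {p : S.Face} {a : Prop} (h : Up f p a) : S.UpperLE (f (S.dim p)) p :=
  h.elim (fun h => .inl h.1.symm) .inr

theorem up_of_le {p : S.Face} {a : Prop} (h : S.UpperLE (f (S.dim p)) p) (ha : a) : Up f p a :=
  h.elim (fun h => .inl ⟨h.symm, ha⟩) .inr

theorem up_of_lt {p : S.Face} {a : Prop} (h : S.UpperLT (f (S.dim p)) p) : Up f p a := .inr h

theorem up_true {p : S.Face} : Up f p True ↔ S.UpperLE (f (S.dim p)) p :=
  ⟨Up.le, fun h => up_of_le h trivial⟩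

theorem up_false {p : S.Face} : Up f p False ↔ S.UpperLT (f (S.dim p)) p := by
  simp [Up]

theorem up_mono {p : S.Face} {a b : Prop} (h : a → b) (hp : Up f p a) : Up f p b :=
  hp.imp_left fun ⟨h1, h2⟩ => ⟨h1, h h2⟩

end

def liftTo (f : ℕ → S.Face) (p : S.Face) (a : Prop) : Lifted f := ⟨(p, Up f p a), up_up f p a⟩

/-- The prism over the flag `f` that is glued into `S`. The face `Sum.inr j` is the prism over
`f j`, it leads from the lower to the upper lift of `f j`. -/
def prism (S : HypergraphData.{u}) (n : ℕ) (f : ℕ → S.Face) : HypergraphData.{u} where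
  Face := Lifted f ⊕ Fin (n + 1)
  dim := Sum.elim (fun p => S.dim p.1.1) (fun j => j.1 + 1)
  γ := Sum.elim (fun p => .inl (liftTo f (S.γ p.1.1) p.1.2)) (fun j => .inl (liftTo f (f j) True))
  -- The label is negated on domains: an up face starts from lower lifts and ends in upper ones, so
  -- it must contain a prism, whereas a face that is not up starts where a prism ends or ends where
  -- a prism starts. Since `fl f j` has dimension `j + 1`, it is an input in dimension `j + 2`.
  δ := Sum.elim
    (fun p => {φ | (∃ t ∈ S.δ p.1.1, φ = .inl (liftTo f t (¬ p.1.2))) ∨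
      (p.1.2 ∧ ∃ j : Fin (n + 1), j.1 + 2 = S.dim p.1.1 ∧ φ = .inr j)})
    (fun j => {φ | φ = .inl (liftTo f (f j) False) ∨ ∃ i : Fin (n + 1), i.1 + 1 = j ∧ φ = .inr i})

namespace prism

variable {n : ℕ} {f : ℕ → S.Face}

/-- The lift of the face `p`, as a face of the prism. -/
def pt (n : ℕ) (f : ℕ → S.Face) (p : S.Face) (a : Prop) : (S.prism n f).Face :=
  .inl (liftTo f p a)

/-- The prism over `f j`. -/
def fl (f : ℕ → S.Face) (j : Fin (n + 1)) : (S.prism n f).Face := .inr j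

@[simp] theorem pt_eq_pt {p q : S.Face} {a b : Prop} :
    pt n f p a = pt n f q b ↔ p = q ∧ (Up f p a ↔ Up f q b) := by
  constructor
  · intro h
    obtain ⟨h1, h2⟩ := Prod.mk.inj (Subtype.ext_iff.1 (Sum.inl.inj h))
    exact ⟨h1, iff_of_eq h2⟩
  · rintro ⟨h1, h2⟩
    exact congrArg Sum.inl (Subtype.ext (Prod.ext h1 (propext h2)))

@[simp] theorem pt_ne_fl {p : S.Face} {a : Prop} {j : Fin (n + 1)} : pt n f p a ≠ fl f j :=
  Sum.inl_ne_inr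

@[simp] theorem fl_ne_pt {p : S.Face} {a : Prop} {j : Fin (n + 1)} : fl f j ≠ pt n f p a :=
  Sum.inr_ne_inl

@[simp] theorem fl_eq_fl {i j : Fin (n + 1)} : fl f i = fl f j ↔ i = j := Sum.inr.injEq i j ▸ Iff.rfl

theorem face_cases (φ : (S.prism n f).Face) :
    (∃ p a, (Up f p a ↔ a) ∧ φ = pt n f p a) ∨ ∃ j, φ = fl f j := by
  rcases φ with ⟨⟨p, a⟩, h⟩ | j
  · refine .inl ⟨p, a, h, ?_⟩
    unfold pt liftTo
    congr 3
    exact (propext h).symm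
  · exact .inr ⟨j, rfl⟩

@[simp] theorem dim_pt (p : S.Face) (a : Prop) : (S.prism n f).dim (pt n f p a) = S.dim p := rfl

@[simp] theorem dim_fl (j : Fin (n + 1)) : (S.prism n f).dim (fl f j) = j.1 + 1 := rfl

@[simp] theorem γ_pt (p : S.Face) (a : Prop) :
    (S.prism n f).γ (pt n f p a) = pt n f (S.γ p) (Up f p a) := rfl

@[simp] theorem γ_fl (j : Fin (n + 1)) : (S.prism n f).γ (fl f j) = pt n f (f j) True := rfl

theorem mem_δ_pt {φ : (S.prism n f).Face} {p : S.Face} {a : Prop} :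
    φ ∈ (S.prism n f).δ (pt n f p a) ↔ (∃ t ∈ S.δ p, φ = pt n f t (¬ Up f p a)) ∨
      (Up f p a ∧ ∃ j : Fin (n + 1), j.1 + 2 = S.dim p ∧ φ = fl f j) := Iff.rfl

theorem mem_δ_fl {φ : (S.prism n f).Face} {j : Fin (n + 1)} :
    φ ∈ (S.prism n f).δ (fl f j) ↔ φ = pt n f (f j) False ∨
      ∃ i : Fin (n + 1), i.1 + 1 = j ∧ φ = fl f i := Iff.rfl

end prism

/-! ### The orders of the prism: strictness, pencil linearity, disjointness -/

namespace IsFullFlag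

variable {n : ℕ} {f : ℕ → S.Face}

open prism

theorem up_flag (hf : S.IsFullFlag n f) (hS : S.IsPositiveOpetopicCardinal) {j : ℕ} (hj : j ≤ n)
    (a : Prop) : Up f (f j) a ↔ a := by
  have h := hS.irrefl (f j)
  simp only [Up, hf.dim_eq j hj, true_and, h, or_false]

theorem boundary_flag (hf : S.IsFullFlag n f) {p : S.Face} {m : ℕ} (hm : m + 1 = S.dim p) :
    f m ∈ S.boundary (f (S.dim p)) := by
  have := hf.dim_le p
  rw [← hm]
  exact hf.mem_boundary m (by omega)

theorem le_γ_of_le (hf : S.IsFullFlag n f) (hS : S.IsPositiveOpetopicCardinal) {p : S.Face}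
    (hp : 0 < S.dim p) (h : S.UpperLE (f (S.dim p)) p) :
    S.UpperLE (f (S.dim (S.γ p))) (S.γ p) := by
  have hd := hS.dim_γ p hp
  refine (hS.le_γ (hf.boundary_flag hd)).trans (hS.γ_mono ?_ h)
  rw [hf.dim_eq _ (hf.dim_le p)]
  exact hp

theorem up_γ (hf : S.IsFullFlag n f) (hS : S.IsPositiveOpetopicCardinal) {p : S.Face} {a b : Prop}
    (hp : 0 < S.dim p) (h : Up f p a) (hb : b) : Up f (S.γ p) b :=
  up_of_le (hf.le_γ_of_le hS hp h.le) hb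

theorem _root_.HypergraphData.prism.step_fl {j : ℕ} (hj : j ≤ n) :
    (S.prism n f).UpperStep (pt n f (f j) False) (pt n f (f j) True) :=
  ⟨fl f ⟨j, by omega⟩, by simp, mem_δ_fl.2 (.inl rfl), rfl⟩

/-- The labels matter only for a flag face, and there the prism over it is a step from the lower to
the upper lift. -/
theorem pt_le (hf : S.IsFullFlag n f) (p : S.Face) {a b : Prop} (h : a → b) :
    (S.prism n f).UpperLE (pt n f p a) (pt n f p b) := by
  by_cases hab : Up f p a ↔ Up f p b
  · left; simp [hab]
  · have hp : p = f (S.dim p) := by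
      by_contra hne
      exact hab (up_iff_of_ne hne a b)
    have h1 : ¬ Up f p a := fun h' => hab ⟨up_mono h, fun _ => h'⟩
    have h2 : Up f p b := by
      by_contra h2
      exact hab (iff_of_false h1 h2)
    have e1 : pt n f p a = pt n f (f (S.dim p)) False := by
      rw [← hp, pt_eq_pt]
      exact ⟨rfl, iff_of_false h1 fun h => h1 (up_mono False.elim h)⟩
    have e2 : pt n f p b = pt n f (f (S.dim p)) True := by
      rw [← hp, pt_eq_pt]
      exact ⟨rfl, iff_of_true h2 (up_mono (fun _ => trivial) h2)⟩
    rw [e1, e2]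
    exact (step_fl (hf.dim_le p)).lt.le

/-- These labels are the worst case. If `q` is not strictly above the flag, its lower lift is the
required step; otherwise `q = γ A` for some `A`, and the path is rerouted through the smaller faces
of `δ A`. -/
theorem pt_lt_γ (hf : S.IsFullFlag n f) (hS : S.IsPositiveOpetopicCardinal) (q : S.Face) :
    ∀ t ∈ S.δ q, (S.prism n f).UpperLT (pt n f t True) (pt n f (S.γ q) False) := by
  induction q using hS.wf.induction with
  | _ q ih =>
    intro t ht
    by_cases hq : S.UpperLT (f (S.dim q)) q
    · obtain ⟨c, -, A, hA, hc, rfl⟩ := Relation.TransGen.tail'_iff.1 hq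
      have h1 := hS.pos_of_mem ht
      have h2 := hS.dim_γ A hA
      have hA2 : 2 ≤ S.dim A := by omega
      have key : ∀ t, ∀ c ∈ S.δ A, t ∈ S.δ c →
          (S.prism n f).UpperLT (pt n f t True) (pt n f (S.γ (S.γ A)) False) := by
        intro t
        induction t using hS.wf_swap.induction with
        | _ t iht =>
          intro c hc ht
          have h3 := ih c (hS.lt_γ hc) t ht
          rcases hS.γ_eq_or_mem hA2 hc with h | ⟨d, hd, h⟩
          · rwa [h] at h3
          · exact (h3.trans_le (hf.pt_le _ False.elim)).trans (iht _ (hS.lt_γ ht) d hd h)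
      obtain ⟨⟨c', hc', htc⟩, -⟩ := (hS.mem_δγ_iff hA2).1 ht
      exact key t c' hc' htc
    · have hup : ¬ Up f q False := fun h => hq (up_false.1 h)
      refine UpperStep.lt ⟨pt n f q False, hS.pos_of_mem ht, mem_δ_pt.2 (.inl ⟨t, ht, ?_⟩), ?_⟩
      · simp [hup]
      · simp [hup]

theorem pt_lt (hf : S.IsFullFlag n f) (hS : S.IsPositiveOpetopicCardinal) {p q : S.Face}
    (h : S.UpperLT p q) (a b : Prop) : (S.prism n f).UpperLT (pt n f p a) (pt n f q b) := by
  have key : (S.prism n f).UpperLT (pt n f p True) (pt n f q False) := by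
    induction h with
    | single h =>
      obtain ⟨A, hA, hp, rfl⟩ := h
      exact hf.pt_lt_γ hS A _ hp
    | tail _ h ih =>
      obtain ⟨A, hA, hp, rfl⟩ := h
      exact (ih.trans_le (hf.pt_le _ False.elim)).trans (hf.pt_lt_γ hS A _ hp)
  exact ((hf.pt_le p fun _ => trivial).trans_lt key).trans_le (hf.pt_le q False.elim)

/-- `fl f j` is an input of the next prism, whose codomain is the upper lift of `f (j + 1)`, the
least up lift of its dimension. -/
theorem fl_lt (hf : S.IsFullFlag n f) (hS : S.IsPositiveOpetopicCardinal) {j : Fin (n + 1)}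
    {p : S.Face} {a : Prop} (hd : S.dim p = j.1 + 1) (h : Up f p a) :
    (S.prism n f).UpperLT (fl f j) (pt n f p a) := by
  have hn := hf.dim_le p
  have h1 : (S.prism n f).UpperLT (fl f j) (pt n f (f (j.1 + 1)) True) :=
    UpperStep.lt ⟨fl f ⟨j.1 + 1, by omega⟩, by simp,
      mem_δ_fl.2 (.inr ⟨j, rfl, rfl⟩), rfl⟩
  rcases h.le with h2 | h2
  · have : pt n f p a = pt n f (f (j.1 + 1)) True := by
      rw [pt_eq_pt, hf.up_flag hS (by omega)]
      exact ⟨by rw [← hd, h2], by simp [h]⟩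
    rwa [this]
  · rw [hd] at h2
    exact h1.trans (hf.pt_lt hS h2 _ _)

theorem exists_pt_of_step (hf : S.IsFullFlag n f) (hS : S.IsPositiveOpetopicCardinal)
    {φ ψ : (S.prism n f).Face} (h : (S.prism n f).UpperStep φ ψ) :
    ∃ q b, ψ = pt n f q b ∧
      ((∃ p a, φ = pt n f p a ∧ (S.UpperLT p q ∨ (p = q ∧ ¬ Up f p a ∧ Up f q b))) ∨
        ∃ j : Fin (n + 1), φ = fl f j ∧ S.dim q = j.1 + 1 ∧ Up f q b) := by
  obtain ⟨α, hα, hφ, rfl⟩ := h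
  rcases face_cases α with ⟨p, a, hp, rfl⟩ | ⟨j, rfl⟩
  · refine ⟨_, _, γ_pt p a, ?_⟩
    rcases mem_δ_pt.1 hφ with ⟨t, ht, rfl⟩ | ⟨hup, j, hj, rfl⟩
    · exact .inl ⟨_, _, rfl, .inl (hS.lt_γ ht)⟩
    · have := hS.dim_γ p hα
      exact .inr ⟨j, rfl, by omega, hf.up_γ hS hα hup hup⟩
  · refine ⟨_, _, γ_fl j, ?_⟩
    have hj : j.1 ≤ n := by omega
    rcases mem_δ_fl.1 hφ with rfl | ⟨i, hi, rfl⟩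
    · exact .inl ⟨_, _, rfl, .inr ⟨rfl, by simp [hf.up_flag hS hj]⟩⟩
    · exact .inr ⟨i, rfl, by rw [hf.dim_eq _ hj, hi], by simp [hf.up_flag hS hj]⟩

/-- An invariant of chains, from which strictness is read off: the projection to `S` increases
strictly unless the chain only crosses one prism, and a prism cannot be crossed back. -/
theorem exists_pt_of_lt (hf : S.IsFullFlag n f) (hS : S.IsPositiveOpetopicCardinal)
    {φ ψ : (S.prism n f).Face} (h : (S.prism n f).UpperLT φ ψ) :
    ∃ q b, ψ = pt n f q b ∧
      ((∃ p a, φ = pt n f p a ∧ (S.UpperLT p q ∨ (p = q ∧ ¬ Up f p a ∧ Up f q b))) ∨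
        ∃ j : Fin (n + 1), φ = fl f j ∧ S.dim q = j.1 + 1 ∧ Up f q b) := by
  induction h with
  | single h => exact hf.exists_pt_of_step hS h
  | tail _ h ih =>
    obtain ⟨q, b, rfl, h1⟩ := ih
    obtain ⟨r, c, rfl, h2⟩ := hf.exists_pt_of_step hS h
    refine ⟨r, c, rfl, ?_⟩
    have h2' : S.UpperLT q r ∨ (q = r ∧ ¬ Up f q b ∧ Up f r c) := by
      rcases h2 with ⟨p, a, h3, h4⟩ | ⟨j, h3, -⟩
      · obtain ⟨rfl, h5⟩ := pt_eq_pt.1 h3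
        rcases h4 with h4 | h4
        · exact .inl h4
        · exact .inr ⟨h4.1, by tauto, h4.2.2⟩
      · exact (pt_ne_fl h3).elim
    rcases h1 with ⟨p, a, rfl, h3⟩ | ⟨j, rfl, h3, h4⟩
    · refine .inl ⟨p, a, rfl, ?_⟩
      rcases h3 with h3 | ⟨rfl, h3, h4⟩
      · rcases h2' with h2' | ⟨rfl, -⟩
        · exact .inl (h3.trans h2')
        · exact .inl h3
      · rcases h2' with h2' | ⟨rfl, h5, -⟩
        · exact .inl h2'
        · exact (h5 h4).elim
    · refine .inr ⟨j, rfl, ?_⟩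
      rcases h2' with h2' | ⟨rfl, h5, -⟩
      · have := hS.dim_lt h2'
        exact ⟨by omega, up_of_lt (this ▸ h4.le.trans_lt h2')⟩
      · exact (h5 h4).elim

theorem of_pt_lt (hf : S.IsFullFlag n f) (hS : S.IsPositiveOpetopicCardinal) {p q : S.Face}
    {a b : Prop} (h : (S.prism n f).UpperLT (pt n f p a) (pt n f q b)) :
    S.UpperLT p q ∨ (p = q ∧ ¬ Up f p a ∧ Up f q b) := by
  obtain ⟨q', b', h1, ⟨p', a', h2, h3⟩ | ⟨j, h2, -⟩⟩ := hf.exists_pt_of_lt hS h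
  · obtain ⟨rfl, h1⟩ := pt_eq_pt.1 h1
    obtain ⟨rfl, h2⟩ := pt_eq_pt.1 h2
    tauto
  · exact (pt_ne_fl h2).elim

theorem of_fl_lt (hf : S.IsFullFlag n f) (hS : S.IsPositiveOpetopicCardinal) {j : Fin (n + 1)}
    {q : S.Face} {b : Prop} (h : (S.prism n f).UpperLT (fl f j) (pt n f q b)) :
    S.dim q = j.1 + 1 ∧ Up f q b := by
  obtain ⟨q', b', h1, ⟨p', a', h2, h3⟩ | ⟨i, h2, h3⟩⟩ := hf.exists_pt_of_lt hS h
  · exact (fl_ne_pt h2).elim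
  · obtain ⟨rfl, h1⟩ := pt_eq_pt.1 h1
    obtain rfl := fl_eq_fl.1 h2
    tauto

theorem not_lt_fl (hf : S.IsFullFlag n f) (hS : S.IsPositiveOpetopicCardinal)
    (φ : (S.prism n f).Face) (j : Fin (n + 1)) : ¬ (S.prism n f).UpperLT φ (fl f j) := by
  intro h
  obtain ⟨q, b, h1, -⟩ := hf.exists_pt_of_lt hS h
  exact fl_ne_pt h1

theorem prism_irrefl (hf : S.IsFullFlag n f) (hS : S.IsPositiveOpetopicCardinal)
    (φ : (S.prism n f).Face) : ¬ (S.prism n f).UpperLT φ φ := by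
  intro h
  rcases face_cases φ with ⟨p, a, hp, rfl⟩ | ⟨j, rfl⟩
  · rcases hf.of_pt_lt hS h with h | h
    · exact hS.irrefl _ h
    · exact h.2.1 h.2.2
  · exact hf.not_lt_fl hS _ _ h

/-- Lifts of comparable faces are comparable. -/
theorem pt_comparable (hf : S.IsFullFlag n f) (hS : S.IsPositiveOpetopicCardinal) {p q : S.Face}
    (h : S.UpperLE p q ∨ S.UpperLT q p) (a b : Prop) :
    (S.prism n f).UpperLT (pt n f p a) (pt n f q b) ∨ pt n f p a = pt n f q b ∨
      (S.prism n f).UpperLT (pt n f q b) (pt n f p a) := by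
  rcases h with (rfl | h) | h
  · by_cases ha : a
    · rcases hf.pt_le p (fun _ : b => ha) with h | h
      exacts [.inr (.inl h.symm), .inr (.inr h)]
    · rcases hf.pt_le p (fun h : a => (ha h).elim : a → b) with h | h
      exacts [.inr (.inl h), .inl h]
  · exact .inl (hf.pt_lt hS h _ _)
  · exact .inr (.inr (hf.pt_lt hS h _ _))

theorem prism_strictness (hf : S.IsFullFlag n f) (hS : S.IsPositiveOpetopicCardinal) :
    (S.prism n f).Strictness := by
  refine ⟨hf.prism_irrefl hS, fun φ ψ hφ hψ => ?_⟩
  rcases face_cases φ with ⟨p, a, -, rfl⟩ | ⟨j, rfl⟩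
  · rcases face_cases ψ with ⟨q, b, -, rfl⟩ | ⟨j, rfl⟩
    · refine hf.pt_comparable hS ?_ a b
      rcases hS.strictness.2 p q hφ hψ with h | h | h
      exacts [.inl h.le, .inl (.inl h), .inr h]
    · simp at hψ
  · simp at hφ

theorem prism_pencilLinearity (hf : S.IsFullFlag n f) (hS : S.IsPositiveOpetopicCardinal) :
    (S.prism n f).PencilLinearity := by
  -- `fl f j` is comparable to every other face of its pencils
  have key : ∀ (χ : (S.prism n f).Face) (j : Fin (n + 1)) (q : S.Face) (b : Prop),
      S.dim q = j.1 + 1 →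
      ((χ = (S.prism n f).γ (fl f j) ∧ χ = (S.prism n f).γ (pt n f q b)) ∨
        (χ ∈ (S.prism n f).δ (fl f j) ∧ χ ∈ (S.prism n f).δ (pt n f q b))) →
      (S.prism n f).UpperLT (fl f j) (pt n f q b) := by
    intro χ j q b hq h
    refine hf.fl_lt hS hq ?_
    have hj : j.1 ≤ n := by omega
    rcases h with ⟨rfl, h⟩ | ⟨h1, h2⟩
    · simp only [γ_fl, γ_pt, pt_eq_pt, hf.up_flag hS hj] at h
      obtain ⟨h, h'⟩ := h
      rw [← h, hf.up_flag hS hj] at h'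
      exact h'.1 trivial
    · rcases mem_δ_pt.1 h2 with ⟨t, ht, rfl⟩ | h2
      · rcases mem_δ_fl.1 h1 with h1 | ⟨i, -, h1⟩
        · obtain ⟨rfl, h1⟩ := pt_eq_pt.1 h1
          simpa [hf.up_flag hS hj] using h1
        · exact (pt_ne_fl h1).elim
      · exact h2.1
  intro χ φ ψ hφ hψ h
  rcases face_cases φ with ⟨p, a, -, rfl⟩ | ⟨j, rfl⟩
  · rcases face_cases ψ with ⟨q, b, -, rfl⟩ | ⟨j, rfl⟩
    · refine hf.pt_comparable hS ?_ a b
      simp only [dim_pt] at hφ hψ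
      rcases h with ⟨h1, h2⟩ | ⟨h1, h2⟩
      · rw [h1, γ_pt, γ_pt, pt_eq_pt] at h2
        exact hS.pencil_γ (by omega) (by omega) h2.1
      · rcases mem_δ_pt.1 h1 with ⟨t, ht, rfl⟩ | ⟨h3, j, hj, rfl⟩
        · rcases mem_δ_pt.1 h2 with ⟨t', ht', h4⟩ | ⟨h3, j, hj, h4⟩
          · obtain ⟨rfl, -⟩ := pt_eq_pt.1 h4
            exact hS.pencil_δ ht ht'
          · exact (pt_ne_fl h4).elim
        · rcases mem_δ_pt.1 h2 with ⟨t', ht', h4⟩ | ⟨h5, i, hi, h4⟩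
          · exact (fl_ne_pt h4).elim
          -- Two faces with a common prism as input both lie above the flag face of their dimension.
          · have e : S.dim p = S.dim q := by omega
            exact hS.linear_above h3.le (e ▸ h5.le)
    · simp only [dim_pt, dim_fl] at hφ hψ
      exact .inr (.inr (key χ j p a (by omega) (h.imp And.symm And.symm)))
  · rcases face_cases ψ with ⟨q, b, -, rfl⟩ | ⟨i, rfl⟩
    · simp only [dim_pt, dim_fl] at hφ hψ
      exact .inl (key χ j q b (by omega) h)
    · simp only [dim_fl] at hφ hψ
      right; left
      rw [fl_eq_fl]; omega

theorem lowerStep_pt_pt {p q : S.Face} {a b : Prop}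
    (h : (S.prism n f).LowerStep (pt n f p a) (pt n f q b)) : S.LowerStep p q := by
  refine ⟨h.1, h.2.1, ?_⟩
  rcases mem_δ_pt.1 h.2.2 with ⟨t, ht, h1⟩ | ⟨-, j, -, h1⟩
  · obtain ⟨rfl, -⟩ := pt_eq_pt.1 h1
    exact ht
  · exact (pt_ne_fl h1).elim

theorem lowerStep_pt_fl (hf : S.IsFullFlag n f) (hS : S.IsPositiveOpetopicCardinal) {p : S.Face}
    {a : Prop} {j : Fin (n + 1)} (h : (S.prism n f).LowerStep (pt n f p a) (fl f j)) :
    S.dim p = j.1 + 1 ∧ S.γ p = f j ∧ ¬ Up f p a := by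
  refine ⟨h.2.1, ?_⟩
  rcases mem_δ_fl.1 h.2.2 with h1 | ⟨i, -, h1⟩
  · rw [γ_pt, pt_eq_pt] at h1
    have hj : j.1 ≤ n := by omega
    refine ⟨h1.1, ?_⟩
    have := h1.2
    rw [h1.1, hf.up_flag hS hj, hf.up_flag hS hj] at this
    tauto
  · exact (pt_ne_fl h1).elim

theorem lowerStep_fl_pt (hf : S.IsFullFlag n f) (hS : S.IsPositiveOpetopicCardinal) {q : S.Face}
    {b : Prop} {j : Fin (n + 1)} (h : (S.prism n f).LowerStep (fl f j) (pt n f q b)) :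
    S.dim q = j.1 + 1 ∧ f j ∈ S.δ q ∧ ¬ Up f q b := by
  refine ⟨h.2.1.symm, ?_⟩
  have hj : j.1 ≤ n := by omega
  rcases mem_δ_pt.1 h.2.2 with ⟨t, ht, h1⟩ | ⟨-, i, -, h1⟩
  · rw [γ_fl, pt_eq_pt] at h1
    obtain ⟨rfl, h1⟩ := h1
    rw [hf.up_flag hS hj, hf.up_flag hS hj] at h1
    tauto
  · exact (pt_ne_fl h1).elim

theorem not_lowerStep_fl_fl (hf : S.IsFullFlag n f) (hS : S.IsPositiveOpetopicCardinal)
    {i j : Fin (n + 1)} : ¬ (S.prism n f).LowerStep (fl f i) (fl f j) := by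
  intro h
  have h1 : i = j := by have := h.2.1; simp only [dim_fl] at this; omega
  subst h1
  rcases mem_δ_fl.1 h.2.2 with h1 | ⟨i, -, h1⟩
  · rw [γ_fl, pt_eq_pt, hf.up_flag hS (by omega), hf.up_flag hS (by omega)] at h1
    tauto
  · exact (pt_ne_fl h1).elim

/-- A lower chain enters the prism `fl f j` from a face with codomain `f j` and leaves it to a face
with input `f j`. These two are adjacent in `S`, so the prism can be cut out of the chain. -/
theorem lowerLT_of_pt (hf : S.IsFullFlag n f) (hS : S.IsPositiveOpetopicCardinal) {p : S.Face}
    {a : Prop} {ψ : (S.prism n f).Face} (h : (S.prism n f).LowerLT (pt n f p a) ψ) :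
    (∃ q b, ψ = pt n f q b ∧ S.LowerLT p q) ∨
      ∃ j : Fin (n + 1), ψ = fl f j ∧ S.dim p = j.1 + 1 ∧ ∃ p' a', S.γ p' = f j ∧ ¬ Up f p' a' ∧
        ((p = p' ∧ (Up f p a ↔ Up f p' a')) ∨ S.LowerLT p p') := by
  induction h with
  | @single ψ h =>
    rcases face_cases ψ with ⟨q, b, -, rfl⟩ | ⟨j, rfl⟩
    · exact .inl ⟨q, b, rfl, (lowerStep_pt_pt h).lt⟩
    · obtain ⟨h1, h2, h3⟩ := hf.lowerStep_pt_fl hS h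
      exact .inr ⟨j, rfl, h1, p, a, h2, h3, .inl ⟨rfl, Iff.rfl⟩⟩
  | @tail χ ψ _ h ih =>
    rcases ih with ⟨q, b, rfl, h1⟩ | ⟨j, rfl, h0, p', a', h1, h2, h3⟩
    · rcases face_cases ψ with ⟨r, c, -, rfl⟩ | ⟨j, rfl⟩
      · exact .inl ⟨r, c, rfl, h1.trans (lowerStep_pt_pt h).lt⟩
      · obtain ⟨h2, h3, h4⟩ := hf.lowerStep_pt_fl hS h
        exact .inr ⟨j, rfl, h1.dim_eq.2.trans h2, q, b, h3, h4, .inr h1⟩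
    · rcases face_cases ψ with ⟨r, c, -, rfl⟩ | ⟨i, rfl⟩
      · obtain ⟨h4, h5, h6⟩ := hf.lowerStep_fl_pt hS h
        left
        refine ⟨r, c, rfl, ?_⟩
        have h7 : S.dim p = S.dim p' := by
          rcases h3 with h3 | h3
          exacts [by rw [h3.1], h3.dim_eq.2]
        have h8 : S.LowerLT p' r := LowerStep.lt ⟨by omega, by omega, h1 ▸ h5⟩
        rcases h3 with ⟨rfl, -⟩ | h3
        exacts [h8, h3.trans h8]
      · exact (hf.not_lowerStep_fl_fl hS h).elim

theorem lowerLT_of_fl (hf : S.IsFullFlag n f) (hS : S.IsPositiveOpetopicCardinal)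
    {j : Fin (n + 1)} {ψ : (S.prism n f).Face} (h : (S.prism n f).LowerLT (fl f j) ψ) :
    (∃ i, ψ = fl f i) ∨
      ∃ q b, ψ = pt n f q b ∧ S.dim q = j.1 + 1 ∧ ∃ p' a', f j ∈ S.δ p' ∧ ¬ Up f p' a' ∧
        ((p' = q ∧ (Up f p' a' ↔ Up f q b)) ∨ S.LowerLT p' q) := by
  induction h with
  | @single ψ h =>
    rcases face_cases ψ with ⟨q, b, -, rfl⟩ | ⟨i, rfl⟩
    · obtain ⟨h1, h2, h3⟩ := hf.lowerStep_fl_pt hS h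
      exact .inr ⟨q, b, rfl, h1, q, b, h2, h3, .inl ⟨rfl, Iff.rfl⟩⟩
    · exact .inl ⟨i, rfl⟩
  | @tail χ ψ h0 h ih =>
    rcases face_cases ψ with ⟨r, c, -, rfl⟩ | ⟨i, rfl⟩
    · right
      refine ⟨r, c, rfl, ?_⟩
      rcases ih with ⟨i, rfl⟩ | ⟨q, b, rfl, h1, p', a', h2, h3, h4⟩
      · have hij : i = j := by have := (LowerLT.dim_eq h0).2; simp only [dim_fl] at this; omega
        subst hij
        obtain ⟨h4, h5, h6⟩ := hf.lowerStep_fl_pt hS h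
        exact ⟨h4, r, c, h5, h6, .inl ⟨rfl, Iff.rfl⟩⟩
      · have h5 := lowerStep_pt_pt h
        refine ⟨h5.2.1 ▸ h1, p', a', h2, h3, .inr ?_⟩
        rcases h4 with ⟨rfl, -⟩ | h4
        exacts [h5.lt, h4.trans h5.lt]
    · exact .inl ⟨i, rfl⟩

theorem prism_disjointness (hf : S.IsFullFlag n f) (hS : S.IsPositiveOpetopicCardinal) :
    (S.prism n f).Disjointness := by
  have hpt : ∀ p a q b, (S.prism n f).LowerLT (pt n f p a) (pt n f q b) → S.LowerLT p q := by
    intro p a q b h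
    rcases hf.lowerLT_of_pt hS h with ⟨r, c, h1, h2⟩ | ⟨j, h1, -⟩
    · obtain ⟨rfl, -⟩ := pt_eq_pt.1 h1
      exact h2
    · exact (pt_ne_fl h1).elim
  have hle : ∀ p a q b, (S.prism n f).UpperLT (pt n f p a) (pt n f q b) → S.UpperLE p q := by
    intro p a q b h
    rcases hf.of_pt_lt hS h with h | h
    exacts [h.le, .inl h.1]
  -- `fl f j` is not comparable in the lower order to the faces above it
  have hfl : ∀ (j : Fin (n + 1)) q b, (S.prism n f).UpperLT (fl f j) (pt n f q b) →
      ¬ ((S.prism n f).LowerLT (fl f j) (pt n f q b) ∨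
        (S.prism n f).LowerLT (pt n f q b) (fl f j)) := by
    intro j q b h hl
    obtain ⟨hd, hup⟩ := hf.of_fl_lt hS h
    have hle := hup.le
    have hn := hf.dim_le q
    have hdf := hf.dim_eq _ hn
    -- `f j` is the codomain or an input of a flag face that is `≤⁺ q`. In either case a lower
    -- comparison of `fl f j` with `q` yields two faces of `S` comparable in both orders, or a lift
    -- that is both up and not up.
    have hb : f j ∈ S.boundary (f (S.dim q)) := hf.boundary_flag hd.symm
    rcases hl with hl | hl
    · rcases hf.lowerLT_of_fl hS hl with ⟨i, h1⟩ | ⟨r, c, h1, -, p', a', h2, h3, h4⟩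
      · exact pt_ne_fl h1
      obtain ⟨rfl, h1⟩ := pt_eq_pt.1 h1
      rcases mem_boundary_iff.1 hb with h5 | h5
      · have h6 : S.LowerLT (f (S.dim q)) p' := hS.lowerLT_of_le (by omega) (.inl h5.symm) h2
        rcases h4 with ⟨rfl, -⟩ | h4
        · exact hS.disjoint_le h6 hle
        · exact hS.disjoint_le (h6.trans h4) hle
      · rcases h4 with ⟨rfl, h4⟩ | h4
        · exact h3 (h4.2 (h1.1 hup))
        · rcases hS.pencil_δ h2 h5 with h6 | h6
          · exact hS.disjoint_le h4 (h6.trans hle)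
          · rcases hS.linear_above h6.le hle with h7 | h7
            · exact hS.disjoint_le h4 h7
            · exact hS.disjoint_ge h4 h7.le
    · rcases hf.lowerLT_of_pt hS hl with ⟨r, c, h1, -⟩ | ⟨i, h1, -, p', a', h2, h3, h4⟩
      · exact fl_ne_pt h1
      obtain rfl := fl_eq_fl.1 h1
      rcases mem_boundary_iff.1 hb with h5 | h5
      · rcases h4 with ⟨rfl, h4⟩ | h4
        · exact h3 (h4.1 hup)
        · have hd' := h4.dim_eq.2
          rcases hS.pencil_γ (by omega) (by omega) (h2.trans h5) with h6 | h6
          · exact hS.disjoint_ge h4 (h6.trans hle)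
          · rcases hS.linear_above h6.le hle with h7 | h7
            · exact hS.disjoint_ge h4 h7
            · exact hS.disjoint_le h4 h7.le
      · have hp' : 0 < S.dim p' := by
          rcases h4 with ⟨rfl, -⟩ | h4
          · omega
          · have := h4.dim_eq; omega
        have h6 : S.LowerLT p' (f (S.dim q)) := hS.lowerLT_of_le hp' (.inl h2) h5
        rcases h4 with ⟨rfl, -⟩ | h4
        · exact hS.disjoint_ge h6 hle
        · exact hS.disjoint_ge (h4.trans h6) hle
  rintro φ ψ hφ hψ ⟨hl, hu⟩
  rcases face_cases φ with ⟨p, a, -, rfl⟩ | ⟨j, rfl⟩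
  · rcases face_cases ψ with ⟨q, b, -, rfl⟩ | ⟨j, rfl⟩
    · rcases hl with hl | hl <;> rcases hu with hu | hu
      · exact hS.disjoint_le (hpt _ _ _ _ hl) (hle _ _ _ _ hu)
      · exact hS.disjoint_ge (hpt _ _ _ _ hl) (hle _ _ _ _ hu)
      · exact hS.disjoint_ge (hpt _ _ _ _ hl) (hle _ _ _ _ hu)
      · exact hS.disjoint_le (hpt _ _ _ _ hl) (hle _ _ _ _ hu)
    · rcases hu with hu | hu
      · exact hf.not_lt_fl hS _ _ hu
      · exact hfl j p a hu hl.symm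
  · rcases face_cases ψ with ⟨q, b, -, rfl⟩ | ⟨i, rfl⟩
    · rcases hu with hu | hu
      · exact hfl j q b hu hl
      · exact hf.not_lt_fl hS _ _ hu
    · rcases hu with hu | hu
      · exact hf.not_lt_fl hS _ _ hu
      · exact hf.not_lt_fl hS _ _ hu

end IsFullFlag

/-! ### Globularity of the prism, and the prism as a positive opetope -/

/-- The propositional core of globularity at a lift of `f m`. Here `D` is `δ p`, `g t` and `d t`
mean `γ t = f m` and `f m ∈ δ t`, the labels of `p`, `γ p` and the inputs are `U`, `B` and `A`, and
`σ` is the label of the lift. The terms `U ∧ σ` and `U ∧ ¬ σ` come from the codomain and the domain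
of the extra input `fl f m`; the hypothesis `h` is supplied by `up_γ_cases`. -/
theorem globularity_aux {α : Type*} {D : Set α} {g d A : α → Prop} {U B : Prop} (σ : Prop)
    (irr : ∀ t, g t → ¬ d t)
    (h : (U ∧ B ∧ (∀ t ∈ D, ¬ A t) ∧ ∃ t ∈ D, g t ∨ d t) ∨
      (¬ U ∧ B ∧ ∃ t₀ ∈ D, (∀ t ∈ D, A t ↔ t = t₀) ∧ (∀ t ∈ D, t ≠ t₀ → g t → d t₀) ∧
        (∀ t ∈ D, t ≠ t₀ → d t → g t₀)) ∨
      (¬ U ∧ ¬ B ∧ (∀ t ∈ D, ¬ A t) ∧ ∀ t ∈ D, ∀ t' ∈ D, g t → ¬ d t')) :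
    ((((∃ t ∈ D, g t) ∧ ∀ t ∈ D, ¬ d t) ∧ (σ ↔ B)) ↔
      ((∃ t ∈ D, g t ∧ (σ ↔ A t)) ∨ (U ∧ σ)) ∧ ¬ ((∃ t ∈ D, d t ∧ (σ ↔ ¬ A t)) ∨ (U ∧ ¬ σ))) ∧
    ((((∃ t ∈ D, d t) ∧ ∀ t ∈ D, ¬ g t) ∧ (σ ↔ ¬ B)) ↔
      ((∃ t ∈ D, d t ∧ (σ ↔ ¬ A t)) ∨ (U ∧ ¬ σ)) ∧ ¬ ((∃ t ∈ D, g t ∧ (σ ↔ A t)) ∨ (U ∧ σ))) := by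
  rcases h with ⟨hU, hB, hA, t, ht, h⟩ | ⟨hU, hB, t, ht, hA, h1, h2⟩ | ⟨hU, hB, hA, h⟩
  · have e : ∀ (p : α → Prop), (∃ t ∈ D, p t ∧ (σ ↔ A t)) ↔ (∃ t ∈ D, p t) ∧ ¬ σ := by grind
    have e' : ∀ (p : α → Prop), (∃ t ∈ D, p t ∧ (σ ↔ ¬ A t)) ↔ (∃ t ∈ D, p t) ∧ σ := by grind
    rw [e, e']
    clear e e'
    by_cases hσ : σ <;> simp only [hσ, hU, hB] <;> grind
  · by_cases hσ : σ
    · have e : ∀ (p : α → Prop), (∃ t ∈ D, p t ∧ (σ ↔ A t)) ↔ p t := by grind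
      have e' : ∀ (p : α → Prop), (∃ t ∈ D, p t ∧ (σ ↔ ¬ A t)) ↔ ∃ t' ∈ D, p t' ∧ t' ≠ t := by
        grind
      rw [e, e']
      clear e e'
      simp only [hσ, hU, hB]
      grind
    · have e : ∀ (p : α → Prop), (∃ t ∈ D, p t ∧ (σ ↔ ¬ A t)) ↔ p t := by grind
      have e' : ∀ (p : α → Prop), (∃ t ∈ D, p t ∧ (σ ↔ A t)) ↔ ∃ t' ∈ D, p t' ∧ t' ≠ t := by
        grind
      rw [e, e']
      clear e e'
      simp only [hσ, hU, hB]
      grind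
  · have e : ∀ (p : α → Prop), (∃ t ∈ D, p t ∧ (σ ↔ A t)) ↔ (∃ t ∈ D, p t) ∧ ¬ σ := by grind
    have e' : ∀ (p : α → Prop), (∃ t ∈ D, p t ∧ (σ ↔ ¬ A t)) ↔ (∃ t ∈ D, p t) ∧ σ := by grind
    rw [e, e']
    clear e e'
    by_cases hσ : σ <;> simp only [hσ, hU, hB] <;> grind

namespace IsPositiveOpetopicCardinal

theorem γγ_eq_iff (hS : S.IsPositiveOpetopicCardinal) {q v : S.Face} (hq : 2 ≤ S.dim q) :
    S.γ (S.γ q) = v ↔ (∃ t ∈ S.δ q, S.γ t = v) ∧ ∀ t ∈ S.δ q, v ∉ S.δ t := by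
  constructor
  · rintro rfl
    exact ⟨hS.γγ_mem hq, fun t ht => hS.γγ_notMem hq ht⟩
  · rintro ⟨⟨t, ht, rfl⟩, h⟩
    rcases hS.γ_eq_or_mem hq ht with h' | ⟨d, hd, h'⟩
    exacts [h'.symm, (h d hd h').elim]

theorem exists_mem_δ_of_boundary_boundary (hS : S.IsPositiveOpetopicCardinal) {q z v : S.Face}
    (hq : 2 ≤ S.dim q) (hz : z ∈ S.boundary q) (hv : v ∈ S.boundary z) :
    ∃ t ∈ S.δ q, S.γ t = v ∨ v ∈ S.δ t := by
  rcases mem_boundary_iff.1 hz with rfl | hz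
  · rcases mem_boundary_iff.1 hv with rfl | hv
    · obtain ⟨t, ht, h⟩ := hS.γγ_mem hq
      exact ⟨t, ht, .inl h⟩
    · obtain ⟨⟨t, ht, h⟩, -⟩ := (hS.mem_δγ_iff hq).1 hv
      exact ⟨t, ht, .inr h⟩
  · rcases mem_boundary_iff.1 hv with rfl | hv
    exacts [⟨z, hz, .inl rfl⟩, ⟨z, hz, .inr hv⟩]

theorem exists_le_δ (hS : S.IsPositiveOpetopicCardinal) {x y q : S.Face} (hx : 0 < S.dim x)
    (hy : y ∈ S.boundary x) (hq : 0 < S.dim q) (hxq : ¬ S.UpperLT x q)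
    (h : S.UpperLT y (S.γ q)) : ∃ t ∈ S.δ q, S.UpperLE y t := by
  rcases hS.le_δ_or_le hx hy hq h with h' | rfl | h'
  · exact h'
  · rcases mem_boundary_iff.1 hy with rfl | hy
    exacts [(hS.irrefl _ h).elim, ⟨y, hy, .refl _⟩]
  · exact (hxq h').elim

/-- If `v` were the codomain of `y`, or of a face strictly below `t`, pencil linearity would make
`t'` comparable to a face `≤⁺ t`, contradicting the incomparability of distinct inputs. Only `v ∈ δ
t` is left. -/
theorem mem_δ_of_γ_eq (hS : S.IsPositiveOpetopicCardinal) {y v t t' q : S.Face}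
    (hy : 0 < S.dim y) (hv : v ∈ S.boundary y) (ht : t ∈ S.δ q) (ht' : t' ∈ S.δ q)
    (hyt : S.UpperLE y t) (hne : t' ≠ t) (hγ : S.γ t' = v) : v ∈ S.δ t := by
  have hd := hS.dim_le hyt
  have h1 := hS.dim_δ _ _ ht
  have h2 := hS.dim_δ _ _ ht'
  rcases mem_boundary_iff.1 hv with hv | hv
  · rcases hS.pencil_γ hy (by omega) (hv.symm.trans hγ.symm) with h | h
    · exact (hne (hS.eq_of_le_le ht' ht h hyt)).elim
    · exact (hS.not_lt_of_mem_δ ht' ht (h.trans_le hyt)).elim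
  · rcases hS.mem_δ_or_exists_γ hyt hv with h | ⟨β, h, h'⟩
    · exact h
    · have := hS.dim_lt h
      rcases hS.pencil_γ (a := β) (b := t') (by omega) (by omega) (h'.trans hγ.symm) with h3 | h3
      · exact (hne (hS.eq_of_le_le ht' ht h3 h.le)).elim
      · exact (hS.not_lt_of_mem_δ ht' ht (h3.trans h)).elim

theorem γ_eq_of_mem_δ (hS : S.IsPositiveOpetopicCardinal) {y v t t' q : S.Face}
    (hy : 0 < S.dim y) (hv : v ∈ S.boundary y) (ht : t ∈ S.δ q) (ht' : t' ∈ S.δ q)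
    (hyt : S.UpperLE y t) (hne : t' ≠ t) (hδ : v ∈ S.δ t') : S.γ t = v := by
  have hd := hS.dim_le hyt
  rcases mem_boundary_iff.1 hv with hvy | hvy
  · by_contra hγ
    have h1 : S.UpperLT v (S.γ t) := (hvy ▸ hS.γ_mono hy hyt).lt_of_ne (Ne.symm hγ)
    rcases hS.le_δ_or_le (hS.pos_of_mem hδ) (δ_subset_boundary _ hδ) (by omega) h1 with
      ⟨r, hr, h2⟩ | h2
    · rcases h2 with rfl | h2
      · exact hne (hS.eq_of_comparable ht' ht (hS.pencil_δ hδ hr))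
      · exact hS.not_lt_of_boundary hy hyt hv hr h2
    · exact hne (hS.eq_of_le_of_mem_δ ht' ht h2)
  · rcases hS.pencil_δ hvy hδ with h | h
    · exact (hne (hS.eq_of_le_le ht' ht h hyt)).elim
    · exact (hS.not_lt_of_mem_δ ht' ht (h.trans_le hyt)).elim

/-- If two inputs were glued along `v`, pencil linearity would put `y` below an input, hence below
`γ q`, or an input below `y`. In the second case `γ q ≤⁺ y`, so both inputs lie below `y`, against
strictness or disjointness. -/
theorem not_mem_δ_of_γ_eq (hS : S.IsPositiveOpetopicCardinal) {y v t t' q : S.Face}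
    (hy : 0 < S.dim y) (hv : v ∈ S.boundary y) (ht : t ∈ S.δ q) (ht' : t' ∈ S.δ q)
    (hyq : ¬ S.UpperLT y (S.γ q)) (hγ : S.γ t = v) : v ∉ S.δ t' := by
  intro hδ
  have hp := hS.pos_of_mem hδ
  have hd := hS.dim_δ _ _ ht
  have hd' := hS.dim_δ _ _ ht'
  have above : ∀ r ∈ S.δ q, S.UpperLT r y → S.UpperLE (S.γ q) y := fun r hr h =>
    (hS.linear_above (hS.lt_γ hr).le h.le).resolve_right hyq
  rcases mem_boundary_iff.1 hv with hvy | hvy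
  · rcases hS.pencil_γ hy (by omega) (hvy.symm.trans hγ.symm) with h | h
    · exact hyq (h.trans_lt (hS.lt_γ ht))
    · have h1 := (hS.lt_γ ht').trans_le (above t ht h)
      exact hS.not_le_of_lt (hS.lt_γ hδ) (hvy ▸ hS.γ_mono hp h1.le)
  · rcases hS.pencil_δ hvy hδ with h | h
    · exact hyq (h.trans_lt (hS.lt_γ ht'))
    · have h1 := (hS.lt_γ ht).trans_le (above t' ht' h)
      refine hS.disjoint_le (LowerStep.lt ⟨by omega, ?_, hγ ▸ hvy⟩) h1.le
      exact hS.dim_lt h1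

end IsPositiveOpetopicCardinal

namespace IsFullFlag

variable {n : ℕ} {f : ℕ → S.Face}

open prism

/-- The flag runs below `p` itself, or below exactly one input `t₀` of `p`, or below neither. The
clauses on `f m` record how it is glued inside `δ p`: not at all in the last case, and only along
`t₀` in the second. -/
theorem up_γ_cases (hf : S.IsFullFlag n f) (hS : S.IsPositiveOpetopicCardinal) {p : S.Face}
    {m : ℕ} (hp : S.dim p = m + 2) (a : Prop) :
    (Up f p a ∧ Up f (S.γ p) (Up f p a) ∧ (∀ t ∈ S.δ p, ¬ Up f t (¬ Up f p a)) ∧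
      ∃ t ∈ S.δ p, S.γ t = f m ∨ f m ∈ S.δ t) ∨
    (¬ Up f p a ∧ Up f (S.γ p) (Up f p a) ∧ ∃ t₀ ∈ S.δ p,
      (∀ t ∈ S.δ p, Up f t (¬ Up f p a) ↔ t = t₀) ∧
      (∀ t ∈ S.δ p, t ≠ t₀ → S.γ t = f m → f m ∈ S.δ t₀) ∧
      (∀ t ∈ S.δ p, t ≠ t₀ → f m ∈ S.δ t → S.γ t₀ = f m)) ∨
    (¬ Up f p a ∧ ¬ Up f (S.γ p) (Up f p a) ∧ (∀ t ∈ S.δ p, ¬ Up f t (¬ Up f p a)) ∧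
      ∀ t ∈ S.δ p, ∀ t' ∈ S.δ p, S.γ t = f m → f m ∉ S.δ t') := by
  have hn := hf.dim_le p
  have hx : S.dim (f (m + 2)) = m + 2 := hf.dim_eq _ (by omega)
  have hy : S.dim (f (m + 1)) = m + 1 := hf.dim_eq _ (by omega)
  have hxy : f (m + 1) ∈ S.boundary (f (m + 2)) := hf.mem_boundary _ (by omega)
  have hyv : f m ∈ S.boundary (f (m + 1)) := hf.mem_boundary _ (by omega)
  have hdγ : S.dim (S.γ p) = m + 1 := by have := hS.dim_γ p (by omega); omega
  have hdδ : ∀ t ∈ S.δ p, S.dim t = m + 1 := fun t ht => by have := hS.dim_δ p t ht; omega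
  by_cases hU : Up f p a
  · refine .inl ⟨hU, hf.up_γ hS (by omega) hU hU, ?_, ?_⟩
    · rintro t ht (⟨-, h⟩ | h)
      · exact h hU
      · have hle := hU.le
        rw [hp] at hle
        rw [hdδ t ht] at h
        exact hS.not_lt_of_boundary (by omega) hle hxy ht h
    · have hle := hU.le
      rw [hp] at hle
      obtain ⟨z, hz, hvz⟩ := hS.exists_boundary_boundary (by omega) hle hxy hyv
      exact hS.exists_mem_δ_of_boundary_boundary (by omega) hz hvz
  · right
    have hxp : ¬ S.UpperLT (f (m + 2)) p := fun h => hU (up_of_lt (by rwa [hp]))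
    have hBiff : Up f (S.γ p) (Up f p a) ↔ S.UpperLT (f (m + 1)) (S.γ p) := by
      simp only [hU, up_false, hdγ]
    by_cases hlt : S.UpperLT (f (m + 1)) (S.γ p)
    · obtain ⟨t₀, ht₀, hle⟩ := hS.exists_le_δ (by omega) hxy (by omega) hxp hlt
      refine .inl ⟨hU, hBiff.2 hlt, t₀, ht₀, ?_, ?_, ?_⟩
      · intro t ht
        simp only [hU, not_false_eq_true, up_true, hdδ t ht]
        exact ⟨fun h => hS.eq_of_le_le ht ht₀ h hle, fun h => h ▸ hle⟩
      · intro t ht hne h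
        exact hS.mem_δ_of_γ_eq (by omega) hyv ht₀ ht hle hne h
      · intro t ht hne h
        exact hS.γ_eq_of_mem_δ (by omega) hyv ht₀ ht hle hne h
    · refine .inr ⟨hU, fun h => hlt (hBiff.1 h), ?_, ?_⟩
      · intro t ht h
        have h1 := h.le
        rw [hdδ t ht] at h1
        exact hlt (h1.trans_lt (hS.lt_γ ht))
      · intro t ht t' ht' h
        exact hS.not_mem_δ_of_γ_eq (by omega) hyv ht ht' hlt h

theorem globularity_pt (hf : S.IsFullFlag n f) (hS : S.IsPositiveOpetopicCardinal) {p : S.Face}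
    (hp : 2 ≤ S.dim p) (a : Prop) (φ : (S.prism n f).Face) :
    (φ = pt n f (S.γ (S.γ p)) (Up f (S.γ p) (Up f p a)) ↔
      φ ∈ (S.prism n f).γ '' (S.prism n f).δ (pt n f p a) \
        ⋃ b ∈ (S.prism n f).δ (pt n f p a), (S.prism n f).δ b) ∧
    (φ ∈ (S.prism n f).δ (pt n f (S.γ p) (Up f p a)) ↔
      φ ∈ (⋃ b ∈ (S.prism n f).δ (pt n f p a), (S.prism n f).δ b) \
        (S.prism n f).γ '' (S.prism n f).δ (pt n f p a)) := by
  obtain ⟨m, hm⟩ := Nat.exists_eq_add_of_le' hp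
  have hn := hf.dim_le p
  have hγ : ∀ φ, φ ∈ (S.prism n f).γ '' (S.prism n f).δ (pt n f p a) ↔
      (∃ t ∈ S.δ p, φ = pt n f (S.γ t) (Up f t (¬ Up f p a))) ∨
        (Up f p a ∧ φ = pt n f (f m) True) := by
    intro φ
    constructor
    · rintro ⟨ψ, hψ, rfl⟩
      rcases mem_δ_pt.1 hψ with ⟨t, ht, rfl⟩ | ⟨hU, j, hj, rfl⟩
      · exact .inl ⟨t, ht, rfl⟩
      · obtain rfl : j.1 = m := by omega
        exact .inr ⟨hU, rfl⟩
    · rintro (⟨t, ht, rfl⟩ | ⟨hU, rfl⟩)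
      · exact ⟨_, mem_δ_pt.2 (.inl ⟨t, ht, rfl⟩), rfl⟩
      · exact ⟨_, mem_δ_pt.2 (.inr ⟨hU, ⟨m, by omega⟩, hm.symm, rfl⟩), rfl⟩
  have hδ : ∀ φ, φ ∈ (⋃ b ∈ (S.prism n f).δ (pt n f p a), (S.prism n f).δ b) ↔
      (∃ t ∈ S.δ p, φ ∈ (S.prism n f).δ (pt n f t (¬ Up f p a))) ∨
        (Up f p a ∧ ∃ j : Fin (n + 1), j.1 = m ∧ φ ∈ (S.prism n f).δ (fl f j)) := by
    intro φ
    simp only [mem_iUnion₂, mem_δ_pt (p := p)]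
    constructor
    · rintro ⟨ψ, ⟨t, ht, rfl⟩ | ⟨hU, j, hj, rfl⟩, h⟩
      · exact .inl ⟨t, ht, h⟩
      · exact .inr ⟨hU, j, by omega, h⟩
    · rintro (⟨t, ht, h⟩ | ⟨hU, j, hj, h⟩)
      · exact ⟨_, .inl ⟨t, ht, rfl⟩, h⟩
      · exact ⟨_, .inr ⟨hU, j, by omega, rfl⟩, h⟩
  have hdδ : ∀ t ∈ S.δ p, S.dim t = m + 1 := fun t ht => by have := hS.dim_δ p t ht; omega
  have hdγ : S.dim (S.γ p) = m + 1 := by have := hS.dim_γ p (by omega); omega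
  have hdγ' : ∀ t ∈ S.δ p, S.dim (S.γ t) = m := fun t ht => by
    have h1 := hdδ t ht; have := hS.dim_γ t (by omega); omega
  have hdδ' : ∀ t ∈ S.δ p, ∀ s ∈ S.δ t, S.dim s = m := fun t ht s hs => by
    have h1 := hdδ t ht; have := hS.dim_δ t s hs; omega
  have hdγγ : S.dim (S.γ (S.γ p)) = m := by have := hS.dim_γ (S.γ p) (by omega); omega
  have cases := hf.up_γ_cases hS hm a
  rw [mem_sdiff, mem_sdiff, hγ, hδ]
  rcases face_cases φ with ⟨s, σ, hσ, rfl⟩ | ⟨j, rfl⟩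
  · simp only [mem_δ_pt, mem_δ_fl, pt_eq_pt, pt_ne_fl, and_false, exists_false, or_false]
    have g1 := hS.γγ_eq_iff hp (v := s)
    have g2 := hS.mem_δγ_iff hp (s := s)
    -- In dimension `m` only `f m` has two lifts; for any other `s` the labels are immaterial and
    -- the claim is globularity of `S`.
    by_cases hs : s = f m
    · subst hs
      have hup : ∀ b, Up f (f m) b ↔ b := hf.up_flag hS (by omega)
      have irr : ∀ t, S.γ t = f m → f m ∉ S.δ t := fun t h h' => hS.γ_notMem_δ t (h ▸ h')
      have e1 : (f m = S.γ (S.γ p) ∧ (Up f (f m) σ ↔ Up f (S.γ (S.γ p)) (Up f (S.γ p) (Up f p a))))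
          ↔ S.γ (S.γ p) = f m ∧ (σ ↔ Up f (S.γ p) (Up f p a)) := by
        constructor <;> rintro ⟨h, h'⟩
        · rw [← h, hup, hup] at h'; exact ⟨h.symm, h'⟩
        · rw [h, hup, hup]; exact ⟨rfl, h'⟩
      have e2 : (∃ t ∈ S.δ p, f m = S.γ t ∧ (Up f (f m) σ ↔ Up f (S.γ t) (Up f t (¬ Up f p a))))
          ↔ ∃ t ∈ S.δ p, S.γ t = f m ∧ (σ ↔ Up f t (¬ Up f p a)) := by
        constructor <;> rintro ⟨t, ht, h, h'⟩
        · rw [← h, hup, hup] at h'; exact ⟨t, ht, h.symm, h'⟩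
        · refine ⟨t, ht, h.symm, ?_⟩
          rw [h, hup, hup]; exact h'
      have e3 : ∀ (D : Set S.Face) (c : Prop),
          (∃ t ∈ D, f m = t ∧ (Up f (f m) σ ↔ Up f t c)) ↔ f m ∈ D ∧ (σ ↔ c) := by
        intro D c
        constructor
        · rintro ⟨t, ht, rfl, h⟩
          rw [hup, hup] at h; exact ⟨ht, h⟩
        · rintro ⟨h, h'⟩
          exact ⟨_, h, rfl, by rw [hup, hup]; exact h'⟩
      have e4 : (∃ j : Fin (n + 1), j.1 = m ∧ f m = f j ∧ (Up f (f m) σ ↔ Up f (f j) False)) ↔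
          ¬ σ := by
        constructor
        · rintro ⟨j, rfl, -, h⟩
          rw [hup, hup] at h
          exact h.1
        · intro h
          refine ⟨⟨m, by omega⟩, rfl, rfl, ?_⟩
          rw [hup, hup]
          exact iff_of_false h not_false
      rw [e1, e2]
      simp only [e3, e4]
      simp only [hup, iff_true, true_and]
      rw [g1, g2]
      exact globularity_aux σ irr cases
    · have hup : S.dim s = m → ∀ b c, Up f s b ↔ Up f s c := fun h =>
        up_iff_of_ne (by rw [h]; exact hs)
      have e1 : (s = S.γ (S.γ p) ∧ (Up f s σ ↔ Up f (S.γ (S.γ p)) (Up f (S.γ p) (Up f p a)))) ↔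
          S.γ (S.γ p) = s := by
        constructor
        · exact fun h => h.1.symm
        · rintro rfl
          exact ⟨rfl, hup hdγγ _ _⟩
      have e2 : (∃ t ∈ S.δ p, s = S.γ t ∧ (Up f s σ ↔ Up f (S.γ t) (Up f t (¬ Up f p a)))) ↔
          ∃ t ∈ S.δ p, S.γ t = s := by
        constructor
        · rintro ⟨t, ht, h, -⟩; exact ⟨t, ht, h.symm⟩
        · rintro ⟨t, ht, rfl⟩; exact ⟨t, ht, rfl, hup (hdγ' t ht) _ _⟩
      have e3 : (∃ t ∈ S.δ p, ∃ r ∈ S.δ t,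
          s = r ∧ (Up f s σ ↔ Up f r (¬ Up f t (¬ Up f p a)))) ↔ ∃ t ∈ S.δ p, s ∈ S.δ t := by
        constructor
        · rintro ⟨t, ht, r, hr, rfl, -⟩; exact ⟨t, ht, hr⟩
        · rintro ⟨t, ht, h⟩; exact ⟨t, ht, s, h, rfl, hup (hdδ' t ht s h) _ _⟩
      have e4 : (∃ t ∈ S.δ (S.γ p), s = t ∧ (Up f s σ ↔ Up f t (¬ Up f (S.γ p) (Up f p a)))) ↔
          s ∈ S.δ (S.γ p) := by
        constructor
        · rintro ⟨t, ht, rfl, -⟩; exact ht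
        · intro h
          have := hS.dim_δ _ _ h
          exact ⟨s, h, rfl, hup (by omega) _ _⟩
      have e5 : ¬ ∃ j : Fin (n + 1), j.1 = m ∧ s = f j ∧ (Up f s σ ↔ Up f (f j) False) := by
        rintro ⟨j, rfl, h, -⟩; exact hs h
      rw [e1, e2, e3, e4]
      simp only [e5, hs, false_and, and_false, or_false]
      rw [g1, g2]
      simp only [not_exists, not_and, ne_eq, and_self]
  -- A prism of dimension `m` is an input of `γ p` exactly when it is an input of an input of `p`:
  -- of an up input `t`, or of `fl f m`.
  · have hUB : ((∃ t ∈ S.δ p, Up f t (¬ Up f p a)) ∨ Up f p a) ↔ Up f (S.γ p) (Up f p a) := by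
      rcases cases with ⟨hU, hB, -⟩ | ⟨-, hB, t, ht, hA, -⟩ | ⟨hU, hB, hA, -⟩
      · exact iff_of_true (.inr hU) hB
      · exact iff_of_true (.inl ⟨t, ht, (hA t ht).2 rfl⟩) hB
      · refine iff_of_false ?_ hB
        rintro (⟨t, ht, h⟩ | h)
        exacts [hA t ht h, hU h]
    simp only [fl_ne_pt, and_false, exists_false, or_false, false_and, not_false_eq_true, and_true,
      true_and, mem_δ_pt, mem_δ_fl, false_or, ← hUB, fl_eq_fl]
    constructor
    · rintro ⟨⟨t, ht, h⟩ | h, i, hi, rfl⟩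
      · exact .inl ⟨t, ht, h, j, by rw [hdδ t ht]; omega, rfl⟩
      · exact .inr ⟨h, ⟨m, by omega⟩, rfl, j, by simp only; omega, rfl⟩
    · rintro (⟨t, ht, h, i, hi, rfl⟩ | ⟨h, i, hi, i', hi', rfl⟩)
      · exact ⟨.inl ⟨t, ht, h⟩, j, by have := hdδ t ht; omega, rfl⟩
      · exact ⟨.inr h, j, by omega, rfl⟩

/-- The inputs of a prism, a lower lift and a smaller prism, are glued along the lower lift of `f m`
if `f m` is the codomain of `f (m + 1)`, and along the upper lift if it is an input. What remains is
the boundary of the upper lift of `f (m + 1)`. -/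
theorem globularity_fl (hf : S.IsFullFlag n f) (hS : S.IsPositiveOpetopicCardinal)
    (j : Fin (n + 1)) (hj : 2 ≤ j.1 + 1) (φ : (S.prism n f).Face) :
    (φ = pt n f (S.γ (f j)) (Up f (f j) True) ↔
      φ ∈ (S.prism n f).γ '' (S.prism n f).δ (fl f j) \
        ⋃ b ∈ (S.prism n f).δ (fl f j), (S.prism n f).δ b) ∧
    (φ ∈ (S.prism n f).δ (pt n f (f j) True) ↔
      φ ∈ (⋃ b ∈ (S.prism n f).δ (fl f j), (S.prism n f).δ b) \
        (S.prism n f).γ '' (S.prism n f).δ (fl f j)) := by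
  obtain ⟨m, hm⟩ : ∃ m, j.1 = m + 1 := ⟨j.1 - 1, by omega⟩
  have hn : m + 1 ≤ n := by omega
  have hx : S.dim (f (m + 1)) = m + 1 := hf.dim_eq _ hn
  have hv : f m ∈ S.boundary (f (m + 1)) := hf.mem_boundary m (by omega)
  have hupx : ∀ b, Up f (f (m + 1)) b ↔ b := hf.up_flag hS hn
  have hup : ∀ b, Up f (f m) b ↔ b := hf.up_flag hS (by omega)
  have hγ : ∀ φ, φ ∈ (S.prism n f).γ '' (S.prism n f).δ (fl f j) ↔
      φ = pt n f (S.γ (f (m + 1))) False ∨ φ = pt n f (f m) True := by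
    intro φ
    constructor
    · rintro ⟨ψ, hψ, rfl⟩
      rcases mem_δ_fl.1 hψ with rfl | ⟨i, hi, rfl⟩
      · left; simp only [γ_pt, hm, hupx]
      · obtain rfl : i.1 = m := by omega
        exact .inr rfl
    · rintro (rfl | rfl)
      · refine ⟨_, mem_δ_fl.2 (.inl rfl), ?_⟩
        simp only [γ_pt, hm, hupx]
      · exact ⟨_, mem_δ_fl.2 (.inr ⟨⟨m, by omega⟩, hm.symm, rfl⟩), rfl⟩
  have hδ : ∀ φ, φ ∈ (⋃ b ∈ (S.prism n f).δ (fl f j), (S.prism n f).δ b) ↔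
      φ ∈ (S.prism n f).δ (pt n f (f (m + 1)) False) ∨
        φ ∈ (S.prism n f).δ (fl f (⟨m, by omega⟩ : Fin (n + 1))) := by
    intro φ
    simp only [mem_iUnion₂, mem_δ_fl (j := j), hm]
    constructor
    · rintro ⟨ψ, rfl | ⟨i, hi, rfl⟩, h⟩
      · exact .inl h
      · right
        convert h
        omega
    · rintro (h | h)
      · exact ⟨_, .inl rfl, h⟩
      · exact ⟨_, .inr ⟨_, rfl, rfl⟩, h⟩
  rw [mem_sdiff, mem_sdiff, hγ, hδ]
  simp only [mem_δ_pt, mem_δ_fl, hm, hupx, false_and, or_false, true_and]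
  rcases face_cases φ with ⟨s, σ, hσ, rfl⟩ | ⟨i, rfl⟩
  · simp only [pt_eq_pt, pt_ne_fl, and_false, exists_false, or_false, not_false_eq_true, not_true]
    by_cases hs : s = f m
    · subst hs
      have e0 : ∀ c, (f m = S.γ (f (m + 1)) ∧ (Up f (f m) σ ↔ Up f (S.γ (f (m + 1))) c)) ↔
          f m = S.γ (f (m + 1)) ∧ (σ ↔ c) := by
        intro c
        constructor <;> rintro ⟨h, h'⟩
        · rw [← h, hup, hup] at h'; exact ⟨h, h'⟩
        · rw [← h, hup, hup]; exact ⟨rfl, h'⟩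
      have e3 : ∀ (c : Prop), (∃ t ∈ S.δ (f (m + 1)), f m = t ∧ (Up f (f m) σ ↔ Up f t c)) ↔
          f m ∈ S.δ (f (m + 1)) ∧ (σ ↔ c) := by
        intro c
        constructor
        · rintro ⟨t, ht, rfl, h⟩
          rw [hup, hup] at h; exact ⟨ht, h⟩
        · rintro ⟨h, h'⟩
          exact ⟨_, h, rfl, by rw [hup, hup]; exact h'⟩
      simp only [e0, e3]
      simp only [hup, iff_true, iff_false, true_and]
      have irr : f m = S.γ (f (m + 1)) → f m ∉ S.δ (f (m + 1)) :=
        fun h h' => hS.γ_notMem_δ (f (m + 1)) (h ▸ h')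
      have hv' := mem_boundary_iff.1 hv
      tauto
    · have hup' : S.dim s = m → ∀ b c, Up f s b ↔ Up f s c := fun h =>
        up_iff_of_ne (by rw [h]; exact hs)
      have e0 : ∀ c, (s = S.γ (f (m + 1)) ∧ (Up f s σ ↔ Up f (S.γ (f (m + 1))) c)) ↔
          s = S.γ (f (m + 1)) := by
        intro c
        refine ⟨fun h => h.1, ?_⟩
        rintro rfl
        have := hS.dim_γ (f (m + 1)) (by omega)
        exact ⟨rfl, hup' (by omega) _ _⟩
      have e3 : ∀ (c : Prop), (∃ t ∈ S.δ (f (m + 1)), s = t ∧ (Up f s σ ↔ Up f t c)) ↔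
          s ∈ S.δ (f (m + 1)) := by
        intro c
        constructor
        · rintro ⟨t, ht, rfl, h⟩; exact ht
        · intro h
          have := hS.dim_δ _ _ h
          exact ⟨_, h, rfl, hup' (by omega) _ _⟩
      simp only [e0, e3, hs, false_and, or_false]
      have irr : s = S.γ (f (m + 1)) → s ∉ S.δ (f (m + 1)) :=
        fun h h' => hS.γ_notMem_δ (f (m + 1)) (h ▸ h')
      tauto
  · simp only [fl_ne_pt, and_false, exists_false, or_false, false_or, false_and,
      not_false_eq_true, and_true, fl_eq_fl, hx, true_and]
    simp only [show ∀ a, (a + 2 = m + 1 ↔ a + 1 = m) by omega]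

theorem prism_globularity (hf : S.IsFullFlag n f) (hS : S.IsPositiveOpetopicCardinal) :
    (S.prism n f).Globularity := by
  intro φ hφ
  rcases face_cases φ with ⟨p, a, -, rfl⟩ | ⟨j, rfl⟩
  · exact ⟨Set.ext fun ψ => (hf.globularity_pt hS hφ a ψ).1,
      Set.ext fun ψ => (hf.globularity_pt hS hφ a ψ).2⟩
  · exact ⟨Set.ext fun ψ => (hf.globularity_fl hS j hφ ψ).1,
      Set.ext fun ψ => (hf.globularity_fl hS j hφ ψ).2⟩

end IsFullFlag

theorem IsPositiveOpetope.eq_of_notMem (hS : S.IsPositiveOpetope) {a b : S.Face}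
    (hab : S.dim a = S.dim b) (ha : ∀ c, a ∉ S.δ c) (hb : ∀ c, b ∉ S.δ c) : a = b := by
  have := hS.finite
  exact (Set.ncard_le_one (Set.toFinite _)).1 (hS.size_le_one (S.dim a)) a
    ⟨rfl, fun c _ => ha c⟩ b ⟨hab.symm, fun c _ => hb c⟩

namespace IsFullFlag

variable {n : ℕ} {f : ℕ → S.Face}

open prism

theorem prism_isPositiveHypergraph (hf : S.IsFullFlag n f) (hS : S.IsPositiveHypergraph) :
    (S.prism n f).IsPositiveHypergraph where
  finite := by
    have := hS.finite
    unfold prism Lifted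
    infer_instance
  dim_γ φ hφ := by
    rcases face_cases φ with ⟨p, a, -, rfl⟩ | ⟨j, rfl⟩
    · exact hS.dim_γ p hφ
    · rw [γ_fl, dim_pt, dim_fl, hf.dim_eq _ (by omega)]
  dim_δ φ ψ h := by
    rcases face_cases φ with ⟨p, a, -, rfl⟩ | ⟨j, rfl⟩
    · rcases mem_δ_pt.1 h with ⟨t, ht, rfl⟩ | ⟨-, j, hj, rfl⟩
      · exact hS.dim_δ p t ht
      · rw [dim_pt, dim_fl, ← hj]
    · rcases mem_δ_fl.1 h with rfl | ⟨i, hi, rfl⟩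
      · rw [dim_pt, dim_fl, hf.dim_eq _ (by omega)]
      · rw [dim_fl, dim_fl, hi]
  δ_total φ hφ := by
    rcases face_cases φ with ⟨p, a, -, rfl⟩ | ⟨j, rfl⟩
    · obtain ⟨t, ht⟩ := hS.δ_total p hφ
      exact ⟨_, mem_δ_pt.2 (.inl ⟨t, ht, rfl⟩)⟩
    · exact ⟨_, mem_δ_fl.2 (.inl rfl)⟩
  δ_one φ hφ := by
    rcases face_cases φ with ⟨p, a, -, rfl⟩ | ⟨j, rfl⟩
    · obtain ⟨t, ht⟩ := hS.δ_one p hφ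
      refine ⟨pt n f t (¬ Up f p a), Set.ext fun ψ => ?_⟩
      rw [dim_pt] at hφ
      rw [mem_δ_pt, ht, mem_singleton_iff]
      constructor
      · rintro (⟨t, rfl, rfl⟩ | ⟨-, j, hj, -⟩)
        · rfl
        · omega
      · rintro rfl
        exact .inl ⟨t, rfl, rfl⟩
    · refine ⟨pt n f (f j) False, Set.ext fun ψ => ?_⟩
      rw [dim_fl] at hφ
      rw [mem_δ_fl, mem_singleton_iff]
      constructor
      · rintro (rfl | ⟨i, hi, -⟩)
        · rfl
        · omega
      · exact .inl

/-- A lower lift of a flag face is an input of its prism. If the upper lift of `f l` is no input,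
every face with input `f l` lies strictly above the flag, which the next flag face makes impossible.
-/
theorem notMem_δ_of_pt (hf : S.IsFullFlag n f) (hS : S.IsPositiveOpetopicCardinal) {p : S.Face}
    {a : Prop} (h : ∀ ψ, pt n f p a ∉ (S.prism n f).δ ψ) :
    (∀ t, p ∉ S.δ t) ∧ pt n f p a = pt n f p True := by
  by_cases hp : p = f (S.dim p)
  · have hn := hf.dim_le p
    generalize S.dim p = l at hp hn
    subst hp
    have ha : a := by
      by_contra ha
      refine h (fl f ⟨l, by omega⟩) (mem_δ_fl.2 (.inl ?_))
      simp [ha]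
    refine ⟨fun t ht => ?_, by simp [ha]⟩
    have hd := hS.dim_δ _ _ ht
    have hn' := hf.dim_le t
    rw [hf.dim_eq l hn] at hd
    have key : ∀ t, f l ∈ S.δ t → Up f t False := by
      intro t ht
      by_contra hup
      refine h (pt n f t False) (mem_δ_pt.2 (.inl ⟨_, ht, ?_⟩))
      simp [ha, hup]
    rcases mem_boundary_iff.1 (hf.boundary_flag hd) with h1 | h1
    · have h2 := up_false.1 (key t ht)
      have h3 := hf.dim_eq _ hn'
      exact hS.disjoint_le (hS.lowerLT_of_le (by omega) (.inl h1.symm) ht) h2.le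
    · exact (hf.up_flag hS hn' False).1 (key _ h1)
  · refine ⟨fun t ht => ?_, by simp [up_iff_of_ne hp a True]⟩
    refine h (pt n f t True) (mem_δ_pt.2 (.inl ⟨_, ht, ?_⟩))
    simp only [pt_eq_pt, true_and]
    exact up_iff_of_ne hp _ _

theorem prism_isPositiveOpetope (hf : S.IsFullFlag n f) (hS : S.IsPositiveOpetope) :
    (S.prism n f).IsPositiveOpetope where
  toIsPositiveHypergraph := hf.prism_isPositiveHypergraph hS.toIsPositiveHypergraph
  nonempty := ⟨pt n f (f 0) True, hf.dim_eq 0 (Nat.zero_le n)⟩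
  globularity := hf.prism_globularity hS.toIsPositiveOpetopicCardinal
  strictness := hf.prism_strictness hS.toIsPositiveOpetopicCardinal
  disjointness := hf.prism_disjointness hS.toIsPositiveOpetopicCardinal
  pencilLinearity := hf.prism_pencilLinearity hS.toIsPositiveOpetopicCardinal
  size_le_one l := by
    have hP := hf.prism_isPositiveHypergraph hS.toIsPositiveHypergraph
    have := hP.finite
    refine (Set.ncard_le_one (Set.toFinite _)).2 ?_
    -- Only the top prism is no input, and no lift attains its dimension `n + 1`.
    have hlast : ∀ j : Fin (n + 1), (∀ ψ, fl f j ∉ (S.prism n f).δ ψ) → j.1 = n := by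
      intro j h
      by_contra hj
      exact h (fl f ⟨j.1 + 1, by omega⟩) (mem_δ_fl.2 (.inr ⟨j, rfl, rfl⟩))
    rintro φ ⟨hφ, hφ'⟩ ψ ⟨hψ, hψ'⟩
    replace hφ' : ∀ χ, φ ∉ (S.prism n f).δ χ := fun χ h =>
      hφ' χ (by have := hP.dim_δ _ _ h; omega) h
    replace hψ' : ∀ χ, ψ ∉ (S.prism n f).δ χ := fun χ h =>
      hψ' χ (by have := hP.dim_δ _ _ h; omega) h
    rcases face_cases φ with ⟨p, a, -, rfl⟩ | ⟨j, rfl⟩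
    · have hn := hf.dim_le p
      rcases face_cases ψ with ⟨q, b, -, rfl⟩ | ⟨i, rfl⟩
      · obtain ⟨h1, h2⟩ := hf.notMem_δ_of_pt hS.toIsPositiveOpetopicCardinal hφ'
        obtain ⟨h3, h4⟩ := hf.notMem_δ_of_pt hS.toIsPositiveOpetopicCardinal hψ'
        obtain rfl : p = q := hS.eq_of_notMem (hφ.trans hψ.symm) h1 h3
        rw [h2, h4]
      · have := hlast i hψ'
        simp only [dim_pt, dim_fl] at hφ hψ
        omega
    · have h1 := hlast j hφ'
      rcases face_cases ψ with ⟨q, b, -, rfl⟩ | ⟨i, rfl⟩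
      · have hn := hf.dim_le q
        simp only [dim_pt, dim_fl] at hφ hψ
        omega
      · have h2 := hlast i hψ'
        rw [fl_eq_fl]; omega

end IsFullFlag

/-! ### Generation by a top face, and transport along embeddings -/

/-- A positive opetope is generated by each of its faces of maximal dimension. -/
theorem IsPositiveOpetope.generated (hS : S.IsPositiveOpetope) {τ : S.Face}
    (hτ : ∀ a, S.dim a ≤ S.dim τ) (a : S.Face) : S.Generated τ a := by
  -- The downward induction carries a greatest face `g` along: then `γ g` is no input, so by the
  -- size condition it is the only face one dimension lower that is not reached through `δ`.
  have key : ∀ m l, l + m = S.dim τ → ∃ g, S.dim g = l ∧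
      ∀ c, S.dim c = l → S.UpperLE c g ∧ S.Generated τ c := by
    intro m
    induction m with
    | zero =>
      intro l hl
      have hmax : ∀ c, S.dim c = l → ∀ b, c ∉ S.δ b := by
        intro c hc b hb
        have h1 := hS.dim_δ _ _ hb
        have h2 := hτ b
        omega
      refine ⟨τ, by omega, fun c hc => ?_⟩
      obtain rfl : c = τ := hS.eq_of_notMem (by omega) (hmax c hc) (hmax τ (by omega))
      exact ⟨.refl _, .base⟩
    | succ m ih =>
      intro l hl
      obtain ⟨g, hg, h⟩ := ih (l + 1) (by omega)
      have hdg := hS.dim_γ g (by omega)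
      refine ⟨S.γ g, by omega, fun c hc => ?_⟩
      by_cases hex : ∃ b, c ∈ S.δ b
      · obtain ⟨b, hb⟩ := hex
        have hd := hS.dim_δ _ _ hb
        obtain ⟨h1, h2⟩ := h b (by omega)
        exact ⟨(hS.lt_γ hb).le.trans (hS.γ_mono (by omega) h1), h2.δ_mem hb⟩
      · push Not at hex
        obtain rfl : c = S.γ g := by
          refine hS.eq_of_notMem (by omega) hex fun b hb => ?_
          have hd := hS.dim_δ _ _ hb
          obtain ⟨h1, -⟩ := h b (by omega)
          exact hS.not_le_of_lt (hS.lt_γ hb) (hS.γ_mono (by omega) h1)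
        exact ⟨.refl _, (h g hg).2.γ_mem (by omega)⟩
  obtain ⟨g, -, h⟩ := key (S.dim τ - S.dim a) (S.dim a) (by have := hτ a; omega)
  exact (h a rfl).2

theorem transGen_iff_of_equiv {α β : Type*} {r : α → α → Prop} {s : β → β → Prop} (e : α ≃ β)
    (h : ∀ a b, s (e a) (e b) ↔ r a b) (a b : α) :
    Relation.TransGen s (e a) (e b) ↔ Relation.TransGen r a b := by
  constructor
  · intro hs
    generalize hb : e b = b' at hs
    induction hs generalizing b with
    | single hs => subst hb; exact .single ((h _ _).1 hs)
    | @tail c d _ hcd ih =>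
      subst hb
      refine .tail (ih (e.symm c) (e.apply_symm_apply c)) ((h _ _).1 ?_)
      rwa [e.apply_symm_apply]
  · intro hr
    induction hr with
    | single hr => exact .single ((h _ _).2 hr)
    | tail _ hcd ih => exact ih.tail ((h _ _).2 hcd)

/-- Being a positive opetope is invariant under isomorphisms. -/
theorem IsPositiveOpetope.of_equiv {T : HypergraphData.{u}} (hS : S.IsPositiveOpetope)
    (e : S.Face ≃ T.Face) (hdim : ∀ a, T.dim (e a) = S.dim a)
    (hγ : ∀ a, 0 < S.dim a → T.γ (e a) = e (S.γ a)) (hδ : ∀ a, T.δ (e a) = e '' S.δ a) :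
    T.IsPositiveOpetope := by
  have hmem : ∀ a b, e b ∈ T.δ (e a) ↔ b ∈ S.δ a := by
    intro a b; rw [hδ, e.injective.mem_set_image]
  have hU : ∀ a b, T.UpperLT (e a) (e b) ↔ S.UpperLT a b := by
    refine transGen_iff_of_equiv e fun a b => ?_
    refine e.surjective.exists.trans (exists_congr fun α => ?_)
    rw [hdim, hmem]
    refine and_congr_right fun h => and_congr_right fun _ => ?_
    rw [hγ α h, e.injective.eq_iff]
  have hL : ∀ a b, T.LowerLT (e a) (e b) ↔ S.LowerLT a b := by
    refine transGen_iff_of_equiv e fun a b => ?_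
    simp only [LowerStep, hdim]
    refine and_congr_right fun h => and_congr_right fun _ => ?_
    rw [hγ a h, hmem]
  have := hS.finite
  have hfin : Finite T.Face := Finite.of_equiv _ e
  refine ⟨⟨⟨hfin, ?_, ?_, ?_, ?_⟩, ?_, ?_, ?_, ?_, ?_⟩, ?_⟩
  · refine e.surjective.forall.2 fun a ha => ?_
    rw [hdim] at ha
    rw [hγ a ha, hdim, hdim, hS.dim_γ a ha]
  · refine e.surjective.forall.2 fun a => e.surjective.forall.2 fun b h => ?_
    rw [hdim, hdim, hS.dim_δ a b ((hmem a b).1 h)]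
  · refine e.surjective.forall.2 fun a ha => ?_
    rw [hdim] at ha
    rw [hδ]
    exact (hS.δ_total a ha).image e
  · refine e.surjective.forall.2 fun a ha => ?_
    rw [hdim] at ha
    obtain ⟨b, hb⟩ := hS.δ_one a ha
    exact ⟨e b, by rw [hδ, hb, image_singleton]⟩
  · obtain ⟨a, ha⟩ := hS.nonempty
    exact ⟨e a, (hdim a).trans ha⟩
  · refine e.surjective.forall.2 fun a ha => ?_
    rw [hdim] at ha
    obtain ⟨h1, h2⟩ := hS.globularity a ha
    have hda := hS.dim_γ a (by omega)
    have e1 : T.γ '' T.δ (e a) = e '' (S.γ '' S.δ a) := by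
      rw [hδ, image_image, image_image]
      refine image_congr fun b hb => hγ b ?_
      have := hS.dim_δ a b hb
      omega
    have e2 : (⋃ b ∈ T.δ (e a), T.δ b) = e '' ⋃ b ∈ S.δ a, S.δ b := by
      rw [hδ, biUnion_image, image_iUnion₂]
      simp only [hδ]
    rw [e1, e2, hγ a (by omega), hγ (S.γ a) (by omega), hδ, ← image_singleton,
      ← image_sdiff e.injective, ← image_sdiff e.injective, ← h1, ← h2]
    exact ⟨rfl, rfl⟩
  · refine ⟨e.surjective.forall.2 fun a => ?_, e.surjective.forall.2 fun a =>
      e.surjective.forall.2 fun b => ?_⟩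
    · rw [hU]
      exact hS.strictness.1 a
    · rw [hdim, hdim, hU, hU, e.injective.eq_iff]
      exact hS.strictness.2 a b
  · refine e.surjective.forall.2 fun a => e.surjective.forall.2 fun b => ?_
    rw [hdim, hdim, hU, hU, hL, hL]
    exact hS.disjointness a b
  · refine e.surjective.forall.2 fun x => e.surjective.forall.2 fun a =>
      e.surjective.forall.2 fun b => ?_
    rw [hdim, hdim, hdim, hU, hU, e.injective.eq_iff, hmem, hmem]
    intro ha hb
    rw [hγ a (by omega), hγ b (by omega), e.injective.eq_iff, e.injective.eq_iff]
    exact hS.pencilLinearity x a b ha hb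
  · intro l
    refine (Set.ncard_le_one (Set.toFinite _)).2 ?_
    refine e.surjective.forall.2 fun a ha => e.surjective.forall.2 fun b hb => ?_
    have hl : ∀ a, e a ∈ {a : T.Face | T.dim a = l ∧ ∀ b : T.Face, T.dim b = l + 1 → a ∉ T.δ b} →
        S.dim a = l ∧ ∀ c, a ∉ S.δ c := by
      rintro a ⟨h1, h2⟩
      rw [hdim] at h1
      refine ⟨h1, fun c hc => h2 (e c) ?_ ((hmem _ _).2 hc)⟩
      rw [hdim, ← hS.dim_δ c a hc, h1]
    rw [hS.eq_of_notMem ((hl a ha).1.trans (hl b hb).1.symm) (hl a ha).2 (hl b hb).2]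

theorem generatedBy_γ (T : HypergraphData.{u}) {x : T.Face} (a : (T.generatedBy x).Face)
    (h : 0 < T.dim a.1) : ((T.generatedBy x).γ a).1 = T.γ a.1 :=
  congrArg Subtype.val (dif_pos h)

/-- An injective map of hypergraphs whose domain is a positive opetope identifies it with the
sub-hypergraph generated by the image of a face of maximal dimension. -/
theorem IsPositiveOpetope.generatedBy {T : HypergraphData.{u}} (hS : S.IsPositiveOpetope)
    {Φ : S.Face → T.Face} (hΦ : Function.Injective Φ) (hdim : ∀ a, T.dim (Φ a) = S.dim a)
    (hγ : ∀ a, 0 < S.dim a → T.γ (Φ a) = Φ (S.γ a)) (hδ : ∀ a, T.δ (Φ a) = Φ '' S.δ a)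
    {τ : S.Face} (hτ : ∀ a, S.dim a ≤ S.dim τ) :
    (∀ b, T.Generated (Φ τ) b → b ∈ range Φ) ∧ (T.generatedBy (Φ τ)).IsPositiveOpetope := by
  have hsub : ∀ b, T.Generated (Φ τ) b → b ∈ range Φ := by
    intro b hb
    induction hb with
    | base => exact ⟨τ, rfl⟩
    | γ_mem _ hpos ih =>
      obtain ⟨a, rfl⟩ := ih
      rw [hdim] at hpos
      exact ⟨_, (hγ a hpos).symm⟩
    | δ_mem _ hb ih =>
      obtain ⟨a, rfl⟩ := ih
      rw [hδ] at hb
      exact image_subset_range _ _ hb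
  have hgen : ∀ a, T.Generated (Φ τ) (Φ a) := by
    intro a
    induction hS.generated hτ a with
    | base => exact .base
    | @γ_mem a _ hpos ih =>
      rw [← hγ a hpos]
      exact ih.γ_mem (by rwa [hdim])
    | @δ_mem a b _ hb ih => exact ih.δ_mem (by rw [hδ]; exact mem_image_of_mem _ hb)
  refine ⟨hsub, ?_⟩
  let e : S.Face ≃ (T.generatedBy (Φ τ)).Face :=
    Equiv.ofBijective (fun a => ⟨Φ a, hgen a⟩)
      ⟨fun a b h => hΦ (Subtype.ext_iff.1 h), fun b => by
        obtain ⟨a, ha⟩ := hsub b.1 b.2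
        exact ⟨a, Subtype.ext ha⟩⟩
  refine hS.of_equiv e hdim ?_ ?_
  · intro a ha
    have hpos : 0 < T.dim (Φ a) := by rwa [hdim]
    refine Subtype.ext ?_
    exact (T.generatedBy_γ (e a) hpos).trans (hγ a ha)
  · intro a
    ext b
    change b.1 ∈ T.δ (Φ a) ↔ _
    rw [hδ]
    constructor
    · rintro ⟨c, hc, h⟩
      exact ⟨c, hc, Subtype.ext h⟩
    · rintro ⟨c, hc, rfl⟩
      exact ⟨c, hc, rfl⟩

/-! ### Iterated codomains and their domains -/

theorem codTo_self (p : S.Face) : S.codTo (S.dim p) p = p := by simp [codTo]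

theorem γ_codTo {p : S.Face} {j : ℕ} (h : j < S.dim p) :
    S.γ (S.codTo (j + 1) p) = S.codTo j p := by
  unfold codTo
  rw [show S.dim p - j = (S.dim p - (j + 1)) + 1 by omega, Function.iterate_succ_apply']

namespace IsPositiveHypergraph

theorem codTo_γ (hS : S.IsPositiveHypergraph) {p : S.Face} {j : ℕ} (h : j < S.dim p) :
    S.codTo j (S.γ p) = S.codTo j p := by
  have hd := hS.dim_γ p (by omega)
  unfold codTo
  rw [show S.dim p - j = (S.dim (S.γ p) - j) + 1 by omega, Function.iterate_succ_apply]

theorem dim_codTo (hS : S.IsPositiveHypergraph) {p : S.Face} {j : ℕ} (h : j ≤ S.dim p) :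
    S.dim (S.codTo j p) = j := by
  induction h using Nat.decreasingInduction with
  | self => rw [codTo_self]
  | of_succ i hi ih =>
    have := hS.dim_γ (S.codTo (i + 1) p) (by omega)
    rw [γ_codTo hi] at this
    omega

theorem mem_domAt_iff {p t : S.Face} {j : ℕ} (h : j < S.dim p) :
    t ∈ S.domAt j p ↔ t ∈ S.δ (S.codTo (j + 1) p) := by
  have : S.dim p ≠ j := by omega
  simp [domAt, h, this]

theorem mem_domAt_dim {p t : S.Face} : t ∈ S.domAt (S.dim p) p ↔ t = p := by
  simp [domAt]

theorem mem_domAt_of_dim {p t : S.Face} {j : ℕ} (h : S.dim p = j) : t ∈ S.domAt j p ↔ t = p := by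
  subst h; exact mem_domAt_dim

theorem le_dim_of_mem_domAt {p t : S.Face} {j : ℕ} (h : t ∈ S.domAt j p) : j ≤ S.dim p := by
  rcases h with h | h
  exacts [h.1.ge, h.1.le]

theorem mem_domAt_pred {p t : S.Face} {j : ℕ} (h : j + 1 = S.dim p) :
    t ∈ S.domAt j p ↔ t ∈ S.δ p := by
  rw [mem_domAt_iff (by omega), h, codTo_self]

theorem domAt_γ (hS : S.IsPositiveHypergraph) {p t : S.Face} {j : ℕ} (h : j + 1 < S.dim p) :
    t ∈ S.domAt j (S.γ p) ↔ t ∈ S.domAt j p := by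
  have hd := hS.dim_γ p (by omega)
  rw [mem_domAt_iff (by omega), mem_domAt_iff (by omega), hS.codTo_γ h]

theorem dim_of_mem_domAt (hS : S.IsPositiveHypergraph) {p t : S.Face} {j : ℕ}
    (h : t ∈ S.domAt j p) : S.dim t = j := by
  rcases h with ⟨h, rfl⟩ | ⟨h, ht⟩
  · exact h
  · have := hS.dim_δ _ _ ht
    rw [hS.dim_codTo h] at this
    omega

theorem lt_codTo (hS : S.IsPositiveHypergraph) {p t : S.Face} {j : ℕ} (h : t ∈ S.domAt j p)
    (hj : j < S.dim p) : S.UpperLT t (S.codTo j p) := by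
  rw [← γ_codTo hj]
  exact hS.lt_γ ((mem_domAt_iff hj).1 h)

theorem domAt_nonempty (hS : S.IsPositiveHypergraph) {p : S.Face} {j : ℕ} (hj : j ≤ S.dim p) :
    ∃ t, t ∈ S.domAt j p := by
  rcases hj.lt_or_eq with h | h
  · obtain ⟨t, ht⟩ := hS.δ_total (S.codTo (j + 1) p) (by rw [hS.dim_codTo h]; omega)
    exact ⟨t, (mem_domAt_iff h).2 ht⟩
  · exact ⟨p, .inl ⟨h.symm, rfl⟩⟩

end IsPositiveHypergraph

namespace IsPositiveOpetopicCardinal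

open IsPositiveHypergraph

theorem codTo_mono (hS : S.IsPositiveOpetopicCardinal) {p q : S.Face} (h : S.UpperLE p q) {j : ℕ}
    (hj : j ≤ S.dim p) : S.UpperLE (S.codTo j p) (S.codTo j q) := by
  have hd := hS.dim_le h
  induction hj using Nat.decreasingInduction with
  | self =>
    rw [codTo_self, hd, codTo_self]
    exact h
  | of_succ i hi ih =>
    have hi' : i < S.dim q := hd ▸ hi
    rw [← γ_codTo hi, ← γ_codTo hi']
    exact hS.γ_mono (by rw [hS.dim_codTo hi]; omega) ih

theorem codTo_le_of_mem (hS : S.IsPositiveOpetopicCardinal) {p q : S.Face} (h : p ∈ S.δ q) {j : ℕ}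
    (hj : j ≤ S.dim p) : S.UpperLE (S.codTo j p) (S.codTo j q) := by
  have := hS.dim_δ q p h
  rw [← hS.codTo_γ (p := q) (by omega)]
  exact hS.codTo_mono (hS.lt_γ h).le hj

/-- Distinct inputs have no common lower bound; this makes the choice of `t` in `place` unambiguous.
-/
theorem domAt_unique (hS : S.IsPositiveOpetopicCardinal) {p t t' x : S.Face} {j : ℕ}
    (ht : t ∈ S.domAt j p) (ht' : t' ∈ S.domAt j p) (h : S.UpperLE x t) (h' : S.UpperLE x t') :
    t = t' := by
  rcases (le_dim_of_mem_domAt ht).lt_or_eq with hj | rfl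
  · rw [mem_domAt_iff hj] at ht ht'
    exact hS.eq_of_le_le ht ht' h h'
  · rw [mem_domAt_dim] at ht ht'
    rw [ht, ht']

/-- The domains of a face `p ∈ δ q` do not lie strictly below those of `q`. -/
theorem not_lt_domAt (hS : S.IsPositiveOpetopicCardinal) {p q t t' : S.Face} {i : ℕ}
    (hp : p ∈ S.δ q) (ht' : t' ∈ S.domAt i p) (ht : t ∈ S.domAt i q) : ¬ S.UpperLT t' t := by
  have hd := hS.dim_δ q p hp
  have hi := le_dim_of_mem_domAt ht'
  rw [mem_domAt_iff (by omega)] at ht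
  rcases hi.lt_or_eq with hi | rfl
  · rw [mem_domAt_iff hi] at ht'
    refine hS.not_lt_of_boundary ?_ (hS.codTo_le_of_mem hp hi) (δ_subset_boundary _ ht') ht
    rw [hS.dim_codTo hi]; omega
  · rw [mem_domAt_dim] at ht'
    rw [hd, codTo_self] at ht
    subst ht'
    exact hS.not_lt_of_mem_δ hp ht

/-- If `t` in the domain of `q` is comparable to a codomain of `p ∈ δ q`, then it lies below
the domain of `p`. -/
theorem exists_domAt_of_comparable (hS : S.IsPositiveOpetopicCardinal) {p q t : S.Face} {i : ℕ}
    (hp : p ∈ S.δ q) (hi : i ≤ S.dim p) (ht : t ∈ S.domAt i q)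
    (h : S.UpperLE (S.codTo i p) t ∨ S.UpperLT t (S.codTo i p)) :
    ∃ t' ∈ S.domAt i p, S.UpperLE t t' := by
  have hd := hS.dim_δ q p hp
  rcases hi.lt_or_eq with hi | rfl
  · rcases h with h | h
    · obtain ⟨r, hr⟩ := hS.domAt_nonempty hi.le
      exact (hS.not_lt_domAt hp hr ht ((hS.lt_codTo hr hi).trans_le h)).elim
    · rw [mem_domAt_iff (by omega)] at ht
      rw [← γ_codTo hi] at h
      have h1 := hS.dim_codTo (p := q) (j := i + 1) (by omega)
      have h2 := hS.dim_codTo (p := p) (j := i + 1) hi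
      rcases hS.le_δ_or_le (by omega) (δ_subset_boundary _ ht) (by omega) h with ⟨r, hr, h3⟩ | h3
      · exact ⟨r, (mem_domAt_iff hi).2 hr, h3⟩
      · have := hS.antisymm h3 (hS.codTo_le_of_mem hp hi)
        exact ⟨t, (mem_domAt_iff hi).2 (this ▸ ht), .refl _⟩
  · rw [codTo_self] at h
    rw [mem_domAt_iff (by omega), hd, codTo_self] at ht
    exact ⟨p, mem_domAt_dim.2 rfl, .inl (hS.eq_of_comparable hp ht h).symm⟩

end IsPositiveOpetopicCardinal

/-! ### Flags: first, last and low level -/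

/-- The faces `g 0, …, g m` form a flag under `g m`. -/
structure IsFlagSeq (S : HypergraphData.{u}) (m : ℕ) (g : ℕ → S.Face) : Prop where
  dim_eq : ∀ i ≤ m, S.dim (g i) = i
  mem_boundary : ∀ i < m, g i ∈ S.boundary (g (i + 1))

/-- The sequence `[g m, …, g 0]`. -/
def flagVec (g : ℕ → S.Face) (m : ℕ) : S.Vec := fun i => if i ≤ m then some (g i) else none

theorem flagVec_of_le {g : ℕ → S.Face} {m i : ℕ} (h : i ≤ m) : flagVec g m i = some (g i) :=
  if_pos h

theorem flagVec_of_lt {g : ℕ → S.Face} {m i : ℕ} (h : m < i) : flagVec g m i = none :=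
  if_neg (by omega)

theorem flagVec_ne_none {g : ℕ → S.Face} {m i : ℕ} : flagVec g m i ≠ none ↔ i ≤ m := by
  unfold flagVec; split_ifs with h <;> simp [h]

theorem IsFlagSeq.isFlag {m : ℕ} {g : ℕ → S.Face} (hg : S.IsFlagSeq m g) :
    S.IsFlag m (flagVec g m) where
  face i hi := ⟨g i, flagVec_of_le hi, hg.dim_eq i hi⟩
  above i hi := flagVec_of_lt hi
  mem_boundary i hi a ha b hb := by
    rw [flagVec_of_le hi.le, Option.mem_some] at ha
    rw [flagVec_of_le (by omega), Option.mem_some] at hb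
    subst ha hb
    exact hg.mem_boundary i hi

theorem IsFlag.exists_seq {m : ℕ} {y : S.Vec} (hy : S.IsFlag m y) :
    ∃ g, S.IsFlagSeq m g ∧ y = flagVec g m := by
  obtain ⟨a₀, -⟩ := hy.face 0 (by omega)
  have h : ∀ i ≤ m, y i = some ((y i).getD a₀) := by
    intro i hi
    obtain ⟨a, ha, -⟩ := hy.face i hi
    rw [Option.mem_def] at ha
    rw [ha]; rfl
  refine ⟨fun i => (y i).getD a₀, ⟨fun i hi => ?_, fun i hi => ?_⟩, funext fun i => ?_⟩
  · obtain ⟨a, ha, hd⟩ := hy.face i hi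
    rw [Option.mem_def] at ha
    simp only [ha, Option.getD_some, hd]
  · exact hy.mem_boundary i hi _ (h i hi.le) _ (h (i + 1) hi)
  · rcases le_or_gt i m with hi | hi
    · rw [flagVec_of_le hi, ← h i hi]
    · rw [flagVec_of_lt hi, hy.above i hi]

theorem IsFlagSeq.le_codTo {m : ℕ} {g : ℕ → S.Face} (hg : S.IsFlagSeq m g)
    (hS : S.IsPositiveOpetopicCardinal) {i : ℕ} (hi : i ≤ m) :
    S.UpperLE (g i) (S.codTo i (g m)) := by
  have hm := hg.dim_eq m le_rfl
  induction hi using Nat.decreasingInduction with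
  | self =>
    left
    conv_rhs => rw [← hm, hm]
    have := codTo_self (g m)
    rw [hm] at this
    exact this.symm
  | of_succ i hi ih =>
    rw [← γ_codTo (by omega)]
    exact (hS.le_γ (hg.mem_boundary i hi)).trans
      (hS.γ_mono (by rw [hg.dim_eq (i + 1) hi]; omega) ih)

theorem sgn_congr {x y : S.Vec} {k : ℕ} (h : ∀ i ≤ k, x i = y i) : S.sgn x k = S.sgn y k := by
  induction k with
  | zero => rfl
  | succ k ih =>
    simp only [sgn]
    rw [h k (by omega), h (k + 1) le_rfl, ih fun i hi => h i (by omega)]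

theorem PencilLT.asymm (hS : S.IsPositiveOpetopicCardinal) {c a b : S.Face}
    (h : S.PencilLT c a b) : ¬ S.PencilLT c b a := by
  have irr : ∀ a, S.γ a = c → c ∉ S.δ a := fun a h h' => hS.γ_notMem_δ a (h ▸ h')
  have asym : ∀ {a b}, S.UpperLT a b → ¬ S.UpperLT b a := fun h h' => hS.irrefl _ (h.trans h')
  rintro (h' | h' | h') <;> rcases h with h | h | h
  · exact irr a h'.1 h.2
  · exact irr a h'.1 h.1
  · exact irr b h.2.1 h'.2
  · exact irr b h.1 h'.1
  · exact asym h.2.2 h'.2.2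
  · exact irr b h.2.1 h'.1
  · exact irr a h'.2.1 h.2
  · exact irr a h'.2.1 h.1
  · exact asym h.2.2 h'.2.2

/-- Asymmetry leaves room for only one first and one last flag under a face in positive dimension;
an explicit last flag depends on the choice of an initial vertex, which this uniqueness settles as
well. -/
theorem FlagLT.asymm (hS : S.IsPositiveOpetopicCardinal) {x y : S.Vec} (h : S.FlagLT x y) :
    ¬ S.FlagLT y x := by
  rintro ⟨j', hj', b', hb', a', ha', -, h'⟩
  obtain ⟨j, hj, a, ha, b, hb, hne, h⟩ := h
  rw [Option.mem_def] at ha hb ha' hb'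
  obtain rfl : j = j' := by
    rcases lt_trichotomy j j' with hlt | rfl | hlt
    · have := hj' j hlt
      rw [ha, hb, Option.some.injEq] at this
      exact (hne this.symm).elim
    · rfl
    · have := hj j' hlt
      rw [ha', hb', Option.some.injEq] at this
      subst this
      rcases h' with ⟨-, h'⟩ | ⟨-, c, -, h'⟩
      · exact (hS.irrefl _ h').elim
      · rcases h' with h' | h' <;> exact (PencilLT.asymm hS h'.2 h'.2).elim
  rw [ha, Option.some.injEq] at ha'
  rw [hb, Option.some.injEq] at hb'
  subst ha' hb'
  rcases h with ⟨h0, h⟩ | ⟨h0, c, hc, h⟩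
  · rcases h' with ⟨-, h'⟩ | ⟨h0', -⟩
    · exact hS.irrefl _ (h.trans h')
    · omega
  · rcases h' with ⟨h0', -⟩ | ⟨-, c', hc', h'⟩
    · omega
    · rw [Option.mem_def] at hc hc'
      rw [hj _ (by omega), hc', Option.some.injEq] at hc
      subst hc
      have hs : S.sgn x (j - 1) = S.sgn y (j - 1) := sgn_congr fun i hi => hj i (by omega)
      rcases h with h | h <;> rcases h' with h' | h'
      · exact PencilLT.asymm hS h.2 h'.2
      · have := h.1; have := h'.1; omega
      · have := h.1; have := h'.1; omega
      · exact PencilLT.asymm hS h.2 h'.2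

theorem exists_least_ne {g h : ℕ → S.Face} {m : ℕ} (hne : flagVec h m ≠ flagVec g m) :
    ∃ j ≤ m, h j ≠ g j ∧ ∀ i < j, h i = g i := by
  have hex : ∃ j, j ≤ m ∧ h j ≠ g j := by
    by_contra hcon
    push Not at hcon
    refine hne (funext fun i => ?_)
    rcases le_or_gt i m with hi | hi
    · rw [flagVec_of_le hi, flagVec_of_le hi, hcon i hi]
    · rw [flagVec_of_lt hi, flagVec_of_lt hi]
  classical
  refine ⟨Nat.find hex, (Nat.find_spec hex).1, (Nat.find_spec hex).2, fun i hi => ?_⟩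
  have := Nat.find_min hex hi
  by_contra h'
  exact this ⟨hi.le.trans (Nat.find_spec hex).1, h'⟩

namespace IsFlagSeq

variable {m : ℕ} {g : ℕ → S.Face}

theorem sgn_succ_of_eq {k : ℕ} (hk : k + 1 ≤ m) (h : g k = S.γ (g (k + 1))) :
    S.sgn (flagVec g m) (k + 1) = S.sgn (flagVec g m) k := by
  refine if_pos ?_
  rw [flagVec_of_le hk, flagVec_of_le (by omega), h]
  rfl

theorem sgn_succ_of_ne {k : ℕ} (hk : k + 1 ≤ m) (h : g k ≠ S.γ (g (k + 1))) :
    S.sgn (flagVec g m) (k + 1) = - S.sgn (flagVec g m) k := by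
  refine if_neg ?_
  rw [flagVec_of_le hk, flagVec_of_le (by omega), Option.map_some, Option.some.injEq]
  exact h

theorem γ_eq_of_codTo (hg : S.IsFlagSeq m g) {i : ℕ} (hi : i < m)
    (h : g i = S.codTo i (g m)) (h' : g (i + 1) = S.codTo (i + 1) (g m)) :
    g i = S.γ (g (i + 1)) := by
  rw [h, h', γ_codTo]
  rw [hg.dim_eq m le_rfl]
  exact hi

/-- A flag that agrees with an iterated codomain in dimension `i` continues with `γ`. -/
theorem γ_eq (hg : S.IsFlagSeq m g) (hS : S.IsPositiveOpetopicCardinal) {i : ℕ} (hi : i < m)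
    (h : g i = S.codTo i (g m)) : S.γ (g (i + 1)) = g i := by
  rcases mem_boundary_iff.1 (hg.mem_boundary i hi) with h1 | h1
  · exact h1.symm
  · have h2 := hS.γ_mono (by rw [hg.dim_eq _ hi]; omega) (hg.le_codTo hS hi)
    rw [γ_codTo (by rw [hg.dim_eq m le_rfl]; exact hi), ← h] at h2
    exact (hS.not_le_of_lt (hS.lt_γ h1) h2).elim

/-- Along iterated codomains all signs are `+1`. Where another flag branches off, it has a
`<⁺`-smaller face with the same codomain, and this comes later in the pencil. -/
theorem isFirstFlag_of (hg : S.IsFlagSeq m g) (hS : S.IsPositiveOpetopicCardinal)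
    (h : ∀ i ≤ m, g i = S.codTo i (g m)) : S.IsFirstFlag m (flagVec g m) := by
  refine ⟨hg.isFlag, fun y hy htop hne => ?_⟩
  obtain ⟨k, hk, rfl⟩ := hy.exists_seq
  rw [flagVec_of_le le_rfl, flagVec_of_le le_rfl, Option.some.injEq] at htop
  obtain ⟨j, hj, hj1, hj2⟩ := exists_least_ne hne
  have hlt : S.UpperLT (k j) (g j) := by
    have := hk.le_codTo hS hj
    rw [htop, ← h j hj] at this
    exact this.lt_of_ne hj1
  refine ⟨j, fun i hi => ?_, g j, flagVec_of_le hj, k j, flagVec_of_le hj, hj1.symm, ?_⟩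
  · rw [flagVec_of_le (by omega), flagVec_of_le (by omega), hj2 i hi]
  · rcases j with _ | j
    · exact .inl ⟨rfl, hlt⟩
    · refine .inr ⟨by omega, g j, flagVec_of_le (by omega), .inl ⟨?_, .inr (.inr ⟨?_, ?_, hlt⟩)⟩⟩
      · have : ∀ i ≤ m, S.sgn (flagVec g m) i = 1 := by
          intro i hi
          induction i with
          | zero => rfl
          | succ i ih =>
            rw [sgn_succ_of_eq hi (hg.γ_eq_of_codTo hi (h i (by omega)) (h (i + 1) hi)),
              ih (by omega)]
        exact this _ (by omega)
      · exact (hg.γ_eq_of_codTo hj (h j (by omega)) (h (j + 1) hj)).symm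
      · have := hk.γ_eq hS hj (by rw [hj2 j (by omega), htop, ← h j (by omega)])
        rw [this, hj2 j (by omega)]

/-- The single switch at the bottom makes all later signs `-1`, which reverses the pencils, so that
the greatest faces now come last. Branching in dimensions 0 and 1 is separate, as the reversed sign
is not yet in force. -/
theorem isLastFlag_of (hg : S.IsFlagSeq m g) (hS : S.IsPositiveOpetopicCardinal) (hm : 1 ≤ m)
    (h : ∀ i, 1 ≤ i → i ≤ m → g i = S.codTo i (g m)) (h0 : g 0 ∈ S.δ (g 1)) :
    S.IsLastFlag m (flagVec g m) := by
  refine ⟨hg.isFlag, fun y hy htop hne => ?_⟩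
  obtain ⟨k, hk, rfl⟩ := hy.exists_seq
  rw [flagVec_of_le le_rfl, flagVec_of_le le_rfl, Option.some.injEq] at htop
  obtain ⟨j, hj, hj1, hj2⟩ := exists_least_ne hne
  have hle : ∀ i, 1 ≤ i → i ≤ m → S.UpperLE (k i) (g i) := fun i hi hi' => by
    have := hk.le_codTo hS hi'
    rwa [htop, ← h i hi hi'] at this
  have hk1 := hk.dim_eq 1 hm
  have hnlt : ∀ s ∈ S.boundary (k 1), ¬ S.UpperLT s (g 0) := fun s hs =>
    hS.not_lt_of_boundary (by omega) (hle 1 le_rfl hm) hs h0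
  refine ⟨j, fun i hi => ?_, k j, flagVec_of_le hj, g j, flagVec_of_le hj, hj1, ?_⟩
  · rw [flagVec_of_le (by omega), flagVec_of_le (by omega), hj2 i hi]
  rcases j with _ | _ | j
  · refine .inl ⟨rfl, ?_⟩
    rcases hS.strictness.2 (k 0) (g 0) (hk.dim_eq 0 (by omega)) (hg.dim_eq 0 (by omega)) with
      h1 | h1 | h1
    · exact (hnlt _ (hk.mem_boundary 0 hm) h1).elim
    · exact (hj1 h1).elim
    · exact h1
  · refine .inr ⟨by omega, k 0, flagVec_of_le (by omega), .inl ⟨rfl, .inr (.inl ⟨?_, ?_, ?_⟩)⟩⟩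
    · rcases mem_boundary_iff.1 (hk.mem_boundary 0 hm) with h1 | h1
      · obtain ⟨s, hs⟩ := hS.δ_total (k 1) (by omega)
        refine (hnlt s (δ_subset_boundary _ hs) ?_).elim
        rw [← hj2 0 (by omega), h1]
        exact hS.lt_γ hs
      · exact h1
    · rw [hj2 0 (by omega)]
      exact h0
    · exact (hle 1 le_rfl hm).lt_of_ne hj1
  · refine .inr ⟨by omega, k (j + 1), flagVec_of_le (by omega),
      .inr ⟨?_, .inr (.inr ⟨?_, ?_, ?_⟩)⟩⟩
    · have hs : ∀ i, i + 1 ≤ m → S.sgn (flagVec g m) (i + 1) = -1 := by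
        intro i hi
        induction i with
        | zero =>
          rw [sgn_succ_of_ne hi fun h1 => hS.γ_notMem_δ (g 1) (by rw [← h1]; exact h0)]
          rfl
        | succ i ih =>
          rw [sgn_succ_of_eq hi (hg.γ_eq_of_codTo hi (h _ (by omega) (by omega))
            (h _ (by omega) hi)), ih (by omega)]
      rw [← hs j (by omega)]
      refine sgn_congr fun i hi => ?_
      rw [flagVec_of_le (by omega), flagVec_of_le (by omega), hj2 i (by omega)]
    · rw [hj2 (j + 1) (by omega)]
      exact (hg.γ_eq_of_codTo hj (h _ (by omega) (by omega)) (h _ (by omega) hj)).symm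
    · refine hk.γ_eq hS hj ?_
      rw [hj2 (j + 1) (by omega), htop, ← h _ (by omega) (by omega)]
    · exact (hle _ (by omega) hj).lt_of_ne hj1

theorem isFirstFlag_iff (hg : S.IsFlagSeq m g) (hS : S.IsPositiveOpetopicCardinal) :
    S.IsFirstFlag m (flagVec g m) ↔ ∀ i ≤ m, g i = S.codTo i (g m) := by
  refine ⟨fun hfirst => ?_, hg.isFirstFlag_of hS⟩
  have hm := hg.dim_eq m le_rfl
  have hself : S.codTo m (g m) = g m := by
    have := codTo_self (g m)
    rwa [hm] at this
  let k : ℕ → S.Face := fun i => S.codTo i (g m)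
  have hk : S.IsFlagSeq m k := by
    refine ⟨fun i hi => hS.dim_codTo (by omega), fun i hi => mem_boundary_iff.2 (.inl ?_)⟩
    exact (γ_codTo (by omega)).symm
  have hkf := hk.isFirstFlag_of hS fun i _ => by simp only [k, hself]
  by_contra hcon
  push Not at hcon
  obtain ⟨i, hi, hne⟩ := hcon
  have hne' : flagVec k m ≠ flagVec g m := by
    intro h
    have := congrFun h i
    rw [flagVec_of_le hi, flagVec_of_le hi, Option.some.injEq] at this
    exact hne this.symm
  have htop : flagVec k m m = flagVec g m m := by
    rw [flagVec_of_le le_rfl, flagVec_of_le le_rfl, Option.some.injEq]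
    exact hself
  exact FlagLT.asymm hS (hfirst.2 _ hk.isFlag htop hne')
    (hkf.2 _ hg.isFlag htop.symm hne'.symm)

theorem isLastFlag_iff (hg : S.IsFlagSeq m g) (hS : S.IsPositiveOpetopicCardinal) (hm : 1 ≤ m) :
    S.IsLastFlag m (flagVec g m) ↔
      (∀ i, 1 ≤ i → i ≤ m → g i = S.codTo i (g m)) ∧ g 0 ∈ S.δ (g 1) := by
  refine ⟨fun hlast => ?_, fun h => hg.isLastFlag_of hS hm h.1 h.2⟩
  have hdm := hg.dim_eq m le_rfl
  have hself : S.codTo m (g m) = g m := by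
    have := codTo_self (g m)
    rwa [hdm] at this
  obtain ⟨s, hs⟩ := hS.domAt_nonempty (p := g m) (j := 0) (by omega)
  have hsd := hS.dim_of_mem_domAt hs
  rw [IsPositiveHypergraph.mem_domAt_iff (by omega)] at hs
  let k : ℕ → S.Face := fun i => if i = 0 then s else S.codTo i (g m)
  have k0 : k 0 = s := if_pos rfl
  have ks : ∀ i, k (i + 1) = S.codTo (i + 1) (g m) := fun i => if_neg (by omega)
  have km : k m = g m := by
    obtain ⟨i, rfl⟩ : ∃ i, m = i + 1 := ⟨m - 1, by omega⟩
    rw [ks, hself]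
  have hk : S.IsFlagSeq m k := by
    refine ⟨fun i hi => ?_, fun i hi => mem_boundary_iff.2 ?_⟩
    · rcases i with _ | i
      · rw [k0, hsd]
      · rw [ks]; exact hS.dim_codTo (by omega)
    · rcases i with _ | i
      · rw [k0, ks]; exact .inr hs
      · rw [ks, ks]; exact .inl (γ_codTo (by omega)).symm
  have hk1 : ∀ i, 1 ≤ i → i ≤ m → k i = S.codTo i (k m) := by
    intro i hi _
    obtain ⟨i, rfl⟩ : ∃ j, i = j + 1 := ⟨i - 1, by omega⟩
    rw [ks, km]
  have hk0 : k 0 ∈ S.δ (k 1) := by rw [k0, ks]; exact hs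
  have hkl := hk.isLastFlag_of hS hm hk1 hk0
  have htop : flagVec k m m = flagVec g m m := by
    rw [flagVec_of_le le_rfl, flagVec_of_le le_rfl, km]
  by_cases heq : flagVec k m = flagVec g m
  · have heq' : ∀ i ≤ m, k i = g i := fun i hi => by
      have := congrFun heq i
      rwa [flagVec_of_le hi, flagVec_of_le hi, Option.some.injEq] at this
    refine ⟨fun i hi hi' => ?_, ?_⟩
    · rw [← heq' i hi', hk1 i hi hi', km]
    · rw [← heq' 0 (by omega), ← heq' 1 hm]
      exact hk0
  · exact (FlagLT.asymm hS (hlast.2 _ hk.isFlag htop heq)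
      (hkl.2 _ hg.isFlag htop.symm (Ne.symm heq))).elim

/-- The flag `g` uses a proper domain for the last time in dimension `j + 1`. -/
theorem lowLevel_eq (hg : S.IsFlagSeq m g) (hS : S.IsPositiveOpetopicCardinal) {j : ℕ}
    (hj : j + 1 < m) (hδ : g (j + 1) ∈ S.δ (g (j + 2)))
    (h : ∀ i, j + 2 ≤ i → i ≤ m → g i = S.codTo i (g m)) :
    ¬ S.IsFirstFlag m (flagVec g m) ∧ ¬ S.IsLastFlag m (flagVec g m) ∧
      S.lowLevel m (flagVec g m) = j := by
  have hdm := hg.dim_eq m le_rfl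
  have hne : g (j + 1) ≠ S.codTo (j + 1) (g m) := by
    intro h1
    rw [← γ_codTo (by omega), ← h (j + 2) le_rfl (by omega)] at h1
    exact hS.γ_notMem_δ (g (j + 2)) (h1 ▸ hδ)
  refine ⟨fun h1 => hne ((hg.isFirstFlag_iff hS).1 h1 _ hj.le),
    fun h1 => hne (((hg.isLastFlag_iff hS (by omega)).1 h1).1 _ (by omega) hj.le), ?_⟩
  refine IsGreatest.csSup_eq ⟨⟨hj, _, flagVec_of_le hj.le, _, flagVec_of_le (by omega), hδ⟩, ?_⟩
  rintro i ⟨hi, a, ha, b, hb, hab⟩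
  rw [flagVec_of_le hi.le, Option.mem_some] at ha
  rw [flagVec_of_le (by omega), Option.mem_some] at hb
  subst ha hb
  by_contra hlt
  have h1 := h (i + 1) (by omega) (by omega)
  rw [← γ_codTo (by omega), ← h (i + 2) (by omega) (by omega)] at h1
  exact hS.γ_notMem_δ (g (i + 2)) (h1 ▸ hab)

/-- Either the flag `g` is the first or the last one, or it has a low level. -/
theorem trichotomy (hg : S.IsFlagSeq m g) (hm : 1 ≤ m) :
    ((∀ i, 1 ≤ i → i ≤ m → g i = S.codTo i (g m)) ∧ (g 0 = S.γ (g 1) ∨ g 0 ∈ S.δ (g 1))) ∨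
      ∃ j, j + 1 < m ∧ g (j + 1) ∈ S.δ (g (j + 2)) ∧
        ∀ i, j + 2 ≤ i → i ≤ m → g i = S.codTo i (g m) := by
  have hdm := hg.dim_eq m le_rfl
  have hself : S.codTo m (g m) = g m := by
    have := codTo_self (g m)
    rwa [hdm] at this
  have key : ∀ d k, k + d = m → 1 ≤ k → (∀ i, k ≤ i → i ≤ m → g i = S.codTo i (g m)) ∨
      ∃ j, j + 1 < m ∧ g (j + 1) ∈ S.δ (g (j + 2)) ∧
        ∀ i, j + 2 ≤ i → i ≤ m → g i = S.codTo i (g m) := by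
    intro d
    induction d with
    | zero =>
      intro k hk _
      left
      intro i h1 h2
      obtain rfl : i = m := by omega
      exact hself.symm
    | succ d ih =>
      intro k hk hk1
      rcases ih (k + 1) (by omega) (by omega) with h | h
      · obtain ⟨j, rfl⟩ : ∃ j, k = j + 1 := ⟨k - 1, by omega⟩
        rcases mem_boundary_iff.1 (hg.mem_boundary (j + 1) (by omega)) with h1 | h1
        · left
          intro i hi hi'
          rcases hi.lt_or_eq with hi | rfl
          · exact h i hi hi'
          · rw [h1, h _ le_rfl (by omega), γ_codTo (by omega)]
        · exact .inr ⟨j, by omega, h1, h⟩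
      · exact .inr h
  rcases key (m - 1) 1 (by omega) le_rfl with h | h
  · exact .inl ⟨h, mem_boundary_iff.1 (hg.mem_boundary 0 hm)⟩
  · exact .inr h

end IsFlagSeq

/-! ### The sequences `L_j(p, t)` and the star operation -/

section Lift

variable {p q t : S.Face} {l i : ℕ} {x y : S.Vec}

theorem lift_of_lt (h : i < l) : S.lift p l t x i = x i := if_pos h

theorem lift_gap : S.lift p l t x l = none := by simp [lift]

theorem lift_succ : S.lift p l t x (l + 1) = some t := by simp [lift]

theorem lift_of_le (h : l + 2 ≤ i) (h' : i ≤ S.dim p) :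
    S.lift p l t x i = some (S.codTo i p) := by
  unfold lift
  rw [if_neg (by omega), if_neg (by omega), if_neg (by omega), if_pos h']

theorem lift_above (h : S.dim p < i) (h' : l + 1 ≤ S.dim p) : S.lift p l t x i = none := by
  unfold lift
  rw [if_neg (by omega), if_neg (by omega), if_neg (by omega), if_neg (by omega)]

theorem lift_top (h : l + 1 ≤ S.dim p) (ht : l + 1 = S.dim p → t = p) :
    S.lift p l t x (S.dim p) = some p := by
  rcases h.lt_or_eq with h | h
  · rw [lift_of_le h le_rfl, codTo_self]
  · rw [← h, lift_succ, ht h]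

theorem lift_congr (h : ∀ i < l, x i = y i) : S.lift p l t x = S.lift p l t y := by
  funext i
  by_cases hi : i < l
  · rw [lift_of_lt hi, lift_of_lt hi, h i hi]
  · simp [lift, hi]

theorem lift_lift {s : S.Face} {m : ℕ} (h : m ≤ l) :
    S.lift q m s (S.lift p l t x) = S.lift q m s x :=
  lift_congr fun _ hi => lift_of_lt (by omega)

theorem gap_lift (h : ∀ i < l, x i ≠ none) : gap (S.lift p l t x) = l := by
  refine IsLeast.csInf_eq ⟨lift_gap, fun i hi => ?_⟩
  by_contra hlt
  change S.lift p l t x i = none at hi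
  rw [lift_of_lt (by omega)] at hi
  exact h i (by omega) hi

theorem topLevel_eq {m : ℕ} (h : x m ≠ none) (h' : ∀ i, m < i → x i = none) : topLevel x = m := by
  refine IsGreatest.csSup_eq ⟨h, fun i hi => ?_⟩
  by_contra hlt
  exact hi (h' i (by omega))

theorem topLevel_lift (h : l + 1 ≤ S.dim p) (ht : l + 1 = S.dim p → t = p) :
    topLevel (S.lift p l t x) = S.dim p :=
  topLevel_eq (by rw [lift_top h ht]; simp) fun _ hi => lift_above hi h

end Lift

/-- The cases in the definition of `p ⋆ z`. -/
theorem star_cases (p : S.Face) (z : S.Vec) :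
    (S.dim p ≠ gap z ∧ z (S.dim p) = some p ∧ S.star p z = .vec (truncate z (S.dim p))) ∨
    (¬ (S.dim p ≠ gap z ∧ z (S.dim p) = some p) ∧
      ((gap z < S.dim p ∧ ∃ t, S.Hits p z (gap z) t ∧ S.star p z = .vec (S.lift p (gap z) t z)) ∨
      (¬ (gap z < S.dim p ∧ ∃ t, S.Hits p z (gap z) t) ∧
        ((0 < gap z ∧ gap z ≤ S.dim p ∧ ∃ t ∈ S.domAt (gap z) p,
          (∃ a ∈ z (gap z + 1), S.UpperLE (S.γ a) t) ∧
            S.star p z = .vec (S.lift p (gap z - 1) t z)) ∨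
        (¬ (0 < gap z ∧ gap z ≤ S.dim p ∧ ∃ t ∈ S.domAt (gap z) p,
          ∃ a ∈ z (gap z + 1), S.UpperLE (S.γ a) t) ∧
          ((∃ r t, IsGreatest {r' | r' + 2 ≤ gap z ∧ r' < S.dim p ∧ ∃ t', S.Hits p z r' t'} r ∧
            S.Hits p z r t ∧ S.star p z = .vec (S.lift p r t z)) ∨
          ((∀ r t, r + 2 ≤ gap z → r < S.dim p → ¬ S.Hits p z r t) ∧
            ((((0 < gap z ∧ ∃ a ∈ z 0, S.UpperLE (S.codTo 0 p) a) ∨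
              (gap z = 0 ∧ ∃ a ∈ z 1, S.UpperLT (S.codTo 0 p) (S.γ a))) ∧
              S.star p z = .bot p) ∨
            (¬ ((0 < gap z ∧ ∃ a ∈ z 0, S.UpperLE (S.codTo 0 p) a) ∨
              (gap z = 0 ∧ ∃ a ∈ z 1, S.UpperLT (S.codTo 0 p) (S.γ a))) ∧
              S.star p z = .top p))))))))) := by
  by_cases h1 : S.dim p ≠ gap z ∧ z (S.dim p) = some p
  · exact .inl ⟨h1.1, h1.2, if_pos h1⟩
  refine .inr ⟨h1, ?_⟩
  by_cases h2 : gap z < S.dim p ∧ ∃ t, S.Hits p z (gap z) t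
  · refine .inl ⟨h2.1, h2.2.choose, h2.2.choose_spec, ?_⟩
    unfold star
    rw [if_neg h1, dif_pos h2]
  refine .inr ⟨h2, ?_⟩
  by_cases h3 : 0 < gap z ∧ gap z ≤ S.dim p ∧
      ∃ t ∈ S.domAt (gap z) p, ∃ a ∈ z (gap z + 1), S.UpperLE (S.γ a) t
  · refine .inl ⟨h3.1, h3.2.1, h3.2.2.choose, h3.2.2.choose_spec.1, h3.2.2.choose_spec.2, ?_⟩
    unfold star
    rw [if_neg h1, dif_neg h2, dif_pos h3]
  refine .inr ⟨h3, ?_⟩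
  by_cases h4 : ∃ q t, IsGreatest {q' | q' + 2 ≤ gap z ∧ q' < S.dim p ∧ ∃ t', S.Hits p z q' t'} q ∧
      S.Hits p z q t
  · refine .inl ⟨h4.choose, h4.choose_spec.choose, h4.choose_spec.choose_spec.1,
      h4.choose_spec.choose_spec.2, ?_⟩
    unfold star
    rw [if_neg h1, dif_neg h2, dif_neg h3, dif_pos h4]
  refine .inr ⟨?_, ?_⟩
  · intro r t hr hr' hrt
    -- The levels hit are bounded by the gap, so a nonempty set of them has a greatest element and
    -- the fourth case would have applied.
    let A := {q' | q' + 2 ≤ gap z ∧ q' < S.dim p ∧ ∃ t', S.Hits p z q' t'}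
    have hA : BddAbove A := ⟨gap z, fun i hi => by have := hi.1; omega⟩
    have hmem : sSup A ∈ A := Nat.sSup_mem ⟨r, hr, hr', t, hrt⟩ hA
    obtain ⟨t', ht'⟩ := hmem.2.2
    exact h4 ⟨sSup A, t', ⟨hmem, fun i hi => le_csSup hA hi⟩, ht'⟩
  · unfold star
    rw [if_neg h1, dif_neg h2, dif_neg h3, dif_neg h4]
    split_ifs with h5
    · exact .inl ⟨h5, rfl⟩
    · exact .inr ⟨h5, rfl⟩

/-! ### Placing the lifts in the cylinder -/

/-- `f (j + 1) ≤⁺ t ∈ δγ^{(j+2)}(p)`. -/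
def HitsAt (f : ℕ → S.Face) (p : S.Face) (j : ℕ) (t : S.Face) : Prop :=
  t ∈ S.domAt (j + 1) p ∧ S.UpperLE (f (j + 1)) t

open Classical in
/-- The face of the cylinder that corresponds to the lift of `p` to the prism over `f`; the
proposition `b` says whether the lift is above the prism. -/
noncomputable def place (n : ℕ) (f : ℕ → S.Face) (p : S.Face) (b : Prop) : S.CylFace :=
  if b then
    -- The gap sits directly below `p`, as in a high p-flag; a vertex has no room for a gap and
    -- becomes flat.
    if S.dim p = 0 then .top p else .vec (S.lift p (S.dim p - 1) p (flagVec f n))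
  else if h : ∃ j t, j + 1 < S.dim p ∧ HitsAt f p j t ∧
      ∀ j' t', j < j' → j' + 1 < S.dim p → ¬ HitsAt f p j' t' then
    .vec (S.lift p h.choose h.choose_spec.choose (flagVec f n))
  else if S.UpperLE (S.codTo 0 p) (f 0) then .bot p
  else .top p

section Place

variable {n : ℕ} {f : ℕ → S.Face} {p t : S.Face} {b : Prop} {j : ℕ}

theorem place_up (hb : b) (hj : S.dim p = j + 1) :
    place n f p b = .vec (S.lift p j p (flagVec f n)) := by
  unfold place
  rw [if_pos hb, if_neg (by omega), hj, Nat.add_sub_cancel]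

theorem place_up_zero (hb : b) (hj : S.dim p = 0) : place n f p b = .top p := by
  unfold place
  rw [if_pos hb, if_pos hj]

theorem place_of_hitsAt (hS : S.IsPositiveOpetopicCardinal) (hb : ¬ b) (hj : j + 1 < S.dim p)
    (ht : HitsAt f p j t) (hmax : ∀ j' t', j < j' → j' + 1 < S.dim p → ¬ HitsAt f p j' t') :
    place n f p b = .vec (S.lift p j t (flagVec f n)) := by
  have h : ∃ j t, j + 1 < S.dim p ∧ HitsAt f p j t ∧
      ∀ j' t', j < j' → j' + 1 < S.dim p → ¬ HitsAt f p j' t' := ⟨j, t, hj, ht, hmax⟩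
  have hs := h.choose_spec.choose_spec
  have e1 : h.choose = j := by
    rcases lt_trichotomy h.choose j with hlt | heq | hlt
    · exact (hs.2.2 _ _ hlt hj ht).elim
    · exact heq
    · exact (hmax _ _ hlt hs.1 hs.2.1).elim
  have e2 : h.choose_spec.choose = t :=
    hS.domAt_unique (e1 ▸ hs.2.1.1) ht.1 (e1 ▸ hs.2.1.2) ht.2
  unfold place
  rw [if_neg hb, dif_pos h, e2, e1]

open Classical in
theorem place_flat (hb : ¬ b) (h : ∀ j t, j + 1 < S.dim p → ¬ HitsAt f p j t) :
    place n f p b = if S.UpperLE (S.codTo 0 p) (f 0) then .bot p else .top p := by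
  unfold place
  rw [if_neg hb, dif_neg]
  rintro ⟨j, t, hj, ht, -⟩
  exact h j t hj ht

theorem place_bot (hb : ¬ b) (h : ∀ j t, j + 1 < S.dim p → ¬ HitsAt f p j t)
    (h0 : S.UpperLE (S.codTo 0 p) (f 0)) : place n f p b = .bot p := by
  rw [place_flat hb h, if_pos h0]

theorem place_top (hb : ¬ b) (h : ∀ j t, j + 1 < S.dim p → ¬ HitsAt f p j t)
    (h0 : ¬ S.UpperLE (S.codTo 0 p) (f 0)) : place n f p b = .top p := by
  rw [place_flat hb h, if_neg h0]

/-- The three kinds of faces that occur as `place n f p b`. -/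
theorem place_cases (hS : S.IsPositiveOpetopicCardinal) (n : ℕ) (f : ℕ → S.Face) (p : S.Face)
    (hb : ¬ b) :
    (∃ j t, j + 1 < S.dim p ∧ HitsAt f p j t ∧
      (∀ j' t', j < j' → j' + 1 < S.dim p → ¬ HitsAt f p j' t') ∧
      place n f p b = .vec (S.lift p j t (flagVec f n))) ∨
    ((∀ j t, j + 1 < S.dim p → ¬ HitsAt f p j t) ∧
      ((S.UpperLE (S.codTo 0 p) (f 0) ∧ place n f p b = .bot p) ∨
        (¬ S.UpperLE (S.codTo 0 p) (f 0) ∧ place n f p b = .top p))) := by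
  by_cases h : ∃ j, j + 1 < S.dim p ∧ ∃ t, HitsAt f p j t
  · left
    let A := {j | j + 1 < S.dim p ∧ ∃ t, HitsAt f p j t}
    have hA : BddAbove A := ⟨S.dim p, fun i hi => by have := hi.1; omega⟩
    have hmem : sSup A ∈ A := Nat.sSup_mem h hA
    obtain ⟨h1, t, h2⟩ := hmem
    have h3 : ∀ j' t', sSup A < j' → j' + 1 < S.dim p → ¬ HitsAt f p j' t' := fun j' t' hlt h h' =>
      (le_csSup hA (show j' ∈ A from ⟨h, t', h'⟩)).not_gt hlt
    exact ⟨sSup A, t, h1, h2, h3, place_of_hitsAt hS hb h1 h2 h3⟩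
  · right
    have h' : ∀ j t, j + 1 < S.dim p → ¬ HitsAt f p j t := fun j t h1 h2 => h ⟨j, h1, t, h2⟩
    refine ⟨h', ?_⟩
    by_cases h0 : S.UpperLE (S.codTo 0 p) (f 0)
    · exact .inl ⟨h0, place_bot hb h' h0⟩
    · exact .inr ⟨h0, place_top hb h' h0⟩

end Place

/-! ### The star operation on placed faces -/

namespace IsFullFlag

open IsPositiveHypergraph

variable {n : ℕ} {f : ℕ → S.Face}

theorem flagVec_ne (hf : S.IsFullFlag n f) {q : S.Face} {l : ℕ} (h : l ≤ S.dim q) :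
    ∀ i < l, flagVec f n i ≠ none := fun i hi => by
  have := hf.dim_le q
  exact flagVec_ne_none.2 (by omega)

theorem hits_lift (hf : S.IsFullFlag n f) {p q t t' : S.Face} {l j : ℕ} (hl : l ≤ S.dim q)
    (hj : j + 2 ≤ l) :
    S.Hits p (S.lift q l t (flagVec f n)) j t' ↔ HitsAt f p j t' := by
  have := hf.dim_le q
  unfold Hits HitsAt
  rw [lift_of_lt (by omega), flagVec_of_le (by omega)]
  simp

theorem hits_lift_gap {p q t t' : S.Face} {l : ℕ} :
    S.Hits p (S.lift q l t (flagVec f n)) l t' ↔ t' ∈ S.domAt (l + 1) p ∧ S.UpperLE t t' := by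
  unfold Hits
  rw [lift_succ]
  simp

theorem exists_domAt_or_le (hf : S.IsFullFlag n f) (hS : S.IsPositiveOpetopicCardinal) {q : S.Face}
    {i : ℕ} (hi : i + 1 ≤ S.dim q) (h : S.UpperLT (f i) (S.codTo i q)) :
    (∃ t ∈ S.domAt i q, S.UpperLE (f i) t) ∨ S.UpperLE (f (i + 1)) (S.codTo (i + 1) q) := by
  have hn := hf.dim_le q
  rw [← γ_codTo (by omega)] at h
  rcases hS.le_δ_or_le (x := f (i + 1)) (by rw [hf.dim_eq _ (by omega)]; omega)
    (hf.mem_boundary i (by omega)) (by rw [hS.dim_codTo hi]; omega) h with ⟨t, ht, h1⟩ | h1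
  · exact .inl ⟨t, (mem_domAt_iff hi).2 ht, h1⟩
  · exact .inr h1

/-- If the flag does not meet the domains of `q` from dimension `m + 1` on, then it meets
`γ^{(i)}(q)` at most by being equal to it. -/
theorem eq_codTo_of_le (hf : S.IsFullFlag n f) (hS : S.IsPositiveOpetopicCardinal) {q : S.Face}
    {m : ℕ} (hq : ¬ S.UpperLT (f (S.dim q)) q)
    (hm : ∀ j t, m ≤ j → j + 1 < S.dim q → ¬ HitsAt f q j t) {i : ℕ} (hi : m + 1 ≤ i)
    (hi' : i ≤ S.dim q) (h : S.UpperLE (f i) (S.codTo i q)) : f i = S.codTo i q := by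
  induction hi' using Nat.decreasingInduction with
  | self =>
    rw [codTo_self] at h ⊢
    exact h.resolve_right hq
  | of_succ i hi' ih =>
    rcases h with h | h
    · exact h
    have hn := hf.dim_le q
    obtain ⟨j, rfl⟩ : ∃ j, i = j + 1 := ⟨i - 1, by omega⟩
    have nohit : ∀ t ∈ S.domAt (j + 1) q, ¬ S.UpperLE (f (j + 1)) t := fun t ht ht' =>
      hm j t (by omega) hi' ⟨ht, ht'⟩
    rcases hf.exists_domAt_or_le hS hi' h with ⟨t, ht, h1⟩ | h1
    · exact (nohit t ht h1).elim
    · have h2 := ih (by omega) h1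
      rcases mem_boundary_iff.1 (hf.mem_boundary (j + 1) (by omega)) with h3 | h3
      · rw [h3, h2, γ_codTo hi']
      · exact (nohit _ ((mem_domAt_iff hi').2 (h2 ▸ h3)) (.refl _)).elim

/-- A hit of `p` would put `f (j + 1)` strictly below the iterated codomain of `q`, where
`eq_codTo_of_le` allows only equality. -/
theorem not_hitsAt_of_mem (hf : S.IsFullFlag n f) (hS : S.IsPositiveOpetopicCardinal)
    {q p : S.Face} {m : ℕ} (hq : ¬ S.UpperLT (f (S.dim q)) q)
    (hm : ∀ j t, m ≤ j → j + 1 < S.dim q → ¬ HitsAt f q j t) (hp : p ∈ S.δ q) {j : ℕ} {t : S.Face}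
    (hj : m ≤ j) (hjp : j + 1 < S.dim p) : ¬ HitsAt f p j t := by
  rintro ⟨ht, hft⟩
  have hd := hS.dim_δ q p hp
  have h1 := hft.trans_lt ((hS.lt_codTo ht hjp).trans_le (hS.codTo_le_of_mem hp hjp.le))
  have h2 := hf.eq_codTo_of_le hS hq hm (by omega) (by omega) h1.le
  exact hS.irrefl _ (h2 ▸ h1)

/-- Composition with an input of a low p-flag. -/
theorem star_low_δ (hf : S.IsFullFlag n f) (hS : S.IsPositiveOpetopicCardinal) {q p t : S.Face}
    {l : ℕ} (hq : ¬ S.UpperLT (f (S.dim q)) q) (hl : l + 1 < S.dim q) (ht : HitsAt f q l t)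
    (hmax : ∀ j' t', l < j' → j' + 1 < S.dim q → ¬ HitsAt f q j' t') (hp : p ∈ S.δ q) :
    S.star p (S.lift q l t (flagVec f n)) = place n f p (Up f p True) := by
  have hd := hS.dim_δ q p hp
  have hn := hf.dim_le q
  have hgap : gap (S.lift q l t (flagVec f n)) = l := gap_lift (hf.flagVec_ne (q := q) (by omega))
  have htδ : l + 1 = S.dim p → t ∈ S.δ q := fun h => (mem_domAt_pred (by omega)).1 ht.1
  have hmem : ∀ i < S.dim q, f i ∈ S.boundary (f (i + 1)) := fun i hi =>
    hf.mem_boundary i (by omega)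
  -- the top entry of `z` below `q` is not `p`, unless `p = t`
  have hup : ¬ (l + 1 = S.dim p ∧ t = p) → ¬ Up f p True := by
    intro hne hup
    rw [up_true] at hup
    by_cases hlp : l + 1 = S.dim p
    · refine hne ⟨hlp, hS.eq_of_le_le (htδ hlp) hp ht.2 ?_⟩
      rwa [hlp]
    · have h1 : S.UpperLT (f (S.dim p)) (S.codTo (S.dim p) q) := by
        refine hup.trans_lt ?_
        rw [← γ_codTo (by omega), hd, codTo_self]
        exact hS.lt_γ hp
      have h2 := hf.eq_codTo_of_le hS (m := l + 1) hq (fun j' t' h => hmax j' t' (by omega))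
        (by omega) (by omega) h1.le
      exact hS.irrefl _ (h2 ▸ h1)
  rcases S.star_cases p (S.lift q l t (flagVec f n)) with ⟨-, h1, h⟩ | ⟨h1, h⟩
  · -- `p` occurs in `z`
    have hlp : l + 1 = S.dim p ∧ t = p := by
      by_contra hcon
      rcases lt_or_eq_of_le (show l + 1 ≤ S.dim p by omega) with h2 | h2
      · rw [lift_of_le h2 (by omega), Option.some.injEq, ← γ_codTo (by omega), hd,
          codTo_self] at h1
        exact hS.irrefl _ (h1 ▸ hS.lt_γ hp)
      · rw [← h2, lift_succ, Option.some.injEq] at h1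
        exact hcon ⟨h2, h1⟩
    obtain ⟨hlp, rfl⟩ := hlp
    rw [h, place_up (up_true.2 (hlp ▸ ht.2)) hlp.symm]
    congr 1
    funext i
    unfold truncate
    rw [← hlp]
    rcases lt_trichotomy i l with hi | rfl | hi
    · rw [if_pos (by omega), lift_of_lt hi, lift_of_lt hi]
    · rw [if_pos (by omega), lift_gap, lift_gap]
    · rcases eq_or_lt_of_le (Nat.succ_le_of_lt hi) with rfl | hi
      · rw [if_pos (by omega), lift_succ, lift_succ]
      · rw [if_neg (by omega), lift_above (by omega) hlp.le]
  have hnt : ¬ (l + 1 = S.dim p ∧ t = p) := by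
    rintro ⟨h2, rfl⟩
    refine h1 ⟨by rw [hgap]; omega, ?_⟩
    rw [← h2, lift_succ]
  replace hup := hup hnt
  have hhigh : ∀ j' t', l < j' → j' + 1 < S.dim p → ¬ HitsAt f p j' t' := fun j' t' h1 h2 =>
    hf.not_hitsAt_of_mem hS hq (m := l + 1) (fun j' t' h => hmax j' t' (by omega)) hp h1 h2
  rw [hgap] at h
  rcases h with ⟨h2, t', h3, h⟩ | ⟨h2, h⟩
  · -- `t` lies below a domain of `p`
    rw [hits_lift_gap] at h3
    have hlp : l + 1 < S.dim p := by
      refine lt_of_le_of_ne h2 fun hlp => hnt ⟨hlp, ?_⟩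
      rw [hlp, mem_domAt_dim] at h3
      exact hS.eq_of_le_of_mem_δ (htδ hlp) hp (h3.1 ▸ h3.2)
    rw [h, lift_lift le_rfl,
      place_of_hitsAt hS hup hlp ⟨h3.1, ht.2.trans h3.2⟩ hhigh]
  have hno : ∀ t' ∈ S.domAt (l + 1) p, ¬ S.UpperLE t t' := fun t' h3 h4 =>
    h2 ⟨by omega, t', hits_lift_gap.2 ⟨h3, h4⟩⟩
  have hcomp : ¬ (S.UpperLE (S.codTo (l + 1) p) t ∨ S.UpperLT t (S.codTo (l + 1) p)) := by
    intro h3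
    obtain ⟨t', h4, h5⟩ := hS.exists_domAt_of_comparable hp (by omega) ht.1 h3
    exact hno t' h4 h5
  -- A hit at level `l` would be comparable to `t`, since both lie above `f (l + 1)`, and both
  -- directions are excluded.
  have hnoL : ∀ j' t', l ≤ j' → j' + 1 < S.dim p → ¬ HitsAt f p j' t' := by
    rintro j' t' h3 h4 h5
    rcases h3.eq_or_lt with rfl | h3
    · rcases hS.linear_above ht.2 h5.2 with h6 | h6
      · exact hno t' h5.1 h6
      · exact hS.not_lt_domAt hp h5.1 ht.1 h6
    · exact hhigh j' t' h3 h4 h5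
  have hdt := hS.dim_of_mem_domAt ht.1
  have hdw := hS.dim_codTo (p := p) (j := l + 1) (by omega)
  have hfl : S.UpperLE (f l) (S.γ t) :=
    (hS.le_γ (hmem l (by omega))).trans (hS.γ_mono (by rw [hf.dim_eq _ (by omega)]; omega) ht.2)
  have hbd : ∀ r ∈ S.δ t, ¬ S.UpperLT (f l) r := fun r hr =>
    hS.not_lt_of_boundary (by rw [hf.dim_eq _ (by omega)]; omega) ht.2 (hmem l (by omega)) hr
  rcases h with ⟨h3, -, s, hs, h4, h⟩ | ⟨h3, h⟩
  · -- `γ t` lies below a domain of `p`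
    obtain ⟨l, rfl⟩ : ∃ m, l = m + 1 := ⟨l - 1, by omega⟩
    rw [lift_succ] at h4
    obtain ⟨a, ha, h4⟩ := h4
    rw [Option.mem_some] at ha
    subst ha
    rw [h, Nat.add_sub_cancel, lift_lift (by omega), place_of_hitsAt hS hup (by omega)
      ⟨hs, hfl.trans h4⟩ fun j' t' hj' hj'' => hnoL j' t' hj' hj'']
  -- Level `l - 1` is excluded too. Such an `s` is comparable to `γ t`: above it, the third clause
  -- of the star operation would have applied; below it, `γ^{(l+1)}(p)` would be comparable to `t`,
  -- against `hcomp`.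
  have hM : 0 < l → ∀ s ∈ S.domAt l p, ¬ S.UpperLE (f l) s := by
    intro hl0 s hs hfs
    rcases hS.linear_above hfl hfs with h4 | h4
    · exact h3 ⟨hl0, by omega, s, hs, t, lift_succ, h4⟩
    · have hsw := (mem_domAt_iff (by omega)).1 hs
      rcases hS.le_δ_or_le (by omega) (δ_subset_boundary _ hsw) (by omega) h4 with
        ⟨r, hr, h5⟩ | h5
      · have h6 : f l = r := (hfs.trans h5).resolve_right (hbd r hr)
        have h7 : s = r := hS.antisymm h5 (h6 ▸ hfs)
        exact hcomp (hS.pencil_δ (h7 ▸ hsw) hr)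
      · exact hcomp (.inl h5)
  have hM' : ∀ j' t', l ≤ j' + 1 → j' + 1 < S.dim p → ¬ HitsAt f p j' t' := by
    intro j' t' h4 h5 h6
    rcases h4.lt_or_eq with h4 | rfl
    · exact hnoL j' t' (by omega) h5 h6
    · exact hM (by omega) t' h6.1 h6.2
  rcases h with ⟨r, s, h4, h5, h⟩ | ⟨h4, h⟩
  · have h6 := h4.1.1
    rw [hf.hits_lift (q := q) (by omega) h6] at h5
    rw [h, lift_lift (by omega), place_of_hitsAt hS hup (by omega) h5]
    intro j' t' h7 h8 h9
    rcases le_or_gt l (j' + 1) with h10 | h10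
    · exact hM' j' t' h10 h8 h9
    · have : j' ≤ r := h4.2 ⟨h10, by omega, t', (hf.hits_lift (q := q) (by omega) h10).2 h9⟩
      omega
  have hnone : ∀ j t, j + 1 < S.dim p → ¬ HitsAt f p j t := by
    intro j' t' h8 h9
    rcases le_or_gt l (j' + 1) with h10 | h10
    · exact hM' j' t' h10 h8 h9
    · exact h4 j' t' h10 (by omega) ((hf.hits_lift (q := q) (by omega) h10).2 h9)
  -- For `l > 0` the vertex `f 0` is still an entry. For `l = 0` it has been removed, and the
  -- comparison with `γ t` has to be translated into one with `f 0`.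
  have hsign : ((0 < l ∧ ∃ a ∈ S.lift q l t (flagVec f n) 0, S.UpperLE (S.codTo 0 p) a) ∨
      (l = 0 ∧ ∃ a ∈ S.lift q l t (flagVec f n) 1, S.UpperLT (S.codTo 0 p) (S.γ a))) ↔
      S.UpperLE (S.codTo 0 p) (f 0) := by
    rcases Nat.eq_zero_or_pos l with rfl | hl0
    · simp only [lift_succ, lt_irrefl, false_and, false_or, true_and, Option.mem_some,
        exists_eq_left']
      have hw : S.codTo 0 p = S.γ (S.codTo 1 p) := (γ_codTo (by omega)).symm
      have hz : S.dim (S.γ (S.codTo 1 p)) = 0 := hw ▸ hS.dim_codTo (by omega)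
      constructor
      · intro h5
        rw [hw] at h5 ⊢
        have hd1 : 0 < S.dim (S.codTo 1 p) := by rw [hS.dim_codTo (by omega)]; exact one_pos
        rcases hS.le_δ_or_le hd1 (γ_mem_boundary _) (by omega) h5 with ⟨r, hr, h6⟩ | h6
        · have hdr := hS.dim_δ t r hr
          rcases hS.strictness.2 (S.γ (S.codTo 1 p)) (f 0) hz (hf.dim_eq 0 (by omega)) with h7 | h7 | h7
          · exact h7.le
          · exact .inl h7
          · exact (hbd r hr (h7.trans_le h6)).elim
        · exact (hcomp (.inl h6)).elim
      · intro h5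
        refine (h5.trans hfl).lt_of_ne fun h6 => hcomp ?_
        rw [hw] at h6
        exact hS.pencil_γ (by omega) (by omega) h6
    · rw [lift_of_lt hl0, flagVec_of_le (by omega)]
      simp [hl0, hl0.ne']
  rw [hsign] at h
  rcases h with ⟨h5, h⟩ | ⟨h5, h⟩
  · rw [h, place_bot hup hnone h5]
  · rw [h, place_top hup hnone h5]

/-- Composition with the output of a low p-flag. -/
theorem star_low_γ (hf : S.IsFullFlag n f) (hS : S.IsPositiveOpetopicCardinal) {q t : S.Face}
    {l : ℕ} (hq : ¬ S.UpperLT (f (S.dim q)) q) (hl : l + 1 < S.dim q) (ht : HitsAt f q l t)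
    (hmax : ∀ j' t', l < j' → j' + 1 < S.dim q → ¬ HitsAt f q j' t') :
    S.star (S.γ q) (S.lift q l t (flagVec f n)) = place n f (S.γ q) (Up f (S.γ q) False) := by
  have hd := hS.dim_γ q (by omega)
  have hn := hf.dim_le q
  have hgap : gap (S.lift q l t (flagVec f n)) = l := gap_lift (hf.flagVec_ne (q := q) (by omega))
  have hcod : S.codTo (S.dim (S.γ q)) q = S.γ q := by
    rw [← hS.codTo_γ (by omega), codTo_self]
  rcases S.star_cases (S.γ q) (S.lift q l t (flagVec f n)) with ⟨-, h1, h⟩ | ⟨h1, h⟩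
  · have hlp : l + 1 < S.dim (S.γ q) := by
      refine lt_of_le_of_ne (by omega) fun h2 => ?_
      rw [← h2, lift_succ, Option.some.injEq] at h1
      have h3 := (mem_domAt_pred (by omega)).1 ht.1
      exact hS.irrefl _ (h1 ▸ hS.lt_γ h3)
    have hup : ¬ Up f (S.γ q) False := by
      rw [up_false]
      intro h2
      have h3 := hf.eq_codTo_of_le hS (m := l + 1) hq (fun j' t' h => hmax j' t' (by omega))
        hlp (by omega) (hcod.symm ▸ h2.le)
      rw [hcod] at h3
      rw [← h3] at h2
      rw [hf.dim_eq _ (by omega)] at h2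
      exact hS.irrefl _ h2
    rw [h, place_of_hitsAt hS hup hlp ⟨(hS.domAt_γ (by omega)).2 ht.1, ht.2⟩
      fun j' t' h2 h3 h4 => hmax j' t' h2 (by omega) ⟨(hS.domAt_γ (by omega)).1 h4.1, h4.2⟩]
    congr 1
    funext i
    unfold truncate
    split_ifs with hi
    · unfold lift
      split_ifs
      · rfl
      · rfl
      · rfl
      · rw [hS.codTo_γ (by omega)]
      · omega
    · rw [lift_above (by omega) hlp.le]
  -- `γ q` can fail to occur only because the place right above the gap is taken by `t`; then it is
  -- up, and the result is a high p-flag, or `+γ q` excluded by its positive dimension.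
  · have hlp : S.dim (S.γ q) = l + 1 := by
      by_contra h2
      refine h1 ⟨by omega, ?_⟩
      rw [lift_of_le (by omega) (by omega), hcod]
    have h3 := (mem_domAt_pred (by omega)).1 ht.1
    have hup : Up f (S.γ q) False := by
      rw [up_false, hlp]
      exact ht.2.trans_lt (hS.lt_γ h3)
    rw [hgap] at h
    rcases h with ⟨h2, t', h4, h⟩ | ⟨h2, h⟩
    · rw [hits_lift_gap, mem_domAt_of_dim hlp] at h4
      rw [h, lift_lift le_rfl, h4.1, place_up hup hlp]
    · exact (h2 ⟨by omega, S.γ q, hits_lift_gap.2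
        ⟨(mem_domAt_of_dim hlp).2 rfl, (hS.lt_γ h3).le⟩⟩).elim

/-- Composition with an input of a high p-flag. -/
theorem star_up_δ (hf : S.IsFullFlag n f) (hS : S.IsPositiveOpetopicCardinal) {q p : S.Face}
    {l : ℕ} (hq : S.UpperLE (f (S.dim q)) q) (hl : S.dim q = l + 1) (hp : p ∈ S.δ q) :
    S.star p (S.lift q l q (flagVec f n)) = place n f p (Up f p False) := by
  have hd := hS.dim_δ q p hp
  have hn := hf.dim_le q
  have hgap : gap (S.lift q l q (flagVec f n)) = l := gap_lift (hf.flagVec_ne (q := q) (by omega))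
  have hdp : S.dim p = l := by omega
  have hnlt : ¬ S.UpperLT (f l) p :=
    hS.not_lt_of_boundary (by rw [hf.dim_eq _ hn]; omega) hq (hf.boundary_flag hl.symm) hp
  have hup : ¬ Up f p False := by rw [up_false, hdp]; exact hnlt
  rcases S.star_cases p (S.lift q l q (flagVec f n)) with ⟨h1, -, h⟩ | ⟨-, h⟩
  · omega
  rw [hgap] at h
  rcases h with ⟨h2, -⟩ | ⟨-, h⟩
  · omega
  rcases h with ⟨-, -, s, hs, ⟨a, ha, h4⟩, -⟩ | ⟨-, h⟩
  · rw [lift_succ, Option.mem_some] at ha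
    subst ha
    rw [mem_domAt_of_dim hdp] at hs
    subst hs
    exact (hS.not_le_of_lt (hS.lt_γ hp) h4).elim
  rcases h with ⟨r, s, h4, h5, h⟩ | ⟨h4, h⟩
  · have h6 := h4.1.1
    rw [hf.hits_lift (q := q) (by omega) h6] at h5
    rw [h, lift_lift (by omega), place_of_hitsAt hS hup (by omega) h5]
    intro j' t' h7 h8 h9
    have : j' ≤ r := h4.2 ⟨by omega, by omega, t', (hf.hits_lift (q := q) (by omega) (by omega)).2 h9⟩
    omega
  have hnone : ∀ j t, j + 1 < S.dim p → ¬ HitsAt f p j t := fun j' t' h8 h9 =>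
    h4 j' t' (by omega) (by omega) ((hf.hits_lift (q := q) (by omega) (by omega)).2 h9)
  have hsign : ((0 < l ∧ ∃ a ∈ S.lift q l q (flagVec f n) 0, S.UpperLE (S.codTo 0 p) a) ∨
      (l = 0 ∧ ∃ a ∈ S.lift q l q (flagVec f n) 1, S.UpperLT (S.codTo 0 p) (S.γ a))) ↔
      S.UpperLE (S.codTo 0 p) (f 0) := by
    rcases Nat.eq_zero_or_pos l with rfl | hl0
    · simp only [lift_succ, lt_irrefl, false_and, false_or, true_and, Option.mem_some,
        exists_eq_left']
      have hw : S.codTo 0 p = p := by rw [← hdp, codTo_self]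
      rw [hw]
      refine iff_of_true (hS.lt_γ hp) ?_
      rcases hS.strictness.2 p (f 0) hdp (hf.dim_eq 0 (by omega)) with h7 | h7 | h7
      exacts [h7.le, .inl h7, (hnlt h7).elim]
    · rw [lift_of_lt hl0, flagVec_of_le (by omega)]
      simp [hl0, hl0.ne']
  rw [hsign] at h
  rcases h with ⟨h5, h⟩ | ⟨h5, h⟩
  · rw [h, place_bot hup hnone h5]
  · rw [h, place_top hup hnone h5]

/-- Composition with the output of a high p-flag. -/
theorem star_up_γ (hf : S.IsFullFlag n f) (hS : S.IsPositiveOpetopicCardinal) {q : S.Face}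
    {l : ℕ} {b : Prop} (hb : b) (hl : S.dim q = l + 1) :
    S.star (S.γ q) (S.lift q l q (flagVec f n)) = place n f (S.γ q) b := by
  have hd := hS.dim_γ q (by omega)
  have hgap : gap (S.lift q l q (flagVec f n)) = l := gap_lift (hf.flagVec_ne (q := q) (by omega))
  have hdp : S.dim (S.γ q) = l := by omega
  rcases S.star_cases (S.γ q) (S.lift q l q (flagVec f n)) with ⟨h1, -, h⟩ | ⟨-, h⟩
  · omega
  rw [hgap] at h
  rcases h with ⟨h2, -⟩ | ⟨-, h⟩
  · omega
  rcases h with ⟨h2, -, s, hs, -, h⟩ | ⟨h3, h⟩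
  · obtain ⟨m, rfl⟩ : ∃ m, l = m + 1 := ⟨l - 1, by omega⟩
    rw [mem_domAt_of_dim hdp] at hs
    rw [h, hs, Nat.add_sub_cancel, lift_lift (by omega), place_up hb hdp]
  -- For `l > 0` the third clause applies with `t = γ q`. For `l = 0` the strict inequality required
  -- for `-` fails, which leaves `+γ q`.
  have hl0 : l = 0 := by
    by_contra hl0
    exact h3 ⟨by omega, by omega, S.γ q, (mem_domAt_of_dim hdp).2 rfl, q, lift_succ, .refl _⟩
  subst hl0
  rw [place_up_zero hb hdp]
  rcases h with ⟨r, s, h4, -⟩ | ⟨-, h⟩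
  · have := h4.1.1
    omega
  rcases h with ⟨⟨h5, -⟩ | ⟨-, a, ha, h5⟩, -⟩ | ⟨-, h⟩
  · omega
  · rw [lift_succ, Option.mem_some] at ha
    subst ha
    have hw := codTo_self (S.γ q)
    rw [hdp] at hw
    rw [hw] at h5
    exact (hS.irrefl _ h5).elim
  · exact h

theorem not_lt_γ_of_flat (hf : S.IsFullFlag n f) (hS : S.IsPositiveOpetopicCardinal) {q : S.Face}
    (hq : ¬ S.UpperLT (f (S.dim q)) q) (h : ∀ j t, j + 1 < S.dim q → ¬ HitsAt f q j t)
    (hd : 2 ≤ S.dim q) : ¬ S.UpperLT (f (S.dim (S.γ q))) (S.γ q) := by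
  intro h1
  have hdγ := hS.dim_γ q (by omega)
  have hcod : S.codTo (S.dim (S.γ q)) q = S.γ q := by
    rw [← hS.codTo_γ (by omega), codTo_self]
  have h2 := hf.eq_codTo_of_le hS (m := 0) hq (fun j t _ => h j t) (i := S.dim (S.γ q)) (by omega)
    (by omega) (hcod.symm ▸ h1.le)
  rw [hcod] at h2
  rw [h2] at h1
  exact hS.irrefl _ h1

theorem place_flat_γ (hf : S.IsFullFlag n f) (hS : S.IsPositiveOpetopicCardinal) {q : S.Face}
    (hq : ¬ S.UpperLT (f (S.dim q)) q) (h : ∀ j t, j + 1 < S.dim q → ¬ HitsAt f q j t)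
    (hd : 0 < S.dim q) :
    (S.UpperLE (S.codTo 0 q) (f 0) → place n f (S.γ q) (Up f (S.γ q) False) = .bot (S.γ q)) ∧
    (¬ S.UpperLE (S.codTo 0 q) (f 0) → place n f (S.γ q) (Up f (S.γ q) False) = .top (S.γ q)) := by
  have hdγ := hS.dim_γ q hd
  have hn := hf.dim_le q
  have h0 : S.codTo 0 (S.γ q) = S.codTo 0 q := hS.codTo_γ hd
  have hno : ∀ j t, j + 1 < S.dim (S.γ q) → ¬ HitsAt f (S.γ q) j t := fun j t hj hjt =>
    h j t (by omega) ⟨(hS.domAt_γ (by omega)).1 hjt.1, hjt.2⟩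
  by_cases hup : Up f (S.γ q) False
  · have h1 : S.dim (S.γ q) = 0 := by
      by_contra h2
      exact hf.not_lt_γ_of_flat hS hq h (by omega) (up_false.1 hup)
    have h2 : S.codTo 0 q = S.γ q := by rw [← h0, ← h1, codTo_self]
    rw [up_false, h1, ← h2] at hup
    exact ⟨fun h3 => (hS.not_le_of_lt hup h3).elim,
      fun _ => place_up_zero (up_false.2 (by rw [h1, ← h2]; exact hup)) h1⟩
  · exact ⟨fun h1 => place_bot hup hno (h0.symm ▸ h1), fun h1 => place_top hup hno (h0.symm ▸ h1)⟩

/-- If the final vertex of `q` came after `f 0` and that of an input did not, `f 1` would be `≤⁺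
γ^{(1)}(q)`, hence equal to it by flatness, and `f 0` would be one of its two ends; both are
excluded. The input `p = f 0` is separate: its upper lift is taken. -/
theorem place_flat_δ (hf : S.IsFullFlag n f) (hS : S.IsPositiveOpetopicCardinal) {q p : S.Face}
    (hq : ¬ S.UpperLT (f (S.dim q)) q) (h : ∀ j t, j + 1 < S.dim q → ¬ HitsAt f q j t)
    (hp : p ∈ S.δ q) :
    (S.UpperLE (S.codTo 0 q) (f 0) → place n f p (Up f p True) = .bot p) ∧
    (¬ S.UpperLE (S.codTo 0 q) (f 0) → place n f p (Up f p True) = .top p) := by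
  have hd := hS.dim_δ q p hp
  have hn := hf.dim_le q
  have hdγ := hS.dim_γ q (by omega)
  have hno : ∀ j t, j + 1 < S.dim p → ¬ HitsAt f p j t := fun j t hj =>
    hf.not_hitsAt_of_mem hS (m := 0) hq (fun j t _ => h j t) hp (Nat.zero_le j) hj
  have h0 : S.UpperLE (S.codTo 0 p) (S.codTo 0 q) := hS.codTo_le_of_mem hp (Nat.zero_le _)
  have hd0 : ∀ r : S.Face, S.dim (S.codTo 0 r) = 0 := fun r => hS.dim_codTo (Nat.zero_le _)
  have hf0 := hf.dim_eq 0 (Nat.zero_le n)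
  -- the two vertices are on the same side of `f 0`
  have key : ∀ s : S.Face, (s = S.codTo 0 p) → S.UpperLE s (f 0) →
      (S.dim p = 0 → s ≠ f 0) → S.UpperLE (S.codTo 0 q) (f 0) := by
    rintro s rfl h1 h2
    by_contra h3
    have h4 : S.UpperLT (f 0) (S.codTo 0 q) := by
      rcases hS.strictness.2 (S.codTo 0 q) (f 0) (hd0 q) hf0 with h4 | h4 | h4
      exacts [(h3 h4.le).elim, (h3 (.inl h4)).elim, h4]
    have hno0 : ∀ t ∈ S.domAt 0 q, ¬ S.UpperLE (f 0) t := by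
      intro t ht h5
      rcases Nat.eq_zero_or_pos (S.dim p) with hz | hz
      · have h6 : S.codTo 0 p = p := by rw [← hz, codTo_self]
        rw [h6] at h1 h2
        rw [mem_domAt_pred (by omega)] at ht
        have h7 := hS.eq_of_le_of_mem_δ hp ht (h1.trans h5)
        exact h2 hz (hS.antisymm h1 (h7 ▸ h5))
      · obtain ⟨r, hr⟩ := hS.domAt_nonempty (p := p) (Nat.zero_le _)
        exact hS.not_lt_domAt hp hr ht ((hS.lt_codTo hr hz).trans_le (h1.trans h5))
    rcases hf.exists_domAt_or_le hS (by omega) h4 with ⟨t, ht, h5⟩ | h5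
    · exact hno0 t ht h5
    · have h6 := hf.eq_codTo_of_le hS (m := 0) hq (fun j t _ => h j t) le_rfl (by omega) h5
      rcases mem_boundary_iff.1 (hf.mem_boundary 0 (by omega)) with h7 | h7
      · rw [zero_add, h6, γ_codTo (by omega)] at h7
        exact hS.irrefl _ (h7 ▸ h4)
      · exact hno0 _ ((mem_domAt_iff (by omega)).2 (h6 ▸ h7)) (.refl _)
  rcases Nat.eq_zero_or_pos (S.dim p) with hz | hz
  · have h6 : S.codTo 0 p = p := by rw [← hz, codTo_self]
    rw [h6] at h0 key
    have h7 : S.UpperLT p (S.codTo 0 q) := by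
      rw [← hS.codTo_γ (by omega), show (0 : ℕ) = S.dim (S.γ q) by omega, codTo_self]
      exact hS.lt_γ hp
    by_cases hup : Up f p True
    · have h1 := up_true.1 hup
      rw [hz] at h1
      exact ⟨fun h2 => (hS.not_le_of_lt (h1.trans_lt h7) h2).elim, fun _ => place_up_zero hup hz⟩
    · have h1 : ¬ S.UpperLE (f 0) p := fun h1 => hup (up_true.2 (by rw [hz]; exact h1))
      have h2 : S.UpperLT p (f 0) := by
        rcases hS.strictness.2 p (f 0) hz hf0 with h4 | h4 | h4
        exacts [h4, (h1 (.inl h4.symm)).elim, (h1 h4.le).elim]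
      have h3 := key p rfl h2.le fun _ h8 => h1 (.inl h8.symm)
      exact ⟨fun _ => place_bot hup hno (h6.symm ▸ h2.le), fun h4 => (h4 h3).elim⟩
  · have hup : ¬ Up f p True := by
      intro hup
      refine hf.not_lt_γ_of_flat hS hq h (by omega) ((show S.dim (S.γ q) = S.dim p by omega) ▸ ?_)
      exact (up_true.1 hup).trans_lt (hS.lt_γ hp)
    refine ⟨fun h1 => place_bot hup hno (h0.trans h1), fun h1 => place_top hup hno fun h2 => h1 ?_⟩
    exact key _ rfl h2 fun h3 => by omega

end IsFullFlag

/-! ### Evaluating the operations of the cylinder -/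

section Operations

variable {n l m : ℕ} {f g : ℕ → S.Face} {p t : S.Face} {x : S.Vec}

theorem topLevel_flagVec : topLevel (flagVec g m) = m :=
  topLevel_eq (flagVec_ne_none.2 le_rfl) fun _ hi => flagVec_of_lt hi

theorem lift_ne_none (h : l + 1 ≤ S.dim p) (hx : ∀ i < l, x i ≠ none) {i : ℕ} :
    S.lift p l t x i ≠ none ↔ i ≤ S.dim p ∧ i ≠ l := by
  constructor
  · intro hi
    refine ⟨?_, ?_⟩
    · by_contra hlt
      exact hi (lift_above (by omega) h)
    · rintro rfl
      exact hi lift_gap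
  · rintro ⟨h1, h2⟩
    rcases lt_or_gt_of_ne h2 with h2 | h2
    · rw [lift_of_lt h2]; exact hx i h2
    · rcases eq_or_lt_of_le (Nat.succ_le_of_lt h2) with rfl | h2
      · rw [lift_succ]; simp
      · rw [lift_of_le h2 h1]; simp

theorem lift_ne_flagVec : S.lift p l t x ≠ flagVec g m := by
  intro he
  have h1 := congrFun he (l + 1)
  have h2 := congrFun he l
  rw [lift_succ] at h1
  rw [lift_gap] at h2
  have h3 : l + 1 ≤ m := by
    rw [← flagVec_ne_none (g := g), ← h1]
    exact Option.some_ne_none t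
  exact flagVec_ne_none.2 (by omega) h2.symm

theorem not_isFlag_lift (h : l + 1 ≤ S.dim p) (ht : l + 1 = S.dim p → t = p) :
    ¬ S.IsFlag (topLevel (S.lift p l t x)) (S.lift p l t x) := by
  rw [topLevel_lift h ht]
  intro hfl
  obtain ⟨a, ha, -⟩ := hfl.face l (by omega)
  rw [lift_gap] at ha
  cases ha

theorem cylDim_flagVec : S.cylDim (.vec (flagVec g m)) = m + 1 := by
  have : {i : ℕ | flagVec g m i ≠ none} = Finset.range (m + 1) := by
    ext i
    change flagVec g m i ≠ none ↔ _
    rw [flagVec_ne_none]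
    simp
  change Set.ncard {i : ℕ | flagVec g m i ≠ none} = _
  rw [this, Set.ncard_coe_finset, Finset.card_range]

theorem cylDim_lift (h : l + 1 ≤ S.dim p) (hx : ∀ i < l, x i ≠ none) :
    S.cylDim (.vec (S.lift p l t x)) = S.dim p := by
  have : {i : ℕ | S.lift p l t x i ≠ none} = (Finset.range (S.dim p + 1)).erase l := by
    ext i
    change S.lift p l t x i ≠ none ↔ _
    rw [lift_ne_none h hx]
    simp [and_comm]
  change Set.ncard {i : ℕ | S.lift p l t x i ≠ none} = _
  rw [this, Set.ncard_coe_finset, Finset.card_erase_of_mem (by simp; omega), Finset.card_range,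
    Nat.add_sub_cancel]

theorem cylγ_lift (h : l + 1 ≤ S.dim p) (ht : l + 1 = S.dim p → t = p) :
    S.cylγ (.vec (S.lift p l t x)) = S.star (S.γ p) (S.lift p l t x) := by
  have h1 : S.lift p l t x (topLevel (S.lift p l t x)) = some p := by
    rw [topLevel_lift h ht, lift_top h ht]
  simp only [cylγ, h1, if_neg (not_isFlag_lift h ht)]

theorem mem_cylδ_lift (h : l + 1 ≤ S.dim p) (ht : l + 1 = S.dim p → t = p)
    (hx : ∀ i < l, x i ≠ none) {φ : S.CylFace} :
    φ ∈ S.cylδ (.vec (S.lift p l t x)) ↔ (∃ q ∈ S.δ p, φ = S.star q (S.lift p l t x)) ∨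
      (1 < S.dim p ∧ l + 1 = S.dim p ∧ φ = .vec (puncture (S.lift p l t x) (S.dim p))) := by
  have h1 : S.lift p l t x (topLevel (S.lift p l t x)) = some p := by
    rw [topLevel_lift h ht, lift_top h ht]
  simp only [cylδ, h1, if_neg (not_isFlag_lift h ht)]
  rw [topLevel_lift h ht]
  have h2 : S.lift p l t x (S.dim p - 1) = none ↔ l + 1 = S.dim p := by
    rw [← not_iff_not, ← ne_eq, lift_ne_none h hx]
    omega
  rw [Set.mem_union]
  refine or_congr ?_ ?_
  · simp only [Set.mem_image, eq_comm]
  · change (1 < S.dim p ∧ S.lift p l t x (S.dim p - 1) = none ∧ _) ↔ _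
    rw [h2]

theorem cylγ_flagVec (hg : S.IsFlagSeq m g) :
    S.cylγ (.vec (flagVec g m)) =
      if m = 0 then .top (g m) else .vec (puncture (flagVec g m) (m - 1)) := by
  have h : S.IsFlag (topLevel (flagVec g m)) (flagVec g m) := topLevel_flagVec.symm ▸ hg.isFlag
  simp only [cylγ, if_pos h]
  simp only [topLevel_flagVec, flagVec_of_le le_rfl]

theorem cylδ_flagVec (hg : S.IsFlagSeq m g) :
    S.cylδ (.vec (flagVec g m)) = if m = 0 then {.bot (g m)} else
      {.vec (puncture (flagVec g m) m), S.low m (flagVec g m) (g m)} := by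
  have h : S.IsFlag (topLevel (flagVec g m)) (flagVec g m) := topLevel_flagVec.symm ▸ hg.isFlag
  simp only [cylδ, if_pos h]
  simp only [topLevel_flagVec, flagVec_of_le le_rfl]

theorem puncture_of_ne {i j : ℕ} (h : j ≠ i) : puncture x i j = x j := Function.update_of_ne h _ _

theorem puncture_self {i : ℕ} : puncture x i i = none := Function.update_self _ _ _

theorem puncture_flagVec_succ : puncture (flagVec g (m + 1)) (m + 1) = flagVec g m := by
  funext i
  by_cases hi : i = m + 1
  · rw [hi, puncture_self, flagVec_of_lt (by omega)]
  · rw [puncture_of_ne hi]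
    unfold flagVec
    simp only [show i ≤ m + 1 ↔ i ≤ m by omega]

/-- A lift is obtained by removing an entry of a flag. -/
theorem lift_eq_puncture (hx : ∀ i < l, x i = some (g i)) (h : l + 1 ≤ S.dim p)
    (ht : g (l + 1) = t) (hg : ∀ i, l + 2 ≤ i → i ≤ S.dim p → g i = S.codTo i p) :
    S.lift p l t x = puncture (flagVec g (S.dim p)) l := by
  funext i
  rcases lt_trichotomy i l with hi | rfl | hi
  · rw [lift_of_lt hi, puncture_of_ne hi.ne, flagVec_of_le (by omega), hx i hi]
  · rw [lift_gap, puncture_self]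
  · rw [puncture_of_ne hi.ne']
    rcases eq_or_lt_of_le (Nat.succ_le_of_lt hi) with rfl | hi
    · rw [lift_succ, flagVec_of_le h, ht]
    · rcases le_or_gt i (S.dim p) with h1 | h1
      · rw [lift_of_le hi h1, flagVec_of_le h1, hg i hi h1]
      · rw [lift_above h1 h, flagVec_of_lt h1]

theorem puncture_lift_top (hl : S.dim p = l + 1) (hx : ∀ i < l, x i = some (g i)) (hl0 : 0 < l) :
    puncture (S.lift p l t x) (S.dim p) = flagVec g (l - 1) := by
  funext i
  rw [hl]
  rcases lt_trichotomy i l with hi | rfl | hi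
  · rw [puncture_of_ne (by omega), lift_of_lt hi, hx i hi, flagVec_of_le (by omega)]
  · rw [puncture_of_ne (by omega), lift_gap, flagVec_of_lt (by omega)]
  · rw [flagVec_of_lt (by omega)]
    rcases eq_or_ne i (l + 1) with rfl | h
    · exact puncture_self
    · rw [puncture_of_ne h, lift_above (by omega) hl.ge]

end Operations

/-! ### The embedding of the prism into the cylinder -/

/-- The face of the cylinder that corresponds to a face of the prism. -/
noncomputable def toCyl (n : ℕ) (f : ℕ → S.Face) : (S.prism n f).Face → S.CylFace :=
  Sum.elim (fun p => place n f p.1.1 p.1.2) fun j => .vec (flagVec f j)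

/-- The top entry of a face of the cylinder. -/
noncomputable def CylFace.face : S.CylFace → Option S.Face
  | .bot p => some p
  | .top p => some p
  | .vec x => x (topLevel x)

section

variable {n : ℕ} {f : ℕ → S.Face}

@[simp] theorem toCyl_pt (p : S.Face) (a : Prop) :
    toCyl n f (prism.pt n f p a) = place n f p (Up f p a) := rfl

@[simp] theorem toCyl_fl (j : Fin (n + 1)) : toCyl n f (prism.fl f j) = .vec (flagVec f j) := rfl

/-- The shape of the face of the cylinder that corresponds to a lift of `p`. -/
theorem place_shape (hS : S.IsPositiveOpetopicCardinal) (n : ℕ) (f : ℕ → S.Face) {p : S.Face}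
    {b : Prop} (hb : Up f p b ↔ b) :
    (b ∧ S.UpperLE (f (S.dim p)) p ∧ ∃ l, S.dim p = l + 1 ∧
      place n f p b = .vec (S.lift p l p (flagVec f n))) ∨
    (b ∧ S.dim p = 0 ∧ S.UpperLE (f 0) p ∧ place n f p b = .top p) ∨
    (¬ b ∧ ¬ S.UpperLT (f (S.dim p)) p ∧ ∃ l t, l + 1 < S.dim p ∧ HitsAt f p l t ∧
      (∀ j' t', l < j' → j' + 1 < S.dim p → ¬ HitsAt f p j' t') ∧
      place n f p b = .vec (S.lift p l t (flagVec f n))) ∨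
    (¬ b ∧ ¬ S.UpperLT (f (S.dim p)) p ∧ (∀ j t, j + 1 < S.dim p → ¬ HitsAt f p j t) ∧
      ((S.UpperLE (S.codTo 0 p) (f 0) ∧ place n f p b = .bot p) ∨
        (¬ S.UpperLE (S.codTo 0 p) (f 0) ∧ place n f p b = .top p))) := by
  by_cases h : b
  · have h1 := (hb.2 h).le
    rcases Nat.eq_zero_or_pos (S.dim p) with h2 | h2
    · exact .inr (.inl ⟨h, h2, h2 ▸ h1, place_up_zero h h2⟩)
    · exact .inl ⟨h, h1, S.dim p - 1, by omega, place_up h (by omega)⟩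
  · have h1 : ¬ S.UpperLT (f (S.dim p)) p := fun h1 => h (hb.1 (up_of_lt h1))
    rcases place_cases hS n f p h with h2 | h2
    · exact .inr (.inr (.inl ⟨h, h1, h2⟩))
    · exact .inr (.inr (.inr ⟨h, h1, h2.1, h2.2⟩))

theorem face_place (hS : S.IsPositiveOpetopicCardinal) {p : S.Face}
    {b : Prop} (hb : Up f p b ↔ b) : (place n f p b).face = some p := by
  have key : ∀ {l t}, l + 1 ≤ S.dim p → (l + 1 = S.dim p → t = p) →
      CylFace.face (.vec (S.lift p l t (flagVec f n))) = some p := by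
    intro l t h1 h2
    change S.lift p l t _ (topLevel _) = _
    rw [topLevel_lift h1 h2, lift_top h1 h2]
  rcases place_shape hS n f hb with ⟨-, -, l, hl, h⟩ | ⟨-, -, -, h⟩ |
    ⟨-, -, l, t, hl, -, -, h⟩ | ⟨-, -, -, ⟨-, h⟩ | ⟨-, h⟩⟩
  · rw [h]; exact key hl.ge fun _ => rfl
  · rw [h]; rfl
  · rw [h]; exact key hl.le fun h => by omega
  · rw [h]; rfl
  · rw [h]; rfl

theorem place_ne_flagVec (hS : S.IsPositiveOpetopicCardinal) {p : S.Face}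
    {b : Prop} (hb : Up f p b ↔ b) {m : ℕ} {g : ℕ → S.Face} :
    place n f p b ≠ .vec (flagVec g m) := by
  rcases place_shape hS n f hb with ⟨-, -, l, hl, h⟩ | ⟨-, -, -, h⟩ |
    ⟨-, -, l, t, hl, -, -, h⟩ | ⟨-, -, -, ⟨-, h⟩ | ⟨-, h⟩⟩ <;> rw [h]
  · exact fun h => lift_ne_flagVec (CylFace.vec.inj h)
  · simp
  · exact fun h => lift_ne_flagVec (CylFace.vec.inj h)
  · simp
  · simp

end

namespace IsFullFlag

variable {n : ℕ} {f : ℕ → S.Face}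

/-- The upper lift has its gap right below the top entry, while the lower one has a deeper gap or is
flat; for a vertex the signs differ. -/
theorem place_ne_place (hf : S.IsFullFlag n f) (hS : S.IsPositiveOpetopicCardinal) {p : S.Face}
    {b c : Prop} (hb : Up f p b ↔ b) (hc : Up f p c ↔ c) (hbt : b) (hcf : ¬ c) :
    place n f p b ≠ place n f p c := by
  have hn := hf.dim_le p
  intro he
  rcases place_shape hS n f hb with ⟨-, -, l, hl, h⟩ | ⟨-, hd, hle, h⟩ | ⟨h, -⟩ | ⟨h, -⟩
  · rw [h] at he
    rcases place_shape hS n f hc with ⟨h, -⟩ | ⟨h, -⟩ |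
      ⟨-, -, k, t, hk, -, -, h⟩ | ⟨-, -, -, ⟨-, h⟩ | ⟨-, h⟩⟩
    · exact hcf h
    · exact hcf h
    · rw [h] at he
      have h1 := congrArg gap (CylFace.vec.inj he)
      rw [gap_lift (hf.flagVec_ne (q := p) (by omega)),
        gap_lift (hf.flagVec_ne (q := p) (by omega))] at h1
      omega
    · rw [h] at he; cases he
    · rw [h] at he; cases he
  · rw [h] at he
    rcases place_shape hS n f hc with ⟨h, -⟩ | ⟨h, -⟩ |
      ⟨-, -, k, t, hk, -, -, h⟩ | ⟨-, h1, -, ⟨-, h⟩ | ⟨h2, -⟩⟩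
    · exact hcf h
    · exact hcf h
    · omega
    · rw [h] at he; cases he
    · have h3 : S.codTo 0 p = p := by rw [← hd, codTo_self]
      rw [hd] at h1
      rw [h3] at h2
      exact h2 (.inl (hle.resolve_right h1).symm)
  · exact h hbt
  · exact h hbt

theorem toCyl_injective (hf : S.IsFullFlag n f) (hS : S.IsPositiveOpetopicCardinal) :
    Function.Injective (toCyl n f) := by
  intro φ ψ he
  rcases prism.face_cases φ with ⟨p, a, ha, rfl⟩ | ⟨i, rfl⟩ <;>
    rcases prism.face_cases ψ with ⟨q, b, hb, rfl⟩ | ⟨j, rfl⟩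
  · rw [toCyl_pt, toCyl_pt, propext ha, propext hb] at he
    have h1 := congrArg CylFace.face he
    rw [face_place hS ha, face_place hS hb, Option.some.injEq] at h1
    subst h1
    rw [prism.pt_eq_pt, ha, hb]
    refine ⟨rfl, ?_⟩
    by_contra hne
    by_cases h : a
    · exact hf.place_ne_place hS ha hb h (by tauto) he
    · exact hf.place_ne_place hS hb ha (by tauto) h he.symm
  · rw [toCyl_pt, propext ha, toCyl_fl] at he
    exact (place_ne_flagVec hS ha he).elim
  · rw [toCyl_pt, propext hb, toCyl_fl] at he
    exact (place_ne_flagVec hS hb he.symm).elim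
  · rw [toCyl_fl, toCyl_fl] at he
    have h1 := congrArg S.cylDim he
    rw [cylDim_flagVec, cylDim_flagVec] at h1
    rw [prism.fl_eq_fl]
    exact Fin.ext (by omega)

theorem cylDim_toCyl (hf : S.IsFullFlag n f) (hS : S.IsPositiveOpetopicCardinal)
    (φ : (S.prism n f).Face) : S.cylDim (toCyl n f φ) = (S.prism n f).dim φ := by
  rcases prism.face_cases φ with ⟨p, a, ha, rfl⟩ | ⟨i, rfl⟩
  · rw [toCyl_pt, propext ha, prism.dim_pt]
    rcases place_shape hS n f ha with ⟨-, -, l, hl, h⟩ | ⟨-, -, -, h⟩ |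
      ⟨-, -, l, t, hl, -, -, h⟩ | ⟨-, -, -, ⟨-, h⟩ | ⟨-, h⟩⟩ <;> rw [h]
    · exact cylDim_lift hl.ge (hf.flagVec_ne (q := p) (by omega))
    · rfl
    · exact cylDim_lift hl.le (hf.flagVec_ne (q := p) (by omega))
    · rfl
    · rfl
  · rw [toCyl_fl, cylDim_flagVec, prism.dim_fl]

theorem isFlagSeq (hf : S.IsFullFlag n f) {m : ℕ} (hm : m ≤ n) : S.IsFlagSeq m f :=
  ⟨fun i hi => hf.dim_eq i (hi.trans hm), fun i hi => hf.mem_boundary i (by omega)⟩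

theorem puncture_pred (hf : S.IsFullFlag n f) {m : ℕ} (hm : m + 1 ≤ n) :
    puncture (flagVec f (m + 1)) m = S.lift (f (m + 1)) m (f (m + 1)) (flagVec f n) := by
  have hd := hf.dim_eq _ hm
  rw [lift_eq_puncture (g := f) (fun i hi => flagVec_of_le (by omega)) hd.ge rfl
    fun i h1 h2 => by omega, hd]

theorem cylγ_toCyl (hf : S.IsFullFlag n f) (hS : S.IsPositiveOpetopicCardinal)
    (φ : (S.prism n f).Face) (hφ : 0 < (S.prism n f).dim φ) :
    S.cylγ (toCyl n f φ) = toCyl n f ((S.prism n f).γ φ) := by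
  rcases prism.face_cases φ with ⟨p, a, ha, rfl⟩ | ⟨⟨m, hm⟩, rfl⟩
  · rw [prism.dim_pt] at hφ
    rw [prism.γ_pt, toCyl_pt, toCyl_pt, propext ha]
    rcases place_shape hS n f ha with ⟨ht, hle, l, hl, h⟩ | ⟨-, hd, -, h⟩ |
      ⟨hnt, hnlt, l, t, hl, ht, hmax, h⟩ | ⟨hnt, hnlt, hno, hbt⟩
    · rw [h, cylγ_lift hl.ge fun _ => rfl]
      exact hf.star_up_γ hS (hf.up_γ hS hφ (ha.2 ht) ht) hl
    · omega
    · rw [h, cylγ_lift hl.le fun h => by omega, eq_false hnt]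
      exact hf.star_low_γ hS hnlt hl ht hmax
    · have h1 := hf.place_flat_γ hS hnlt hno hφ
      rw [eq_false hnt] at hbt ⊢
      rcases hbt with ⟨h2, h⟩ | ⟨h2, h⟩
      · rw [h, h1.1 h2]; rfl
      · rw [h, h1.2 h2]; rfl
  · have h1 := hf.dim_eq m (by omega)
    have h2 : Up f (f m) True := (hf.up_flag hS (by omega) True).2 trivial
    rw [toCyl_fl, cylγ_flagVec (hf.isFlagSeq (by omega)), prism.γ_fl, toCyl_pt]
    rcases m with _ | m
    · rw [if_pos rfl, place_up_zero h2 h1]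
    · rw [if_neg m.succ_ne_zero, place_up h2 h1, Nat.add_sub_cancel, hf.puncture_pred (m := m) (by omega)]

/-- While the flag follows iterated codomains it lies strictly above the domains, so nothing is hit.
Its last proper domain, at the low level, is therefore the greatest hit; without one in positive
dimension the flag is first or last, and the face is flat. -/
theorem low_eq_place (hf : S.IsFullFlag n f) (hS : S.IsPositiveOpetopicCardinal) {m : ℕ}
    (hm : 1 ≤ m) (hmn : m ≤ n) :
    S.low m (flagVec f m) (f m) = place n f (f m) (Up f (f m) False) := by
  have hg := hf.isFlagSeq hmn
  have hd := hf.dim_eq m hmn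
  have hup : ¬ Up f (f m) False := (hf.up_flag hS hmn False).1
  have hnohit : ∀ {k}, (∀ i, k ≤ i → i ≤ m → f i = S.codTo i (f m)) → ∀ j t, k ≤ j + 1 →
      j + 1 < S.dim (f m) → ¬ HitsAt f (f m) j t := by
    rintro k h j t h1 h2 ⟨h3, h4⟩
    rw [h (j + 1) h1 (by omega)] at h4
    exact hS.not_le_of_lt (hS.lt_codTo h3 h2) h4
  rcases hg.trichotomy hm with ⟨h, h0⟩ | ⟨j, hj, hδ, h⟩
  · have hno : ∀ j t, j + 1 < S.dim (f m) → ¬ HitsAt f (f m) j t := fun j t =>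
      hnohit h j t (by omega)
    have hγ : S.codTo 0 (f m) = S.γ (f 1) := by rw [h 1 le_rfl hm, γ_codTo (by omega)]
    rcases h0 with h0 | h0
    · have hfirst : S.IsFirstFlag m (flagVec f m) := by
        rw [hg.isFirstFlag_iff hS]
        intro i hi
        rcases Nat.eq_zero_or_pos i with rfl | hi0
        · rw [h0, hγ]
        · exact h i hi0 hi
      rw [low, if_pos hfirst, place_bot hup hno (.inl (hγ.trans h0.symm))]
    · have hne : f 0 ≠ S.γ (f 1) := fun h1 => hS.γ_notMem_δ (f 1) (h1 ▸ h0)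
      rw [low, if_neg, if_pos ((hg.isLastFlag_iff hS hm).2 ⟨h, h0⟩), place_top hup hno]
      · rw [hγ]
        exact hS.not_le_of_lt (hS.lt_γ h0)
      · rw [hg.isFirstFlag_iff hS]
        exact fun h1 => hne ((h1 0 (by omega)).trans hγ)
  · obtain ⟨h1, h2, h3⟩ := hg.lowLevel_eq hS hj hδ h
    have hhit : HitsAt f (f m) j (f (j + 1)) :=
      ⟨(IsPositiveHypergraph.mem_domAt_iff (by omega)).2 (h (j + 2) le_rfl (by omega) ▸ hδ),
        .refl _⟩
    rw [low, if_neg h1, if_neg h2, h3, place_of_hitsAt hS hup (by omega) hhit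
      fun j' t' h4 h5 => hnohit h j' t' (by omega) h5,
      lift_eq_puncture (g := f) (fun i hi => flagVec_of_le (by omega)) (by omega) rfl
      fun i h4 h5 => h i h4 (by omega), hd]

theorem cylδ_toCyl (hf : S.IsFullFlag n f) (hS : S.IsPositiveOpetopicCardinal)
    (φ : (S.prism n f).Face) :
    S.cylδ (toCyl n f φ) = toCyl n f '' (S.prism n f).δ φ := by
  ext ψ
  rw [Set.mem_image]
  rcases prism.face_cases φ with ⟨p, a, ha, rfl⟩ | ⟨⟨m, hm⟩, rfl⟩
  · have hn := hf.dim_le p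
    simp only [prism.mem_δ_pt, toCyl_pt, propext ha]
    -- The extra input `fl f j`, with `j + 2 = dim p`, becomes the flag that a high p-flag has as an
    -- additional input.
    have hδ : (∃ χ, ((∃ t ∈ S.δ p, χ = prism.pt n f t (¬ a)) ∨
        (a ∧ ∃ j : Fin (n + 1), j.1 + 2 = S.dim p ∧ χ = prism.fl f j)) ∧ toCyl n f χ = ψ) ↔
        (∃ t ∈ S.δ p, ψ = place n f t (Up f t (¬ a))) ∨
        (a ∧ 1 < S.dim p ∧ ψ = .vec (flagVec f (S.dim p - 2))) := by
      constructor
      · rintro ⟨χ, ⟨t, ht, rfl⟩ | ⟨h1, j, hj, rfl⟩, rfl⟩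
        · exact .inl ⟨t, ht, rfl⟩
        · exact .inr ⟨h1, by omega, by rw [toCyl_fl, ← hj, Nat.add_sub_cancel]⟩
      · rintro (⟨t, ht, rfl⟩ | ⟨h1, h2, rfl⟩)
        · exact ⟨_, .inl ⟨t, ht, rfl⟩, rfl⟩
        · exact ⟨_, .inr ⟨h1, ⟨S.dim p - 2, by omega⟩, by simp only; omega, rfl⟩, rfl⟩
    rw [hδ]
    rcases place_shape hS n f ha with ⟨ht, hle, l, hl, h⟩ | ⟨ht, hd, -, h⟩ |
      ⟨hnt, hnlt, l, t, hl, ht, hmax, h⟩ | ⟨hnt, hnlt, hno, hbt⟩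
    · rw [h, mem_cylδ_lift hl.ge (fun _ => rfl) (hf.flagVec_ne (q := p) (by omega)), eq_true ht, not_true]
      refine or_congr (exists_congr fun q => and_congr_right fun hq => ?_) ?_
      · rw [hf.star_up_δ hS hle hl hq]
      · simp only [true_and, hl]
        refine and_congr_right fun h1 => ?_
        rw [← hl, puncture_lift_top (g := f) hl (fun i hi => flagVec_of_le (by omega)) (by omega),
          show S.dim p - 2 = l - 1 by omega]
    · have hδp : ∀ t, t ∉ S.δ p := fun t ht => by
        have := hS.dim_δ p t ht
        omega
      have h1 : ¬ 1 < S.dim p := by omega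
      rw [h]
      simp [cylδ, hδp, h1]
    · have h1 : l + 1 ≠ S.dim p := hl.ne
      rw [h, mem_cylδ_lift hl.le (fun h => by omega) (hf.flagVec_ne (q := p) (by omega)), eq_false hnt,
        not_false_eq_true]
      simp only [h1, false_and, and_false, or_false]
      refine exists_congr fun q => and_congr_right fun hq => ?_
      rw [hf.star_low_δ hS hnlt hl ht hmax hq]
    · rw [eq_false hnt] at hbt ⊢
      simp only [not_false_eq_true, false_and, or_false]
      rcases hbt with ⟨h2, h⟩ | ⟨h2, h⟩
      · rw [h]
        change ψ ∈ CylFace.bot '' S.δ p ↔ _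
        rw [Set.mem_image]
        refine exists_congr fun q => and_congr_right fun hq => ?_
        rw [(hf.place_flat_δ hS hnlt hno hq).1 h2, eq_comm]
      · rw [h]
        change ψ ∈ CylFace.top '' S.δ p ↔ _
        rw [Set.mem_image]
        refine exists_congr fun q => and_congr_right fun hq => ?_
        rw [(hf.place_flat_δ hS hnlt hno hq).2 h2, eq_comm]
  · have hmn : m ≤ n := by omega
    have h1 := hf.dim_eq m hmn
    simp only [prism.mem_δ_fl, toCyl_fl, cylδ_flagVec (hf.isFlagSeq hmn)]
    rcases m with _ | m
    · have hup : ¬ Up f (f 0) False := (hf.up_flag hS hmn False).1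
      have h2 : place n f (f 0) (Up f (f 0) False) = .bot (f 0) :=
        place_bot hup (fun j t hj => by omega) (.inl (by
          conv_lhs => rw [← h1]
          rw [h1]
          have := codTo_self (f 0)
          rwa [h1] at this))
      simp [h2, eq_comm]
    · rw [if_neg (by omega), hf.low_eq_place hS (by omega) hmn, puncture_flagVec_succ]
      simp only [Set.mem_insert_iff, Set.mem_singleton_iff]
      constructor
      · rintro (rfl | rfl)
        · exact ⟨_, .inr ⟨⟨m, by omega⟩, rfl, rfl⟩, rfl⟩
        · exact ⟨_, .inl rfl, rfl⟩
      · rintro ⟨χ, rfl | ⟨i, hi, rfl⟩, rfl⟩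
        · exact .inr rfl
        · left
          rw [toCyl_fl, show i.1 = m by simpa using hi]

/-- A lift can be completed to a flag. -/
theorem exists_flagSeq (hf : S.IsFullFlag n f) (hS : S.IsPositiveOpetopicCardinal) {q t : S.Face}
    {l : ℕ} (hl : l + 1 ≤ S.dim q) (ht : t ∈ S.domAt (l + 1) q) (hle : S.UpperLE (f (l + 1)) t) :
    ∃ g, S.IsFlagSeq (S.dim q) g ∧ (∀ i < l, g i = f i) ∧ g (l + 1) = t ∧
      (∀ i, l + 2 ≤ i → i ≤ S.dim q → g i = S.codTo i q) := by
  have hn := hf.dim_le q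
  have hdt := hS.dim_of_mem_domAt ht
  -- Only the entry at the gap is missing. It has to join `t` to `f (l - 1)`, and for `l = 0` any
  -- vertex of `t` will do.
  obtain ⟨y, hy, hy'⟩ : ∃ y ∈ S.boundary t, 0 < l → f (l - 1) ∈ S.boundary y := by
    rcases Nat.eq_zero_or_pos l with rfl | h0
    · exact ⟨_, γ_mem_boundary _, fun h => absurd h (lt_irrefl _)⟩
    · obtain ⟨y, h1, h2⟩ := hS.exists_boundary_boundary (x := f (l + 1))
        (by rw [hf.dim_eq _ (by omega)]; omega) hle (hf.mem_boundary l (by omega))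
        (show f (l - 1) ∈ S.boundary (f l) by
          have := hf.mem_boundary (l - 1) (by omega)
          rwa [Nat.sub_add_cancel h0] at this)
      exact ⟨y, h1, fun _ => h2⟩
  have hdy : S.dim y = l := by
    have := hS.dim_boundary (by omega) hy
    omega
  let g : ℕ → S.Face := fun i =>
    if i < l then f i else if i = l then y else if i = l + 1 then t else S.codTo i q
  have g1 : ∀ i < l, g i = f i := fun i hi => if_pos hi
  have g2 : g l = y := by simp [g]
  have g3 : g (l + 1) = t := by simp [g]
  have g4 : ∀ i, l + 2 ≤ i → g i = S.codTo i q := fun i hi => by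
    simp only [g]
    rw [if_neg (by omega), if_neg (by omega), if_neg (by omega)]
  refine ⟨g, ⟨fun i hi => ?_, fun i hi => ?_⟩, g1, g3, fun i hi _ => g4 i hi⟩
  · rcases lt_trichotomy i l with h | rfl | h
    · rw [g1 i h, hf.dim_eq i (by omega)]
    · rw [g2, hdy]
    · rcases eq_or_lt_of_le (Nat.succ_le_of_lt h) with rfl | h
      · rw [g3, hdt]
      · rw [g4 i h, hS.dim_codTo hi]
  · rcases lt_trichotomy i l with h | rfl | h
    · rw [g1 i h]
      rcases eq_or_lt_of_le (Nat.succ_le_of_lt h) with h' | h'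
      · have := hy' (by omega)
        rw [← h'] at g2 this
        rw [g2]
        exact this
      · rw [g1 _ h']
        exact hf.mem_boundary i (by omega)
    · rw [g2, g3]; exact hy
    · rcases eq_or_lt_of_le (Nat.succ_le_of_lt h) with rfl | h
      · rw [g3, g4 _ le_rfl]
        exact δ_subset_boundary _
          ((IsPositiveHypergraph.mem_domAt_iff (by omega)).1 ht)
      · rw [g4 i h, g4 (i + 1) (by omega), ← γ_codTo (p := q) (j := i) hi]
        exact γ_mem_boundary _

theorem isCylFace_toCyl (hf : S.IsFullFlag n f) (hS : S.IsPositiveOpetopicCardinal)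
    (φ : (S.prism n f).Face) : S.IsCylFace (toCyl n f φ) := by
  rcases prism.face_cases φ with ⟨p, a, ha, rfl⟩ | ⟨⟨m, hm⟩, rfl⟩
  · have hn := hf.dim_le p
    rw [toCyl_pt, propext ha]
    rcases place_shape hS n f ha with ⟨-, hle, l, hl, h⟩ | ⟨-, -, -, h⟩ |
      ⟨-, -, l, t, hl, ht, -, h⟩ | ⟨-, -, -, ⟨-, h⟩ | ⟨-, h⟩⟩ <;> rw [h]
    · obtain ⟨g, h1, h2, h3, h4⟩ := hf.exists_flagSeq hS hl.ge
        ((IsPositiveHypergraph.mem_domAt_of_dim hl).2 rfl) (hl ▸ hle)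
      refine ⟨S.dim p, .inr ⟨flagVec g (S.dim p), h1.isFlag, .inl ⟨by omega, ?_⟩⟩⟩
      rw [lift_eq_puncture (fun i hi => by rw [flagVec_of_le (by omega), h2 i hi]) hl.ge h3 h4]
      congr 1
      omega
    · trivial
    · obtain ⟨g, h1, h2, h3, h4⟩ := hf.exists_flagSeq hS hl.le ht.1 ht.2
      have hδ : g (l + 1) ∈ S.δ (g (l + 2)) := by
        rw [h3, h4 _ le_rfl hl]
        exact (IsPositiveHypergraph.mem_domAt_iff hl).1 ht.1
      have htop : g (S.dim p) = p := by rw [h4 _ hl le_rfl, codTo_self]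
      obtain ⟨h5, h6, h7⟩ := h1.lowLevel_eq hS hl hδ (fun i hi hi' => by rw [htop, h4 i hi hi'])
      refine ⟨S.dim p, .inr ⟨flagVec g (S.dim p), h1.isFlag, .inr ⟨by omega, h5, h6, ?_⟩⟩⟩
      rw [lift_eq_puncture (fun i hi => by rw [flagVec_of_le (by omega), h2 i hi]) hl.le h3 h4, h7]
    · trivial
    · trivial
  · exact ⟨m, .inl (hf.isFlagSeq (by omega)).isFlag⟩

end IsFullFlag

end HypergraphData

theorem mainTheorem6 (P : HypergraphData.{u}) (hP : P.IsPositiveOpetope)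
    (x : P.Vec) (hx : P.IsMaximalFlag x) :
    (∀ φ : (P.flagHypergraph x).Face, P.IsCylFace φ.1) ∧
      (P.flagHypergraph x).IsPositiveOpetope := by
  obtain ⟨n, hn, hflag⟩ := hx
  obtain ⟨f, hseq, rfl⟩ := hflag.exists_seq
  have hf : P.IsFullFlag n f :=
    ⟨hseq.dim_eq, hseq.mem_boundary, fun p => hn.2 (Set.mem_range_self p)⟩
  have hS := hP.toIsPositiveOpetopicCardinal
  -- The maximal flag is the image of the top prism `fl f n`, whose dimension `n + 1` is the
  -- largest.
  have key := (hf.prism_isPositiveOpetope hP).generatedBy (T := P.cylinder)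
    (Φ := HypergraphData.toCyl n f) (hf.toCyl_injective hS) (hf.cylDim_toCyl hS) (hf.cylγ_toCyl hS)
    (hf.cylδ_toCyl hS)
    (τ := HypergraphData.prism.fl f ⟨n, n.lt_succ_self⟩) fun φ => by
      rcases HypergraphData.prism.face_cases φ with ⟨p, a, -, rfl⟩ | ⟨j, rfl⟩
      · exact (hf.dim_le p).trans n.le_succ
      · exact j.2
  refine ⟨fun φ => ?_, key.2⟩
  obtain ⟨ψ, h⟩ := key.1 _ φ.2
  rw [← h]
  exact hf.isCylFace_toCyl hS ψ
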